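/- **Theorem (De Giorgi).** Let $d\ge 1$, let $B_r$ denote the open Euclidean ball of radius $r$ centred at $0$ in $\mathbb{R}^d$, and let $B_r(x_0)$ be the one centred at $x_0$. For constants $C^\pm\ge 1$ and $S\in L^2(B_1)$, a function $u\in H^1(B_1)$ belongs to the elliptic De Giorgi class $\mathrm{DG}(B_1,S)$ with constants $C^+,C^-$ if for both signs, for all balls $B_R(x_0)\subset B_1$, all $r\in(0,R)$ and all $\kappa\in\mathbb{R}$, $$\int_{B_r(x_0)}|\nabla (u-\kappa)_\pm|^2\,dx\le \frac{C^\pm}{(R-r)^2}\int_{B_R(x_0)}|(u-\kappa)_\pm|^2\,dx+C^\pm\int_{B_R(x_0)}|S|\,(u-\kappa)_\pm\,dx ,$$ where $(t)_+=\max(t,0)$, $(t)_-=\max(-t,0)$ and $\nabla$ is the weak gradient. (i) For all $C^+,C^-\ge 1$ there exist $\alpha\in(0,1]$ and $C>0$, depending only on $d$, $C^+$ and $C^-$, such that for every $S\in L^\infty(B_1)$, every $u$ in the class $\mathrm{DG}(B_1,S)$ with constants $C^+,C^-$ coincides almost everywhere in $B_1$ with a function that is $\alpha$-Hölder continuous on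 $B_r$ for each $r<1$ and that (still denoted by $u$) satisfies $$\|u\|_{C^\alpha(B_{1/2})}\le C\left(\|u\|_{L^2(B_1)}+\|S\|_{L^\infty(B_1)}\right),\qquad \|u\|_{C^\alpha(F)}=\sup_F|u|+\sup_{x\ne y\in F}\frac{|u(x)-u(y)|}{|x-y|^\alpha}.$$ (ii) In particular, for all $\lambda,\Lambda>0$ there exist $C^\pm\ge1$, $\alpha\in(0,1]$ and $C>0$, depending only on $d,\lambda,\Lambda$, such that the following holds for every measurable field $A$ of real symmetric $d\times d$ matrices on $B_1$ with $\lambda|\xi|^2\le A(x)\xi\cdot\xi\le\Lambda|\xi|^2$ for a.e. $x\in B_1$ and all $\xi\in\mathbb{R}^d$, and every $S\in L^\infty(B_1)$: each weak solution $u$ of $-\mathrm{div}(A\nabla u)=S$ in $B_1$, that is, each $u\in H^1(B_1)$ with $\int_{B_1}A\nabla u\cdot\nabla\varphi\,dx=\int_{B_1}S\varphi\,dx$ for all $\varphi\in C^\infty_c(B_1)$, belongs to $\mathrm{DG}(B_1,S)$ with constants $C^+,C^-$, and the conclusion of (i) holds for $u$ with this $\alpha$ and $C$. -/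

import Mathlib

open MeasureTheory Metric
open scoped ENNReal NNReal ContDiff

namespace DeGiorgi

/-- The Euclidean space of dimension `d`. -/
abbrev Eucl (d : ℕ) : Type := EuclideanSpace ℝ (Fin d)

/-- Smooth test functions with compact support in the open set `Ω`. -/
structure IsTestFunction {d : ℕ} (Ω : Set (Eucl d)) (φ : Eucl d → ℝ) : Prop where
  smooth : ContDiff ℝ ∞ φ
  compact : HasCompactSupport φ
  support : tsupport φ ⊆ Ω

/-- The locally integrable vector field `g` is the gradient of the locally integrable function `u`
in the sense of distributions in `Ω`. -/
structure HasWeakGradient {d : ℕ} (Ω : Set (Eucl d)) (u : Eucl d → ℝ) (g : Eucl d → Eucl d) :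
    Prop where
  locInt : LocallyIntegrableOn u Ω volume
  locInt_grad : LocallyIntegrableOn g Ω volume
  parts : ∀ φ : Eucl d → ℝ, IsTestFunction Ω φ → ∀ i : Fin d,
    ∫ x in Ω, u x * (gradient φ x) i = - ∫ x in Ω, (g x) i * φ x

open Classical in
/-- A weak gradient of `u` in `Ω` (it is unique almost everywhere in `Ω`);
the value is `0` if there is none. -/
noncomputable def weakGrad {d : ℕ} (Ω : Set (Eucl d)) (u : Eucl d → ℝ) : Eucl d → Eucl d :=
  if h : ∃ g : Eucl d → Eucl d, HasWeakGradient Ω u g then h.choose else 0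

/-- The Sobolev space `H¹(Ω)`. -/
def MemH1 {d : ℕ} (Ω : Set (Eucl d)) (u : Eucl d → ℝ) : Prop :=
  MemLp u 2 (volume.restrict Ω) ∧
    ∃ g : Eucl d → Eucl d, MemLp g 2 (volume.restrict Ω) ∧ HasWeakGradient Ω u g

/-- The class of measurable fields of real symmetric matrices in `Ω` satisfying the ellipticity
condition with constants `lam` and `Lam`. -/
structure IsElliptic {d : ℕ} (lam Lam : ℝ) (Ω : Set (Eucl d))
    (A : Eucl d → Matrix (Fin d) (Fin d) ℝ) : Prop where
  measurable : ∀ i j : Fin d, AEMeasurable (fun x => A x i j) (volume.restrict Ω)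
  symmetric : ∀ᵐ x ∂(volume.restrict Ω), (A x).IsSymm
  elliptic : ∀ᵐ x ∂(volume.restrict Ω), ∀ ξ : Eucl d,
    lam * ‖ξ‖ ^ 2 ≤ inner ℝ (Matrix.toEuclideanLin (A x) ξ) ξ ∧
      inner ℝ (Matrix.toEuclideanLin (A x) ξ) ξ ≤ Lam * ‖ξ‖ ^ 2

/-- Weak solutions of `-div (A ∇u) = S` in `Ω`. -/
structure IsWeakSolution {d : ℕ} (Ω : Set (Eucl d)) (A : Eucl d → Matrix (Fin d) (Fin d) ℝ)
    (S u : Eucl d → ℝ) : Prop where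
  source : IntegrableOn S Ω volume
  memH1 : MemH1 Ω u
  weak_eq : ∀ φ : Eucl d → ℝ, IsTestFunction Ω φ →
    ∫ x in Ω, inner ℝ (Matrix.toEuclideanLin (A x) (weakGrad Ω u x)) (gradient φ x)
      = ∫ x in Ω, S x * φ x

/-- The local energy estimates in `B`, with constant `C` and source `S`, for a function `w`
(which is going to be a truncation `(u - κ)₊` or `(u - κ)₋`). -/
def LocalEnergyEstimate {d : ℕ} (C : ℝ) (B : Set (Eucl d)) (S w : Eucl d → ℝ) : Prop :=
  ∀ (x₀ : Eucl d) (R r : ℝ), ball x₀ R ⊆ B → 0 < r → r < R →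
    ∫ x in ball x₀ r, ‖weakGrad B w x‖ ^ 2
      ≤ C / (R - r) ^ 2 * (∫ x in ball x₀ R, w x ^ 2) + C * ∫ x in ball x₀ R, |S x| * w x

/-- The class `DG⁺(B, S)` with the constant `C` in the local energy estimates. -/
structure DGPlus {d : ℕ} (C : ℝ) (B : Set (Eucl d)) (S u : Eucl d → ℝ) : Prop where
  source : MemLp S 2 (volume.restrict B)
  memH1 : MemH1 B u
  one_le : 1 ≤ C
  energy : ∀ κ : ℝ, LocalEnergyEstimate C B S (fun x => max (u x - κ) 0)

/-- The class `DG⁻(B, S)` with the constant `C` in the local energy estimates. -/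
structure DGMinus {d : ℕ} (C : ℝ) (B : Set (Eucl d)) (S u : Eucl d → ℝ) : Prop where
  source : MemLp S 2 (volume.restrict B)
  memH1 : MemH1 B u
  one_le : 1 ≤ C
  energy : ∀ κ : ℝ, LocalEnergyEstimate C B S (fun x => max (-(u x - κ)) 0)

/-- The elliptic De Giorgi class `DG(B, S) = DG⁺(B, S) ∩ DG⁻(B, S)`, with the constants `Cp` and
`Cm` in the respective energy estimates. -/
def DG {d : ℕ} (Cp Cm : ℝ) (B : Set (Eucl d)) (S u : Eucl d → ℝ) : Prop :=
  DGPlus Cp B S u ∧ DGMinus Cm B S u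

/-- The Hölder norm on a set `F`: the supremum of `|v|` on `F` plus the `α`-Hölder semi-norm on `F`,
with value `∞` if one of them is infinite. -/
noncomputable def holderNorm {d : ℕ} (α : ℝ≥0) (F : Set (Eucl d)) (v : Eucl d → ℝ) : ℝ≥0∞ :=
  (⨆ x ∈ F, ‖v x‖ₑ) +
    ⨆ x ∈ F, ⨆ y ∈ F, ⨆ _ : x ≠ y, ENNReal.ofReal (|v x - v y| / ‖x - y‖ ^ (α : ℝ))

end DeGiorgi

/-! The equation is used only once, to derive Caccioppoli's inequality for truncations
(`exists_localEnergyEstimate`); everything else follows from energy inequalities alone. Since lower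
truncations of u are upper truncations of -u, only upper truncations are studied, with an explicit
weak gradient and a constant s bounding the source (`EnergyClass`); the results are then applied to
both u and -u.

No Sobolev embedding is needed. On a ball, the L^p norm of v(· + h) - v is at most |h| times that of
the gradient. Integrating this over small h gives two inequalities. If v vanishes outside a set that
is small compared with balls of radius ρ, then v(y) - v(x) = -v(x) for many y near x, so that ∫ v² ≤
c ρ² ∫ |∇v|² (`HasWeakGradient.integral_sq_le`). If v takes the values 0 and l on two sets, the
pairs of points from these sets give De Giorgi's isoperimetric inequality
(`HasWeakGradient.mul_measure_mul_measure_le`).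

Local boundedness (`exists_ae_le_of_integral_sq_le`): levels increase to k + H while radii decrease
to R/2. By Chebyshev each truncation has small support, so the first inequality holds at a scale ρ
proportional to the current gap between radii. The factor ρ² beats the factor lost in the energy
inequality, the truncated L² norms decay geometrically, and the truncation at the limiting level
vanishes.

Reduction of the supremum (`exists_ae_le_of_measure_le`): let u ≤ M, with u ≤ M - L on half of a
ball. Take dyadic levels from M - L up towards M. By the isoperimetric inequality the measure of
each slab between consecutive levels controls the square of the measure of what lies above it. The
slabs are disjoint, so after finitely many levels the superlevel set is small enough for local
boundedness to push the supremum strictly below M.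

One of u, -u always satisfies the half-ball condition, so the oscillation contracts by a fixed
factor from a ball to its concentric quarter. Iteration gives a Hölder estimate off a null set
(`exists_holder_on_ae`), and the function extends by continuity. -/

namespace DeGiorgi

open Filter Topology

/-! ### Translations and mollification in L² -/

/-- Jensen's inequality for a power and a probability measure. -/
theorem lintegral_rpow_le_lintegral_rpow {X : Type*} [MeasurableSpace X] (ν : Measure X)
    [IsProbabilityMeasure ν] {F : X → ℝ≥0∞} (hF : AEMeasurable F ν) {p : ℝ} (hp : 1 ≤ p) :
    (∫⁻ x, F x ∂ν) ^ p ≤ ∫⁻ x, F x ^ p ∂ν := by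
  have h := eLpNorm'_le_eLpNorm'_of_exponent_le one_pos hp ν hF.aestronglyMeasurable
  simp only [eLpNorm'_eq_lintegral_enorm, enorm_eq_self, ENNReal.rpow_one, div_one] at h
  calc (∫⁻ x, F x ∂ν) ^ p ≤ ((∫⁻ x, F x ^ p ∂ν) ^ (1 / p)) ^ p :=
        ENNReal.rpow_le_rpow h (by linarith)
    _ = _ := by rw [← ENNReal.rpow_mul, one_div_mul_cancel (by linarith), ENNReal.rpow_one]

/-- Translations are continuous in `L²`. -/
theorem tendsto_eLpNorm_comp_sub_sub {d : ℕ} {E : Type*} [NormedAddCommGroup E]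
    {f : Eucl d → E} (hf : MemLp f 2 volume) :
    Tendsto (fun h => eLpNorm (fun x => f (x - h) - f x) 2 volume) (𝓝 (0 : Eucl d)) (𝓝 0) := by
  let g : Eucl d → C(Eucl d, Eucl d) := fun h => ⟨fun x => x - h, by fun_prop⟩
  have hg : Continuous g :=
    ContinuousMap.continuous_of_continuous_uncurry _ (by
      change Continuous fun p : Eucl d × Eucl d => p.2 - p.1
      fun_prop)
  have hgm : ∀ h, MeasurePreserving (g h) volume volume := fun h =>
    measurePreserving_sub_right volume h
  have : Fact ((1 : ℝ≥0∞) ≤ 2) := ⟨by norm_num⟩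
  -- Composition with a continuously varying measure-preserving map is continuous in `Lp`; the claim
  -- is this continuity at `h = 0`.
  have hc : Continuous fun h => Lp.compMeasurePreserving (g h) (hgm h) (hf.toLp f) :=
    Continuous.compMeasurePreservingLp continuous_const hg hgm (by norm_num)
  have h0 := (hc.tendsto 0)
  rw [tendsto_iff_edist_tendsto_0] at h0
  refine h0.congr fun h => ?_
  rw [Lp.edist_def]
  refine eLpNorm_congr_ae ?_
  have e1 := Lp.coeFn_compMeasurePreserving (hf.toLp f) (hgm h)
  have e2 := Lp.coeFn_compMeasurePreserving (hf.toLp f) (hgm 0)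
  have e3 := (hgm h).quasiMeasurePreserving.ae_eq_comp hf.coeFn_toLp
  have e4 := (hgm 0).quasiMeasurePreserving.ae_eq_comp hf.coeFn_toLp
  filter_upwards [e1, e2, e3, e4] with x h1 h2 h3 h4
  simp only [Pi.sub_apply, h1, h2, h3, h4]
  simp [g]

/-- The mollification of an `L²` function converges to it in `L²`. -/
theorem eLpNorm_mollify_sub_le {d : ℕ} {E : Type*} [NormedAddCommGroup E] [NormedSpace ℝ E]
    [CompleteSpace E]
    {f : Eucl d → E} (hf : MemLp f 2 volume) (φ : ContDiffBump (0 : Eucl d)) {δ : ℝ≥0∞}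
    (hδ : ∀ h ∈ ball (0 : Eucl d) φ.rOut, eLpNorm (fun x => f (x - h) - f x) 2 volume ≤ δ) :
    eLpNorm (fun x => (convolution (φ.normed volume) f (ContinuousLinearMap.lsmul ℝ ℝ) volume) x
      - f x) 2 volume ≤ δ := by
  -- Tonelli requires joint measurability of f(x - h) - f(x), hence a strongly measurable
  -- representative; neither the convolution nor the norms see the change.
  wlog hsm : StronglyMeasurable f generalizing f
  · obtain ⟨f', hf'm, hff'⟩ := hf.1
    have hconv := convolution_congr (L := ContinuousLinearMap.lsmul ℝ ℝ)
      (Filter.EventuallyEq.refl (ae (volume : Measure (Eucl d))) (φ.normed volume)) hff'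
    rw [hconv]
    have h1 := this (hf.ae_eq hff') (fun h hh => by
      rw [← eLpNorm_congr_ae (f := fun x => f (x - h) - f x)]
      · exact hδ h hh
      · have := (measurePreserving_sub_right volume h).quasiMeasurePreserving.ae_eq_comp hff'
        filter_upwards [hff', this] with x hx hx'
        simp only [Function.comp] at hx'
        rw [hx, hx']) hf'm
    refine le_trans (le_of_eq (eLpNorm_congr_ae ?_)) h1
    filter_upwards [hff'] with x hx
    rw [hx]
  set ψ := φ.normed (volume : Measure (Eucl d)) with hψ
  have hψc : Continuous ψ := φ.continuous_normed
  have hψ0 : ∀ x, 0 ≤ ψ x := φ.nonneg_normed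
  -- For the probability measure ν with density ψ, the error ψ ∗ f - f is the ν-average of f(· - h)
  -- - f; Jensen for the square and Tonelli reduce it to `hδ` on the support of ψ.
  set ν : Measure (Eucl d) := volume.withDensity fun h => ENNReal.ofReal (ψ h) with hν
  have hψm : Measurable fun h => ENNReal.ofReal (ψ h) := hψc.measurable.ennreal_ofReal
  have hψ1 : ∫⁻ h, ENNReal.ofReal (ψ h) = 1 := by
    rw [← ofReal_integral_eq_lintegral_ofReal φ.integrable_normed
      (Eventually.of_forall hψ0), φ.integral_normed, ENNReal.ofReal_one]
  have : IsProbabilityMeasure ν := ⟨by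
    rw [hν, withDensity_apply _ MeasurableSet.univ, Measure.restrict_univ, hψ1]⟩
  have hloc : LocallyIntegrable f volume := hf.locallyIntegrable (by norm_num)
  have hsub : StronglyMeasurable fun p : Eucl d × Eucl d => f (p.1 - p.2) - f p.1 :=
    (hsm.comp_measurable (by fun_prop)).sub (hsm.comp_measurable (by fun_prop))
  have hpt : ∀ x, ‖(convolution ψ f (ContinuousLinearMap.lsmul ℝ ℝ) volume) x - f x‖ₑ ^ (2 : ℝ)
      ≤ ∫⁻ h, ‖f (x - h) - f x‖ₑ ^ (2 : ℝ) ∂ν := by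
    intro x
    have hm : Measurable fun h => ‖f (x - h) - f x‖ₑ :=
      (hsub.comp_measurable (by fun_prop : Measurable fun h : Eucl d => (x, h))).enorm
    refine le_trans ?_ (lintegral_rpow_le_lintegral_rpow ν hm.aemeasurable (by norm_num))
    refine ENNReal.rpow_le_rpow ?_ (by norm_num)
    have hint : Integrable (fun h => ψ h • f (x - h)) volume :=
      (φ.hasCompactSupport_normed.convolutionExists_left (ContinuousLinearMap.lsmul ℝ ℝ) hψc hloc x)
    have hint2 : Integrable (fun h => ψ h • f x) volume := φ.integrable_normed.smul_const _
    have e : (convolution ψ f (ContinuousLinearMap.lsmul ℝ ℝ) volume) x - f x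
        = ∫ h, ψ h • (f (x - h) - f x) := by
      have : f x = ∫ h, ψ h • f x := by
        rw [integral_smul_const, φ.integral_normed, one_smul]
      conv_lhs => rw [this]
      rw [convolution_lsmul, ← integral_sub hint hint2]
      refine integral_congr_ae (Eventually.of_forall fun h => ?_)
      simp [smul_sub]
    rw [e]
    refine (enorm_integral_le_lintegral_enorm _).trans (le_of_eq ?_)
    rw [hν, lintegral_withDensity_eq_lintegral_mul _ hψm hm]
    refine lintegral_congr fun h => ?_
    rw [enorm_smul, Real.enorm_of_nonneg (hψ0 h)]
    rfl
  rw [eLpNorm_eq_lintegral_rpow_enorm_toReal (by norm_num) (by norm_num)]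
  simp only [ENNReal.toReal_ofNat]
  rw [one_div, ENNReal.rpow_inv_le_iff (by norm_num)]
  calc ∫⁻ x, ‖(convolution ψ f (ContinuousLinearMap.lsmul ℝ ℝ) volume) x - f x‖ₑ ^ (2 : ℝ)
      ≤ ∫⁻ x, ∫⁻ h, ‖f (x - h) - f x‖ₑ ^ (2 : ℝ) ∂ν := lintegral_mono hpt
    _ = ∫⁻ h, (∫⁻ x, ‖f (x - h) - f x‖ₑ ^ (2 : ℝ)) ∂ν := by
        rw [lintegral_lintegral_swap]
        exact (hsub.enorm.pow_const (2 : ℝ)).aemeasurable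
    _ ≤ ∫⁻ h, δ ^ (2 : ℝ) ∂ν := by
        refine lintegral_mono_ae ?_
        rw [hν, ae_withDensity_iff hψm]
        refine Eventually.of_forall fun h hh => ?_
        have hh' : h ∈ ball (0 : Eucl d) φ.rOut := by
          rw [← φ.support_normed_eq (μ := volume)]
          intro h0
          exact hh (by rw [← hψ] at h0; rw [h0, ENNReal.ofReal_zero])
        have := hδ h hh'
        rw [eLpNorm_eq_lintegral_rpow_enorm_toReal (by norm_num) (by norm_num)] at this
        simp only [ENNReal.toReal_ofNat] at this
        rwa [one_div, ENNReal.rpow_inv_le_iff (by norm_num)] at this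
    _ = δ ^ (2 : ℝ) := by simp

theorem gradient_apply {d : ℕ} (φ : Eucl d → ℝ) (x : Eucl d) (i : Fin d) :
    (gradient φ x) i = fderiv ℝ φ x (EuclideanSpace.single i 1) := by
  have h := inner_gradient_left (f := φ) (x := x) (y := EuclideanSpace.single i (1 : ℝ))
  rw [EuclideanSpace.inner_single_right] at h
  simpa using h

theorem exists_bump_tendsto (d : ℕ) {ε : ℝ} (hε : 0 < ε) :
    ∃ φ : ℕ → ContDiffBump (0 : Eucl d), (∀ n, (φ n).rOut < ε) ∧
      Tendsto (fun n => (φ n).rOut) atTop (𝓝 0) := by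
  refine ⟨fun n => ⟨ε / (n + 3), ε / (n + 2), by positivity, ?_⟩, fun n => ?_, ?_⟩
  · gcongr; norm_num
  · change ε / (n + 2) < ε
    rw [div_lt_iff₀ (by positivity)]
    nlinarith [(Nat.cast_nonneg n : (0 : ℝ) ≤ n)]
  · change Tendsto (fun n : ℕ => ε / ((n : ℝ) + 2)) atTop (𝓝 0)
    exact tendsto_const_nhds.div_atTop
      (tendsto_atTop_add_const_right _ _ tendsto_natCast_atTop_atTop)

theorem tendsto_eLpNorm_mollify_sub {d : ℕ} {E : Type*} [NormedAddCommGroup E] [NormedSpace ℝ E]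
    [CompleteSpace E] {f : Eucl d → E} (hf : MemLp f 2 volume)
    {φ : ℕ → ContDiffBump (0 : Eucl d)} (hφ : Tendsto (fun n => (φ n).rOut) atTop (𝓝 0)) :
    Tendsto (fun n => eLpNorm (fun x => (convolution ((φ n).normed volume) f
      (ContinuousLinearMap.lsmul ℝ ℝ) volume) x - f x) 2 volume) atTop (𝓝 0) := by
  rw [ENNReal.tendsto_nhds_zero]
  intro δ hδ
  have h1 := (ENNReal.tendsto_nhds_zero.1 (tendsto_eLpNorm_comp_sub_sub hf)) δ hδ
  obtain ⟨η, hη, hball⟩ := Metric.eventually_nhds_iff.1 h1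
  filter_upwards [hφ.eventually (gt_mem_nhds hη)] with n hn
  refine eLpNorm_mollify_sub_le hf (φ n) fun h hh => hball ?_
  exact (mem_ball.1 hh).trans hn

/-- The gradient of a mollification is the mollification of the weak gradient. -/
theorem gradient_mollify {d : ℕ} {Ω : Set (Eucl d)} (hΩ : MeasurableSet Ω) {u : Eucl d → ℝ}
    {g : Eucl d → Eucl d} (hu : MemLp u 2 (volume.restrict Ω))
    (hg : MemLp g 2 (volume.restrict Ω)) (h : HasWeakGradient Ω u g)
    (φ : ContDiffBump (0 : Eucl d)) {x : Eucl d} (hx : closedBall x φ.rOut ⊆ Ω) :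
    gradient (convolution (φ.normed volume) (Ω.indicator u)
      (ContinuousLinearMap.lsmul ℝ ℝ) volume) x
      = convolution (φ.normed volume) (Ω.indicator g) (ContinuousLinearMap.lsmul ℝ ℝ) volume x := by
  have hu' : LocallyIntegrable (Ω.indicator u) volume :=
    ((memLp_indicator_iff_restrict hΩ).2 hu).locallyIntegrable (by norm_num)
  have hg' : LocallyIntegrable (Ω.indicator g) volume :=
    ((memLp_indicator_iff_restrict hΩ).2 hg).locallyIntegrable (by norm_num)
  set ψ := φ.normed (volume : Measure (Eucl d)) with hψ
  have hψs : ContDiff ℝ ∞ ψ := φ.contDiff_normed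
  have hψc : HasCompactSupport ψ := φ.hasCompactSupport_normed
  have hd := hψc.hasFDerivAt_convolution_left (ContinuousLinearMap.lsmul ℝ ℝ)
    (hψs.of_le (by exact_mod_cast le_top)) hu' x
  -- The reflected kernel serves as test function, supported in `closedBall x φ.rOut`. The sign from
  -- differentiating in y cancels the sign in `parts`.
  have htest : IsTestFunction Ω fun y => ψ (x - y) := by
    refine ⟨hψs.comp (contDiff_const.sub contDiff_id), ?_, ?_⟩
    · exact hψc.comp_homeomorph (Homeomorph.subLeft x)
    · have : tsupport (fun y => ψ (x - y)) = (Homeomorph.subLeft x) ⁻¹' tsupport ψ :=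
        tsupport_comp_eq_preimage ψ (Homeomorph.subLeft x)
      rw [this, hψ, φ.tsupport_normed_eq]
      intro y hy
      apply hx
      simp only [Set.mem_preimage, Homeomorph.coe_subLeft, mem_closedBall, dist_zero_right] at hy
      rw [mem_closedBall, dist_comm, dist_eq_norm]
      exact hy
  ext i
  have hcomp : (convolution ψ (Ω.indicator g) (ContinuousLinearMap.lsmul ℝ ℝ) volume x) i
      = ∫ y in Ω, g y i * ψ (x - y) := by
    have hint : Integrable (fun y => ψ (x - y) • Ω.indicator g y) volume :=
      (hψc.convolutionExists_left (ContinuousLinearMap.lsmul ℝ ℝ) hψs.continuous hg' x).integrable_swap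
    rw [convolution_lsmul_swap]
    have := (EuclideanSpace.proj (𝕜 := ℝ) i).integral_comp_comm hint
    simp only [EuclideanSpace.coe_proj] at this
    rw [← this, ← integral_indicator hΩ]
    refine integral_congr_ae (Eventually.of_forall fun y => ?_)
    by_cases hy : y ∈ Ω <;> simp [hy, mul_comm]
  rw [hcomp, gradient_apply, hd.fderiv]
  have hint2 : ConvolutionExistsAt (fderiv ℝ ψ) (Ω.indicator u) x
      ((ContinuousLinearMap.lsmul ℝ ℝ).precompL (Eucl d)) volume :=
    (hψc.fderiv (𝕜 := ℝ)).convolutionExists_left _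
      (hψs.continuous_fderiv (by simp)) hu' x
  have h2 := h.parts _ htest i
  rw [convolution_eq_swap, ContinuousLinearMap.integral_apply hint2.integrable_swap]
  rw [← neg_eq_iff_eq_neg] at h2
  rw [← h2, ← integral_neg, ← integral_indicator hΩ]
  refine integral_congr_ae (Eventually.of_forall fun y => ?_)
  have hgr : (gradient (fun y => ψ (x - y)) y) i = - fderiv ℝ ψ (x - y) (EuclideanSpace.single i 1) := by
    rw [gradient_apply]
    have h3 : HasFDerivAt (fun y => ψ (x - y))
        ((fderiv ℝ ψ (x - y)).comp (-ContinuousLinearMap.id ℝ (Eucl d))) y :=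
      (hψs.differentiable (by simp) (x - y)).hasFDerivAt.comp y
        ((hasFDerivAt_id y).const_sub x)
    rw [h3.fderiv]
    simp
  by_cases hy : y ∈ Ω
  · simp [hy, hgr, mul_comm]
  · simp [hy]

/-- Interior approximation of Sobolev functions by smooth functions. -/
theorem exists_smooth_approx {d : ℕ} {Ω K : Set (Eucl d)} (hΩ : MeasurableSet Ω)
    (hKm : MeasurableSet K) {ε : ℝ} (hε : 0 < ε) (hK : ∀ x ∈ K, closedBall x ε ⊆ Ω)
    {u : Eucl d → ℝ} {g : Eucl d → Eucl d} (hu : MemLp u 2 (volume.restrict Ω))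
    (hg : MemLp g 2 (volume.restrict Ω)) (h : HasWeakGradient Ω u g) :
    ∃ w : ℕ → Eucl d → ℝ, (∀ n, ContDiff ℝ ∞ (w n)) ∧
      Tendsto (fun n => eLpNorm (fun x => w n x - u x) 2 (volume.restrict K)) atTop (𝓝 0) ∧
      Tendsto (fun n => eLpNorm (fun x => gradient (w n) x - g x) 2 (volume.restrict K))
        atTop (𝓝 0) := by
  obtain ⟨φ, hφε, hφ⟩ := exists_bump_tendsto d hε
  have hu' := (memLp_indicator_iff_restrict hΩ).2 hu
  have hg' := (memLp_indicator_iff_restrict hΩ).2 hg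
  have hKΩ : K ⊆ Ω := fun x hx => hK x hx (mem_closedBall_self hε.le)
  -- Extension by zero may destroy the weak gradient across the boundary of Ω, but at points of K a
  -- mollification of radius below ε does not reach it.
  refine ⟨fun n => convolution ((φ n).normed volume) (Ω.indicator u)
      (ContinuousLinearMap.lsmul ℝ ℝ) volume, fun n => ?_, ?_, ?_⟩
  · exact (φ n).hasCompactSupport_normed.contDiff_convolution_left _ (φ n).contDiff_normed
      (hu'.locallyIntegrable (by norm_num))
  · refine tendsto_of_tendsto_of_tendsto_of_le_of_le tendsto_const_nhds
      (tendsto_eLpNorm_mollify_sub hu' hφ) (fun _ => zero_le) fun n => ?_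
    refine le_trans (le_of_eq (eLpNorm_congr_ae ?_)) (eLpNorm_mono_measure _ Measure.restrict_le_self)
    filter_upwards [ae_restrict_mem hKm] with x hx
    simp [hKΩ hx]
  · refine tendsto_of_tendsto_of_tendsto_of_le_of_le tendsto_const_nhds
      (tendsto_eLpNorm_mollify_sub hg' hφ) (fun _ => zero_le) fun n => ?_
    refine le_trans (le_of_eq (eLpNorm_congr_ae ?_)) (eLpNorm_mono_measure _ Measure.restrict_le_self)
    filter_upwards [ae_restrict_mem hKm] with x hx
    rw [gradient_mollify hΩ hu hg h (φ n)
      ((closedBall_subset_closedBall (hφε n).le).trans (hK x hx)), Set.indicator_of_mem (hKΩ hx)]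

/-! ### Weak gradients: uniqueness and chain rule -/

theorem tendsto_integral_inner {X E : Type*} [MeasurableSpace X] {μ : Measure X}
    [NormedAddCommGroup E] [InnerProductSpace ℝ E] {a b : ℕ → X → E} {a₀ b₀ : X → E}
    (ha : ∀ n, MemLp (a n) 2 μ) (hb : ∀ n, MemLp (b n) 2 μ) (ha₀ : MemLp a₀ 2 μ)
    (hb₀ : MemLp b₀ 2 μ)
    (hta : Tendsto (fun n => eLpNorm (fun x => a n x - a₀ x) 2 μ) atTop (𝓝 0))
    (htb : Tendsto (fun n => eLpNorm (fun x => b n x - b₀ x) 2 μ) atTop (𝓝 0)) :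
    Tendsto (fun n => ∫ x, inner ℝ (a n x) (b n x) ∂μ) atTop
      (𝓝 (∫ x, inner ℝ (a₀ x) (b₀ x) ∂μ)) := by
  have h1 := (Lp.tendsto_Lp_iff_tendsto_eLpNorm'' a ha a₀ ha₀).2 hta
  have h2 := (Lp.tendsto_Lp_iff_tendsto_eLpNorm'' b hb b₀ hb₀).2 htb
  have h3 := h1.inner (𝕜 := ℝ) h2
  have key : ∀ {f g : X → E} (hf : MemLp f 2 μ) (hg : MemLp g 2 μ),
      inner ℝ (hf.toLp f) (hg.toLp g) = ∫ x, inner ℝ (f x) (g x) ∂μ := by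
    intro f g hf hg
    rw [L2.inner_def]
    refine integral_congr_ae ?_
    filter_upwards [hf.coeFn_toLp, hg.coeFn_toLp] with x h1 h2
    rw [h1, h2]
  simpa only [key] using h3

/-- Each coordinate of g - g' integrates to zero against all test functions, so the fundamental
lemma of the calculus of variations applies. -/
theorem HasWeakGradient.ae_eq {d : ℕ} {Ω : Set (Eucl d)} (hΩ : IsOpen Ω) {u : Eucl d → ℝ}
    {g g' : Eucl d → Eucl d} (h : HasWeakGradient Ω u g) (h' : HasWeakGradient Ω u g') :
    g =ᵐ[volume.restrict Ω] g' := by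
  have key : ∀ i : Fin d, ∀ᵐ x, x ∈ Ω → (g x - g' x) i = 0 := by
    intro i
    have hli : ∀ {f : Eucl d → Eucl d}, LocallyIntegrableOn f Ω volume →
        LocallyIntegrableOn (fun x => f x i) Ω volume := by
      intro f hf x hx
      obtain ⟨s, hs, hfs⟩ := hf x hx
      exact ⟨s, hs, (EuclideanSpace.proj (𝕜 := ℝ) i).integrable_comp hfs⟩
    have h1 := hli h.locInt_grad
    have h2 := hli h'.locInt_grad
    refine hΩ.ae_eq_zero_of_integral_contDiff_smul_eq_zero
      (f := fun x => (g x - g' x) i) (h1.sub h2) fun φ hφ hφc hφs => ?_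
    have e := h.parts φ ⟨hφ, hφc, hφs⟩ i
    rw [h'.parts φ ⟨hφ, hφc, hφs⟩ i, neg_inj] at e
    have hint : ∀ {f : Eucl d → ℝ}, LocallyIntegrableOn f Ω volume →
        IntegrableOn (fun x => f x * φ x) Ω volume := by
      intro f hf
      have h3 : IntegrableOn (fun x => f x * φ x) (tsupport φ) volume :=
        (hf.integrableOn_compact_subset hφs hφc).mul_continuousOn hφ.continuous.continuousOn hφc
      rw [integrableOn_iff_integrable_of_support_subset] at h3
      · exact h3.integrableOn
      · intro x hx
        by_contra hx'
        exact hx (by simp [image_eq_zero_of_notMem_tsupport hx'])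
    rw [← setIntegral_eq_integral_of_forall_compl_eq_zero (s := Ω)]
    · have : ∀ x, φ x • (g x - g' x) i = g x i * φ x - g' x i * φ x := by
        intro x; simp; ring
      simp_rw [this]
      rw [integral_sub (hint h1) (hint h2), e, sub_self]
    · intro x hx
      rw [image_eq_zero_of_notMem_tsupport fun hx' => hx (hφs hx'), zero_smul]
  rw [Filter.EventuallyEq, ae_restrict_iff' hΩ.measurableSet]
  filter_upwards [ae_all_iff.2 key] with x hx hxΩ
  ext i
  have := hx i hxΩ
  simpa [sub_eq_zero] using this

/-- Removes the dependence on the choice in `weakGrad`: under integrals over subsets of Ω any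
explicit weak gradient may replace it. -/
theorem HasWeakGradient.weakGrad_ae_eq {d : ℕ} {Ω : Set (Eucl d)} (hΩ : IsOpen Ω)
    {u : Eucl d → ℝ} {g : Eucl d → Eucl d} (h : HasWeakGradient Ω u g) :
    weakGrad Ω u =ᵐ[volume.restrict Ω] g := by
  have hex : ∃ g : Eucl d → Eucl d, HasWeakGradient Ω u g := ⟨g, h⟩
  have : HasWeakGradient Ω u (weakGrad Ω u) := by
    rw [weakGrad, dif_pos hex]
    exact hex.choose_spec
  exact this.ae_eq hΩ h

theorem locallyIntegrableOn_of_memLp {d : ℕ} {E : Type*} [NormedAddCommGroup E]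
    {Ω : Set (Eucl d)} {f : Eucl d → E}
    (hf : MemLp f 2 (volume.restrict Ω)) : LocallyIntegrableOn f Ω volume :=
  locallyIntegrableOn_of_locallyIntegrable_restrict (hf.locallyIntegrable (by norm_num))

/-- Integration by parts for a smooth function and a test function. -/
theorem integral_mul_gradient_eq_neg {d : ℕ} {f φ : Eucl d → ℝ} (hf : ContDiff ℝ 1 f)
    (hφ : ContDiff ℝ ∞ φ) (hφc : HasCompactSupport φ) (i : Fin d) :
    ∫ x, f x * (gradient φ x) i = - ∫ x, (gradient f x) i * φ x := by
  simp_rw [gradient_apply]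
  have hφ1 : ContDiff ℝ 1 φ := hφ.of_le (by exact_mod_cast le_top)
  have hfd : Continuous fun x => fderiv ℝ f x (EuclideanSpace.single i 1) :=
    (hf.continuous_fderiv (by simp)).clm_apply continuous_const
  have hφd : Continuous fun x => fderiv ℝ φ x (EuclideanSpace.single i 1) :=
    (hφ1.continuous_fderiv (by simp)).clm_apply continuous_const
  refine integral_mul_fderiv_eq_neg_fderiv_mul_of_integrable ?_ ?_ ?_
    (fun x _ => (hf.differentiable (by simp)) x) (fun x _ => (hφ1.differentiable (by simp)) x)
  · exact (hfd.mul hφ.continuous).integrable_of_hasCompactSupport hφc.mul_left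
  · exact (hf.continuous.mul hφd).integrable_of_hasCompactSupport
      (hφc.fderiv_apply (𝕜 := ℝ) (EuclideanSpace.single i 1)).mul_left
  · exact (hf.continuous.mul hφ.continuous).integrable_of_hasCompactSupport hφc.mul_left

/-- A continuous function belongs to `L^p` on compact sets. -/
theorem _root_.Continuous.memLp_restrict_of_isCompact {d : ℕ} {E : Type*} [NormedAddCommGroup E]
    {f : Eucl d → E} (hf : Continuous f) {K : Set (Eucl d)} (hK : IsCompact K) (p : ℝ≥0∞) :
    MemLp f p (volume.restrict K) := by
  obtain ⟨C, hC⟩ := hK.exists_bound_of_continuousOn hf.continuousOn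
  have : IsFiniteMeasure (volume.restrict K : Measure (Eucl d)) :=
    ⟨by rw [Measure.restrict_apply_univ]; exact hK.measure_lt_top⟩
  exact MemLp.of_bound (hf.aestronglyMeasurable) C
    ((ae_restrict_iff' hK.measurableSet).2 (Eventually.of_forall hC))

theorem continuous_gradient {d : ℕ} {f : Eucl d → ℝ} (hf : ContDiff ℝ 1 f) :
    Continuous (gradient f) :=
  (InnerProductSpace.toDual ℝ (Eucl d)).symm.continuous.comp (hf.continuous_fderiv (by simp))

theorem gradient_comp {d : ℕ} {G G' : ℝ → ℝ} {f : Eucl d → ℝ} {x : Eucl d}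
    (hG : HasDerivAt G (G' (f x)) (f x)) (hf : DifferentiableAt ℝ f x) :
    gradient (fun y => G (f y)) x = G' (f x) • gradient f x := by
  have h := hG.comp_hasFDerivAt x hf.hasFDerivAt
  rw [gradient, gradient, show (fun y => G (f y)) = G ∘ f from rfl, h.fderiv]
  simp

/-- The chain rule for weak gradients, tested against a test function. -/
theorem integral_comp_mul_gradient {d : ℕ} {Ω : Set (Eucl d)} (hΩ : IsOpen Ω)
    {u : Eucl d → ℝ} {g : Eucl d → Eucl d} (hu : MemLp u 2 (volume.restrict Ω))
    (hg : MemLp g 2 (volume.restrict Ω)) (h : HasWeakGradient Ω u g) {G G' : ℝ → ℝ}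
    (hG : ∀ t, HasDerivAt G (G' t) t) (hG1 : ∀ t, |G' t| ≤ 1) {L : ℝ≥0} (hGL : LipschitzWith L G')
    {φ : Eucl d → ℝ} (hφ : IsTestFunction Ω φ) (i : Fin d) :
    ∫ x in Ω, G (u x) * (gradient φ x) i = - ∫ x in Ω, G' (u x) * g x i * φ x := by
  set K := tsupport φ with hKdef
  have hK : IsCompact K := hφ.compact
  have hKΩ : K ⊆ Ω := hφ.support
  obtain ⟨ε, hε, hεK⟩ := hK.exists_cthickening_subset_open hΩ hKΩ
  -- The classical chain rule holds for each smooth w n. As G and G' are Lipschitz, L² convergence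
  -- of w n on K passes to G(w n) and to G'(w n) φ; both sides become L² pairings and converge
  -- without extracting subsequences.
  obtain ⟨w, hw, hwu, hwg⟩ := exists_smooth_approx hΩ.measurableSet hK.measurableSet hε
    (fun x hx => (closedBall_subset_cthickening hx ε).trans hεK) hu hg h
  have hGc : Continuous G := continuous_iff_continuousAt.2 fun t => (hG t).continuousAt
  have hGlip : LipschitzWith 1 G := lipschitzWith_of_nnnorm_deriv_le
    (fun t => (hG t).differentiableAt) fun t => by
      rw [(hG t).deriv, ← NNReal.coe_le_coe, coe_nnnorm]; exact hG1 t
  have hGC1 : ContDiff ℝ 1 G := contDiff_one_iff_deriv.2 ⟨fun t => (hG t).differentiableAt, by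
    rw [funext fun t => (hG t).deriv]; exact hGL.continuous⟩
  have hμK : (volume.restrict K : Measure (Eucl d)) ≤ volume.restrict Ω :=
    Measure.restrict_mono hKΩ le_rfl
  have huK := hu.mono_measure hμK
  have hgK := hg.mono_measure hμK
  have hφ0 : ∀ x ∉ K, φ x = 0 := fun x hx => image_eq_zero_of_notMem_tsupport hx
  have hgφ0 : ∀ x ∉ K, gradient φ x = 0 := by
    intro x hx
    have : fderiv ℝ φ x = 0 := by
      by_contra hne
      exact hx (support_fderiv_subset ℝ (f := φ) hne)
    rw [gradient, this, map_zero]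
  have e1 : ∀ {F : Eucl d → ℝ}, ∫ x in Ω, F x * (gradient φ x) i
      = ∫ x in K, F x * (gradient φ x) i := fun {F} =>
    setIntegral_eq_of_subset_of_forall_sdiff_eq_zero hΩ.measurableSet hKΩ fun x hx => by
      rw [hgφ0 x hx.2]; simp
  have e2 : ∀ {F : Eucl d → ℝ}, ∫ x in Ω, F x * φ x = ∫ x in K, F x * φ x := fun {F} =>
    setIntegral_eq_of_subset_of_forall_sdiff_eq_zero hΩ.measurableSet hKΩ fun x hx => by
      rw [hφ0 x hx.2]; simp
  have e1' : ∀ {F : Eucl d → ℝ}, ∫ x, F x * (gradient φ x) i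
      = ∫ x in K, F x * (gradient φ x) i := fun {F} =>
    (setIntegral_eq_integral_of_forall_compl_eq_zero fun x hx => by rw [hgφ0 x hx]; simp).symm
  have e2' : ∀ {F : Eucl d → ℝ}, ∫ x, F x * φ x = ∫ x in K, F x * φ x := fun {F} =>
    (setIntegral_eq_integral_of_forall_compl_eq_zero fun x hx => by rw [hφ0 x hx]; simp).symm
  have hw1 : ∀ n, ContDiff ℝ 1 (w n) := fun n => (hw n).of_le (by exact_mod_cast le_top)
  have hparts : ∀ n, ∫ x in K, G (w n x) * (gradient φ x) i
      = - ∫ x in K, (G' (w n x) * (gradient (w n) x) i) * φ x := by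
    intro n
    rw [← e1', ← e2', integral_mul_gradient_eq_neg (f := fun x => G (w n x))
      (hGC1.comp (hw1 n)) hφ.smooth hφ.compact]
    congr 2 with x
    rw [gradient_comp (hG _) ((hw1 n).differentiable (by simp) x)]
    simp
  have hφ1 : ContDiff ℝ 1 φ := hφ.smooth.of_le (by exact_mod_cast le_top)
  have hproj : Continuous fun v : Eucl d => v i := (EuclideanSpace.proj (𝕜 := ℝ) i).continuous
  have hb : MemLp (fun x => (gradient φ x) i) 2 (volume.restrict K) :=
    (hproj.comp (continuous_gradient hφ1)).memLp_restrict_of_isCompact hK 2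
  have hfin : IsFiniteMeasure (volume.restrict K : Measure (Eucl d)) :=
    ⟨by rw [Measure.restrict_apply_univ]; exact hK.measure_lt_top⟩
  have hGu : MemLp (fun x => G (u x)) 2 (volume.restrict K) := by
    have h1 : MemLp (fun x => |u x| + |G 0|) 2 (volume.restrict K) :=
      huK.abs.add (memLp_const _)
    refine h1.mono (hGc.comp_aestronglyMeasurable huK.1) (Eventually.of_forall fun x => ?_)
    have := hGlip.dist_le_mul (u x) 0
    rw [Real.dist_eq, Real.dist_eq, sub_zero, NNReal.coe_one, one_mul] at this
    rw [Real.norm_eq_abs, Real.norm_eq_abs, abs_of_nonneg (by positivity : 0 ≤ |u x| + |G 0|)]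
    calc |G (u x)| = |(G (u x) - G 0) + G 0| := by ring_nf
      _ ≤ _ := (abs_add_le _ _).trans (by gcongr)
  have hzero : Tendsto (fun _ : ℕ => eLpNorm (fun x => (gradient φ x) i - (gradient φ x) i) 2
      (volume.restrict K)) atTop (𝓝 0) := by simp
  have lim1 := tendsto_integral_inner (μ := volume.restrict K)
    (a := fun _ x => (gradient φ x) i) (b := fun n x => G (w n x)) (a₀ := fun x => (gradient φ x) i)
    (b₀ := fun x => G (u x)) (fun _ => hb)
    (fun n => (hGc.comp (hw n).continuous).memLp_restrict_of_isCompact hK 2) hb hGu hzero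
    (by
      refine tendsto_of_tendsto_of_tendsto_of_le_of_le tendsto_const_nhds hwu
        (fun _ => zero_le) fun n => eLpNorm_mono fun x => ?_
      have := hGlip.dist_le_mul (w n x) (u x)
      simpa [Real.dist_eq] using this)
  obtain ⟨M, hM⟩ := hφ.smooth.continuous.bounded_above_of_compact_support hφ.compact
  have hM0 : 0 ≤ M := (norm_nonneg _).trans (hM 0)
  have hgi : MemLp (fun x => g x i) 2 (volume.restrict K) :=
    (EuclideanSpace.proj (𝕜 := ℝ) i).comp_memLp' hgK
  have hc : MemLp (fun x => G' (u x) * φ x) 2 (volume.restrict K) := by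
    refine MemLp.of_bound ((hGL.continuous.comp_aestronglyMeasurable huK.1).mul
      hφ.smooth.continuous.aestronglyMeasurable) M (Eventually.of_forall fun x => ?_)
    rw [norm_mul]
    calc ‖G' (u x)‖ * ‖φ x‖ ≤ 1 * M := by gcongr; exacts [hG1 _, hM x]
      _ = M := one_mul M
  have lim2 := tendsto_integral_inner (μ := volume.restrict K)
    (a := fun n x => (gradient (w n) x) i) (b := fun n x => G' (w n x) * φ x)
    (a₀ := fun x => g x i) (b₀ := fun x => G' (u x) * φ x)
    (fun n => (hproj.comp (continuous_gradient (hw1 n))).memLp_restrict_of_isCompact hK 2)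
    (fun n => ((hGL.continuous.comp (hw n).continuous).mul
      hφ.smooth.continuous).memLp_restrict_of_isCompact hK 2) hgi hc
    (by
      refine tendsto_of_tendsto_of_tendsto_of_le_of_le tendsto_const_nhds hwg
        (fun _ => zero_le) fun n => eLpNorm_mono fun x => ?_
      exact PiLp.norm_apply_le (gradient (w n) x - g x) i)
    (by
      have h1 : Tendsto (fun n => ENNReal.ofReal (L * M) *
          eLpNorm (fun x => w n x - u x) 2 (volume.restrict K)) atTop (𝓝 0) := by
        have := ENNReal.Tendsto.const_mul (a := ENNReal.ofReal (L * M)) hwu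
          (Or.inr ENNReal.ofReal_ne_top)
        rwa [mul_zero] at this
      refine tendsto_of_tendsto_of_tendsto_of_le_of_le tendsto_const_nhds h1
        (fun _ => zero_le) fun n => ?_
      refine eLpNorm_le_mul_eLpNorm_of_ae_le_mul (Eventually.of_forall fun x => ?_) 2
      rw [← sub_mul, norm_mul]
      have := hGL.dist_le_mul (w n x) (u x)
      rw [dist_eq_norm, dist_eq_norm] at this
      calc ‖G' (w n x) - G' (u x)‖ * ‖φ x‖ ≤ (L * ‖w n x - u x‖) * M := by
            gcongr; exact hM x
        _ = _ := by ring)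
  rw [e1, e2]
  have r1 : ∀ n, ∫ x in K, inner ℝ ((gradient φ x) i) (G (w n x))
      = -∫ x in K, inner ℝ ((gradient (w n) x) i) (G' (w n x) * φ x) := by
    intro n
    have := hparts n
    simp only [RCLike.inner_apply, conj_trivial]
    rw [this]
    congr 2 with x; ring
  simp_rw [r1] at lim1
  have := tendsto_nhds_unique lim1 lim2.neg
  simp only [RCLike.inner_apply, conj_trivial] at this
  rw [this]
  congr 2 with x; ring

/-! ### Truncations of Sobolev functions -/

/-- Squaring removes the corner of the positive part; this is why `smoothPos` is differentiable,
with a Lipschitz derivative. -/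
theorem hasDerivAt_max_zero_sq (t : ℝ) :
    HasDerivAt (fun t : ℝ => (max t 0) ^ 2) (2 * max t 0) t := by
  rcases lt_trichotomy t 0 with ht | rfl | ht
  · rw [max_eq_right ht.le, mul_zero]
    refine (hasDerivAt_const t (0 : ℝ)).congr_of_eventuallyEq ?_
    filter_upwards [gt_mem_nhds ht] with s hs
    rw [max_eq_right hs.le]; simp
  · rw [max_self, mul_zero, hasDerivAt_iff_isLittleO]
    have h : (fun x : ℝ => x ^ 2) =o[𝓝 0] fun x => x := by
      simpa using Asymptotics.isLittleO_pow_id (𝕜 := ℝ) (n := 2) (by norm_num)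
    refine Asymptotics.IsBigO.trans_isLittleO ?_ (by simpa using h)
    refine Asymptotics.IsBigO.of_bound 1 (Eventually.of_forall fun x => ?_)
    simp only [max_self, sub_zero, smul_zero, norm_pow, one_mul, Real.norm_eq_abs]
    norm_num
    rw [sq_le_sq, abs_of_nonneg (le_max_right _ _)]
    exact max_le (le_abs_self x) (abs_nonneg x)
  · rw [max_eq_left ht.le]
    refine HasDerivAt.congr_of_eventuallyEq (f := fun t => t ^ 2) (by simpa using hasDerivAt_pow 2 t) ?_
    filter_upwards [lt_mem_nhds ht] with s hs
    rw [max_eq_left hs.le]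

/-- A continuously differentiable approximation of the positive part. -/
noncomputable def smoothPos (ε t : ℝ) : ℝ := ((max t 0) ^ 2 - (max (t - ε) 0) ^ 2) / (2 * ε)

/-- The derivative of `smoothPos ε`. -/
noncomputable def smoothPosDeriv (ε t : ℝ) : ℝ := (max t 0 - max (t - ε) 0) / ε

theorem hasDerivAt_smoothPos {ε : ℝ} (hε : 0 < ε) (t : ℝ) :
    HasDerivAt (smoothPos ε) (smoothPosDeriv ε t) t := by
  have h1 := hasDerivAt_max_zero_sq t
  have h2 := (hasDerivAt_max_zero_sq (t - ε)).comp t ((hasDerivAt_id t).sub_const ε)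
  have h3 : HasDerivAt (smoothPos ε) _ t := (h1.sub h2).div_const (2 * ε)
  refine h3.congr_deriv ?_
  simp only [smoothPosDeriv]
  field_simp

theorem smoothPosDeriv_mem {ε : ℝ} (hε : 0 < ε) (t : ℝ) :
    0 ≤ smoothPosDeriv ε t ∧ smoothPosDeriv ε t ≤ 1 := by
  rw [smoothPosDeriv, div_le_one hε]
  refine ⟨div_nonneg ?_ hε.le, ?_⟩
  · have : max (t - ε) 0 ≤ max t 0 := max_le_max (by linarith) le_rfl
    linarith
  · have : max t 0 ≤ max (t - ε) 0 + ε :=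
      max_le (by linarith [le_max_left (t - ε) 0]) (by linarith [le_max_right (t - ε) 0])
    linarith

theorem smoothPosDeriv_lipschitz {ε : ℝ} (hε : 0 < ε) :
    ∃ L : ℝ≥0, LipschitzWith L (smoothPosDeriv ε) := by
  have h1 : LipschitzWith 1 fun t : ℝ => max t 0 := LipschitzWith.id.max_const 0
  have h2 : LipschitzWith 1 fun t : ℝ => max (t - ε) 0 :=
    (LipschitzWith.of_dist_le_mul fun x y => by simp).max_const 0
  have h3 := h1.sub h2
  refine ⟨Real.toNNReal (1 / ε) * (1 + 1), ?_⟩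
  refine LipschitzWith.of_dist_le_mul fun x y => ?_
  have h4 := h3.dist_le_mul x y
  rw [Real.dist_eq] at h4
  rw [Real.dist_eq, smoothPosDeriv, smoothPosDeriv, ← sub_div, abs_div, abs_of_pos hε]
  calc _ ≤ (((1 + 1 : ℝ≥0) : ℝ) * dist x y) / ε := by gcongr
    _ = _ := by push_cast; rw [Real.coe_toNNReal _ (by positivity)]; ring

theorem smoothPosDeriv_eq_one {ε t : ℝ} (hε : 0 < ε) (ht : ε ≤ t) : smoothPosDeriv ε t = 1 := by
  rw [smoothPosDeriv, max_eq_left (by linarith), max_eq_left (by linarith)]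
  field_simp; ring

theorem smoothPosDeriv_eq_zero {ε t : ℝ} (hε : 0 < ε) (ht : t ≤ 0) : smoothPosDeriv ε t = 0 := by
  rw [smoothPosDeriv, max_eq_right (by linarith), max_eq_right (by linarith)]; simp

/-- `smoothPos ε t` is the mean of the positive parts of t - a over a in [0, ε], each within ε of
the positive part of t. -/
theorem abs_smoothPos_sub_le {ε : ℝ} (hε : 0 < ε) (t : ℝ) : |smoothPos ε t - max t 0| ≤ ε := by
  rw [smoothPos]
  rcases le_total t 0 with h | h
  · rw [max_eq_right h, max_eq_right (by linarith)]; simp [hε.le]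
  · rw [max_eq_left h]
    rcases le_total t ε with h' | h'
    · rw [max_eq_right (by linarith), abs_le]
      constructor
      · rw [le_sub_iff_add_le, le_div_iff₀ (by positivity)]; nlinarith
      · rw [sub_le_iff_le_add, div_le_iff₀ (by positivity)]; nlinarith
    · rw [max_eq_left (by linarith), abs_le]
      constructor
      · rw [le_sub_iff_add_le, le_div_iff₀ (by positivity)]; nlinarith
      · rw [sub_le_iff_le_add, div_le_iff₀ (by positivity)]; nlinarith

theorem memLp_max_sub {d : ℕ} {Ω : Set (Eucl d)} (hfin : volume Ω ≠ ⊤) {u : Eucl d → ℝ}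
    (hu : MemLp u 2 (volume.restrict Ω)) (κ : ℝ) :
    MemLp (fun x => max (u x - κ) 0) 2 (volume.restrict Ω) := by
  have : IsFiniteMeasure (volume.restrict Ω : Measure (Eucl d)) :=
    ⟨by rw [Measure.restrict_apply_univ]; exact hfin.lt_top⟩
  exact (hu.sub (memLp_const κ)).pos_part

theorem aestronglyMeasurable_indicator_lt {d : ℕ} {μ : Measure (Eucl d)} {u : Eucl d → ℝ}
    {g : Eucl d → Eucl d} (hu : AEStronglyMeasurable u μ) (hg : AEStronglyMeasurable g μ) (κ : ℝ) :
    AEStronglyMeasurable ({x | κ < u x}.indicator g) μ :=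
  hg.indicator₀ (nullMeasurableSet_lt aemeasurable_const hu.aemeasurable)

theorem memLp_indicator_lt {d : ℕ} {μ : Measure (Eucl d)} {u : Eucl d → ℝ}
    {g : Eucl d → Eucl d} (hu : AEStronglyMeasurable u μ) (hg : MemLp g 2 μ) (κ : ℝ) :
    MemLp ({x | κ < u x}.indicator g) 2 μ :=
  hg.mono (aestronglyMeasurable_indicator_lt hu hg.1 κ)
    (Eventually.of_forall fun _ => norm_indicator_le_norm_self _ _)

/-- The weak gradient of a truncation. -/
theorem HasWeakGradient.max_sub {d : ℕ} {Ω : Set (Eucl d)} (hΩ : IsOpen Ω)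
    (hfin : volume Ω ≠ ⊤) {u : Eucl d → ℝ} {g : Eucl d → Eucl d}
    (hu : MemLp u 2 (volume.restrict Ω)) (hg : MemLp g 2 (volume.restrict Ω))
    (h : HasWeakGradient Ω u g) (κ : ℝ) :
    HasWeakGradient Ω (fun x => max (u x - κ) 0) ({x | κ < u x}.indicator g) := by
  refine ⟨locallyIntegrableOn_of_memLp (memLp_max_sub hfin hu κ),
    locallyIntegrableOn_of_memLp (memLp_indicator_lt hu.1 hg κ), fun φ hφ i => ?_⟩
  have hμ : IsFiniteMeasure (volume.restrict Ω : Measure (Eucl d)) :=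
    ⟨by rw [Measure.restrict_apply_univ]; exact hfin.lt_top⟩
  have hφ1 : ContDiff ℝ 1 φ := hφ.smooth.of_le (by exact_mod_cast le_top)
  have hproj : Continuous fun v : Eucl d => v i := (EuclideanSpace.proj (𝕜 := ℝ) i).continuous
  obtain ⟨M, hM⟩ := hφ.smooth.continuous.bounded_above_of_compact_support hφ.compact
  have hgφc : Continuous fun x => (gradient φ x) i := hproj.comp (continuous_gradient hφ1)
  have hgφs : HasCompactSupport fun x => (gradient φ x) i := by
    simp_rw [gradient_apply]
    exact hφ.compact.fderiv_apply (𝕜 := ℝ) (EuclideanSpace.single i 1)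
  obtain ⟨M', hM'⟩ := hgφc.bounded_above_of_compact_support hgφs
  have hgi : MemLp (fun x => g x i) 2 (volume.restrict Ω) :=
    (EuclideanSpace.proj (𝕜 := ℝ) i).comp_memLp' hg
  let ε : ℕ → ℝ := fun n => 1 / ((n : ℝ) + 1)
  have hε : ∀ n, 0 < ε n := fun n => by positivity
  have hεlim : Tendsto ε atTop (𝓝 0) := tendsto_one_div_add_atTop_nhds_zero_nat
  have hε1 : ∀ n, ε n ≤ 1 := fun n => by
    rw [div_le_one (by positivity)]; linarith [(Nat.cast_nonneg n : (0 : ℝ) ≤ n)]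
  have hchain : ∀ n, ∫ x in Ω, smoothPos (ε n) (u x - κ) * (gradient φ x) i
      = - ∫ x in Ω, smoothPosDeriv (ε n) (u x - κ) * g x i * φ x := by
    intro n
    obtain ⟨L, hL⟩ := smoothPosDeriv_lipschitz (hε n)
    refine integral_comp_mul_gradient hΩ hu hg h (G := fun t => smoothPos (ε n) (t - κ))
      (G' := fun t => smoothPosDeriv (ε n) (t - κ)) (L := L * 1) (fun t => ?_) (fun t => ?_) ?_ hφ i
    · simpa using! (hasDerivAt_smoothPos (hε n) (t - κ)).comp t ((hasDerivAt_id t).sub_const κ)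
    · have := smoothPosDeriv_mem (hε n) (t - κ)
      rw [abs_of_nonneg this.1]; exact this.2
    · exact hL.comp (LipschitzWith.of_dist_le_mul fun x y => by simp)
  have hcpos : ∀ n, Continuous (smoothPos (ε n)) := fun n =>
    continuous_iff_continuousAt.2 fun t => (hasDerivAt_smoothPos (hε n) t).continuousAt
  have hcder : ∀ n, Continuous (smoothPosDeriv (ε n)) := fun n =>
    (smoothPosDeriv_lipschitz (hε n)).choose_spec.continuous
  have huκ : AEStronglyMeasurable (fun x => u x - κ) (volume.restrict Ω) :=
    hu.1.sub aestronglyMeasurable_const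
  have lim1 : Tendsto (fun n => ∫ x in Ω, smoothPos (ε n) (u x - κ) * (gradient φ x) i) atTop
      (𝓝 (∫ x in Ω, max (u x - κ) 0 * (gradient φ x) i)) := by
    refine tendsto_integral_of_dominated_convergence (fun x => (|max (u x - κ) 0| + 1) * M')
      (fun n => ((hcpos n).comp_aestronglyMeasurable huκ).mul hgφc.aestronglyMeasurable) ?_
      (fun n => Eventually.of_forall fun x => ?_) (Eventually.of_forall fun x => ?_)
    · exact ((((memLp_max_sub hfin hu κ).integrable (by norm_num)).abs).add
        (integrable_const 1)).mul_const _
    · rw [norm_mul]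
      gcongr
      · have := abs_smoothPos_sub_le (hε n) (u x - κ)
        rw [Real.norm_eq_abs]
        have h2 := abs_add_le (smoothPos (ε n) (u x - κ) - max (u x - κ) 0) (max (u x - κ) 0)
        rw [sub_add_cancel] at h2
        linarith [hε1 n]
      · exact hM' x
    · refine Tendsto.mul_const _ ?_
      rw [tendsto_iff_norm_sub_tendsto_zero]
      refine squeeze_zero (fun n => norm_nonneg _) (fun n => ?_) hεlim
      exact abs_smoothPos_sub_le (hε n) _
  have lim2 : Tendsto (fun n => ∫ x in Ω, smoothPosDeriv (ε n) (u x - κ) * g x i * φ x) atTop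
      (𝓝 (∫ x in Ω, ({x | κ < u x}.indicator g x) i * φ x)) := by
    refine tendsto_integral_of_dominated_convergence (fun x => |g x i| * M)
      (fun n => (((hcder n).comp_aestronglyMeasurable huκ).mul hgi.1).mul
        hφ.smooth.continuous.aestronglyMeasurable) ?_
      (fun n => Eventually.of_forall fun x => ?_) (Eventually.of_forall fun x => ?_)
    · exact (hgi.integrable (by norm_num)).abs.mul_const _
    · have := smoothPosDeriv_mem (hε n) (u x - κ)
      rw [norm_mul, norm_mul, Real.norm_of_nonneg this.1]
      calc _ ≤ 1 * ‖g x i‖ * M := by gcongr; exacts [this.2, hM x]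
        _ = _ := by rw [one_mul, Real.norm_eq_abs]
    · refine Tendsto.mul_const _ ?_
      refine tendsto_const_nhds.congr' ?_
      -- The approximation is one-sided: its derivative vanishes on (-∞, 0] for every ε. Hence it
      -- converges pointwise to the strict indicator, and nothing need be known about the gradient
      -- on {u = κ}.
      by_cases hx : κ < u x
      · filter_upwards [hεlim.eventually (gt_mem_nhds (sub_pos.2 hx))] with n hn
        rw [smoothPosDeriv_eq_one (hε n) hn.le, Set.indicator_of_mem (by exact hx), one_mul]
      · refine Eventually.of_forall fun n => ?_
        have hx' : u x - κ ≤ 0 := by linarith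
        simp [smoothPosDeriv_eq_zero (hε n) hx', hx]
  simp_rw [hchain] at lim1
  exact tendsto_nhds_unique lim1 lim2.neg

theorem integrableOn_mul_of_isTestFunction {d : ℕ} {Ω : Set (Eucl d)} {f φ : Eucl d → ℝ}
    (hf : LocallyIntegrableOn f Ω volume) (hφ : Continuous φ) (hφc : HasCompactSupport φ)
    (hφs : tsupport φ ⊆ Ω) : IntegrableOn (fun x => f x * φ x) Ω volume := by
  have h3 : IntegrableOn (fun x => f x * φ x) (tsupport φ) volume :=
    (hf.integrableOn_compact_subset hφs hφc).mul_continuousOn hφ.continuousOn hφc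
  rw [integrableOn_iff_integrable_of_support_subset] at h3
  · exact h3.integrableOn
  · intro x hx
    by_contra hx'
    exact hx (by simp [image_eq_zero_of_notMem_tsupport hx'])

theorem HasWeakGradient.neg {d : ℕ} {Ω : Set (Eucl d)} {u : Eucl d → ℝ} {g : Eucl d → Eucl d}
    (h : HasWeakGradient Ω u g) : HasWeakGradient Ω (fun x => -u x) (fun x => -g x) := by
  refine ⟨h.locInt.neg, h.locInt_grad.neg, fun φ hφ i => ?_⟩
  simp only [neg_mul, PiLp.neg_apply, integral_neg, h.parts φ hφ i]

theorem HasWeakGradient.sub {d : ℕ} {Ω : Set (Eucl d)} {u v : Eucl d → ℝ} {g k : Eucl d → Eucl d}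
    (h : HasWeakGradient Ω u g) (h' : HasWeakGradient Ω v k) :
    HasWeakGradient Ω (fun x => u x - v x) (fun x => g x - k x) := by
  refine ⟨h.locInt.sub h'.locInt, h.locInt_grad.sub h'.locInt_grad, fun φ hφ i => ?_⟩
  have hφ1 : ContDiff ℝ 1 φ := hφ.smooth.of_le (by exact_mod_cast le_top)
  have hproj : Continuous fun v : Eucl d => v i := (EuclideanSpace.proj (𝕜 := ℝ) i).continuous
  have hgφc : Continuous fun x => (gradient φ x) i := hproj.comp (continuous_gradient hφ1)
  have hsub : tsupport (fun x => (gradient φ x) i) ⊆ tsupport φ := by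
    refine closure_minimal (fun x hx => ?_) (isClosed_tsupport _)
    refine support_fderiv_subset ℝ (f := φ) fun h0 => hx ?_
    simp [gradient_apply, h0]
  have hgφs : HasCompactSupport fun x => (gradient φ x) i :=
    HasCompactSupport.of_support_subset_isCompact hφ.compact ((subset_tsupport _).trans hsub)
  have hli : ∀ {f : Eucl d → Eucl d}, LocallyIntegrableOn f Ω volume →
      LocallyIntegrableOn (fun x => f x i) Ω volume := by
    intro f hf x hx
    obtain ⟨s, hs, hfs⟩ := hf x hx
    exact ⟨s, hs, (EuclideanSpace.proj (𝕜 := ℝ) i).integrable_comp hfs⟩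
  simp only [sub_mul, PiLp.sub_apply]
  rw [integral_sub
      (integrableOn_mul_of_isTestFunction h.locInt hgφc hgφs (hsub.trans hφ.support))
      (integrableOn_mul_of_isTestFunction h'.locInt hgφc hgφs (hsub.trans hφ.support)),
    integral_sub
      (integrableOn_mul_of_isTestFunction (hli h.locInt_grad) hφ.smooth.continuous hφ.compact hφ.support)
      (integrableOn_mul_of_isTestFunction (hli h'.locInt_grad) hφ.smooth.continuous hφ.compact hφ.support),
    h.parts φ hφ i, h'.parts φ hφ i]
  ring

/-! ### Finite differences controlled by the gradient -/

/-- `L^p` estimate of the differences of a `C¹` function by its gradient, in a convex set. -/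
theorem lintegral_enorm_sub_rpow_le {d : ℕ} {w : Eucl d → ℝ} (hw : ContDiff ℝ 1 w)
    {K : Set (Eucl d)} (hK : Convex ℝ K) (hKm : MeasurableSet K) (h : Eucl d) {p : ℝ} (hp : 1 ≤ p) :
    ∫⁻ x in K ∩ (fun x => x + h) ⁻¹' K, ‖w (x + h) - w x‖ₑ ^ p
      ≤ ‖h‖ₑ ^ p * ∫⁻ x in K, ‖gradient w x‖ₑ ^ p := by
  have hp0 : 0 ≤ p := by linarith
  set ν : Measure ℝ := volume.restrict (Set.Icc 0 1) with hν
  have : IsProbabilityMeasure ν := ⟨by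
    rw [hν, Measure.restrict_apply_univ, Real.volume_Icc]; simp⟩
  have hgc : Continuous (gradient w) := continuous_gradient hw
  have hpt : ∀ x, ‖w (x + h) - w x‖ₑ ^ p
      ≤ ∫⁻ t, ‖h‖ₑ ^ p * ‖gradient w (x + t • h)‖ₑ ^ p ∂ν := by
    intro x
    have hd : ∀ t : ℝ, HasDerivAt (fun t : ℝ => w (x + t • h))
        (inner ℝ (gradient w (x + t • h)) h) t := by
      intro t
      have h1 : HasDerivAt (fun t : ℝ => x + t • h) h t := by
        simpa using! ((hasDerivAt_id t).smul_const h).const_add x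
      have h2 := ((hw.differentiable (by simp)) (x + t • h)).hasFDerivAt.comp_hasDerivAt t h1
      rw [inner_gradient_left]
      exact h2
    have hcont : Continuous fun t : ℝ => inner ℝ (gradient w (x + t • h)) h := by fun_prop
    -- Fundamental theorem of calculus on the segment from x to x + h; Jensen in t then brings the
    -- power p under the integral.
    have e : w (x + h) - w x = ∫ t in Set.Icc (0 : ℝ) 1, inner ℝ (gradient w (x + t • h)) h := by
      rw [integral_Icc_eq_integral_Ioc, ← intervalIntegral.integral_of_le zero_le_one,
        intervalIntegral.integral_eq_sub_of_hasDerivAt (fun t _ => hd t)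
          (hcont.intervalIntegrable _ _)]
      simp
    have hm : AEMeasurable (fun t : ℝ => ‖h‖ₑ * ‖gradient w (x + t • h)‖ₑ) ν := by
      refine Continuous.aemeasurable ?_
      exact ENNReal.continuous_const_mul (by simp) |>.comp (by fun_prop)
    calc ‖w (x + h) - w x‖ₑ ^ p ≤ (∫⁻ t, ‖h‖ₑ * ‖gradient w (x + t • h)‖ₑ ∂ν) ^ p := by
          refine ENNReal.rpow_le_rpow ?_ hp0
          rw [e]
          refine (enorm_integral_le_lintegral_enorm _).trans (lintegral_mono fun t => ?_)
          rw [mul_comm, ← ofReal_norm, ← ofReal_norm, ← ofReal_norm,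
            ← ENNReal.ofReal_mul (norm_nonneg _)]
          exact ENNReal.ofReal_le_ofReal (norm_inner_le_norm _ _)
      _ ≤ ∫⁻ t, (‖h‖ₑ * ‖gradient w (x + t • h)‖ₑ) ^ p ∂ν :=
          lintegral_rpow_le_lintegral_rpow ν hm hp
      _ = _ := by simp_rw [ENNReal.mul_rpow_of_nonneg _ _ hp0]
  have hKh : MeasurableSet (K ∩ (fun x => x + h) ⁻¹' K) :=
    hKm.inter (hKm.preimage (by fun_prop))
  have hmeas : Measurable fun q : Eucl d × ℝ =>
      ‖h‖ₑ ^ p * ‖gradient w (q.1 + q.2 • h)‖ₑ ^ p := by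
    refine Measurable.const_mul (Measurable.pow_const ?_ _) _
    exact Continuous.measurable (by fun_prop)
  calc ∫⁻ x in K ∩ (fun x => x + h) ⁻¹' K, ‖w (x + h) - w x‖ₑ ^ p
      ≤ ∫⁻ x in K ∩ (fun x => x + h) ⁻¹' K,
          (∫⁻ t, ‖h‖ₑ ^ p * ‖gradient w (x + t • h)‖ₑ ^ p ∂ν) := lintegral_mono hpt
    _ = ∫⁻ t, (∫⁻ x in K ∩ (fun x => x + h) ⁻¹' K,
          ‖h‖ₑ ^ p * ‖gradient w (x + t • h)‖ₑ ^ p) ∂ν := by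
        rw [lintegral_lintegral_swap]
        exact hmeas.aemeasurable
    _ ≤ ∫⁻ t, (‖h‖ₑ ^ p * ∫⁻ x in K, ‖gradient w x‖ₑ ^ p) ∂ν := by
        refine lintegral_mono_ae ?_
        rw [hν]
        filter_upwards [ae_restrict_mem measurableSet_Icc] with t ht
        rw [lintegral_const_mul' _ _ (by simp [hp0])]
        refine mul_le_mul_right ?_ _
        -- After translation by t • h it remains to see that x + t • h stays in K, which is
        -- convexity applied to x and x + h.
        rw [← lintegral_indicator hKh, ← lintegral_indicator hKm,
          ← lintegral_add_right_eq_self (K.indicator _) (t • h)]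
        refine lintegral_mono fun x => ?_
        by_cases hx : x ∈ K ∩ (fun x => x + h) ⁻¹' K
        swap
        · rw [Set.indicator_of_notMem hx]; exact zero_le
        rw [Set.indicator_of_mem hx, Set.indicator_of_mem]
        have := hK hx.1 hx.2 (sub_nonneg.2 ht.2) ht.1 (by ring)
        convert this using 1
        simp only [smul_add, sub_smul, one_smul]
        abel
    _ = _ := by simp

/-- `L^p` estimate of the differences of a Sobolev function by its weak gradient, in a convex
set. -/
theorem HasWeakGradient.eLpNorm_comp_add_sub_le {d : ℕ} {Ω K : Set (Eucl d)} (hΩ : MeasurableSet Ω)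
    (hK : Convex ℝ K) (hKm : MeasurableSet K) (hKfin : volume K ≠ ⊤) {ε : ℝ} (hε : 0 < ε)
    (hKΩ : ∀ x ∈ K, closedBall x ε ⊆ Ω) {u : Eucl d → ℝ} {g : Eucl d → Eucl d}
    (hu : MemLp u 2 (volume.restrict Ω)) (hg : MemLp g 2 (volume.restrict Ω))
    (hug : HasWeakGradient Ω u g) (h : Eucl d) {p : ℝ≥0∞} (hp : 1 ≤ p) (hp2 : p ≤ 2) :
    eLpNorm (fun x => u (x + h) - u x) p (volume.restrict (K ∩ (fun x => x + h) ⁻¹' K))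
      ≤ ‖h‖ₑ * eLpNorm g p (volume.restrict K) := by
  obtain ⟨w, hw, hwu, hwg⟩ := exists_smooth_approx hΩ hKm hε hKΩ hu hg hug
  have hptop : p ≠ ⊤ := (hp2.trans_lt (by norm_num)).ne
  have hp0 : p ≠ 0 := (zero_lt_one.trans_le hp).ne'
  have hpr : 1 ≤ p.toReal := by
    rw [← ENNReal.toReal_one]; exact (ENNReal.toReal_le_toReal (by simp) hptop).2 hp
  set μ : Measure (Eucl d) := volume.restrict K with hμ
  set μ' : Measure (Eucl d) := volume.restrict (K ∩ (fun x => x + h) ⁻¹' K) with hμ'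
  have hμ'μ : μ' ≤ μ := Measure.restrict_mono Set.inter_subset_left le_rfl
  have hw1 : ∀ n, ContDiff ℝ 1 (w n) := fun n => (hw n).of_le (by exact_mod_cast le_top)
  have hKsub : K ⊆ Ω := fun x hx => hKΩ x hx (mem_closedBall_self hε.le)
  have huK : AEStronglyMeasurable u μ := hu.1.mono_measure (Measure.restrict_mono hKsub le_rfl)
  have hgK : AEStronglyMeasurable g μ := hg.1.mono_measure (Measure.restrict_mono hKsub le_rfl)
  have hmp : MeasurePreserving (fun x : Eucl d => x + h) volume volume :=
    measurePreserving_add_right volume h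
  have hmap : Measure.map (fun x => x + h) μ' ≤ μ := by
    rw [hμ, ← (hmp.restrict_preimage hKm).map_eq]
    exact Measure.map_mono (Measure.restrict_mono Set.inter_subset_right le_rfl) (by fun_prop)
  -- K has finite volume, so L² convergence implies L^p convergence for p ≤ 2. The case p = 2 serves
  -- the Poincaré inequality, p = 1 the isoperimetric one.
  have hC : ∀ {E : Type} [NormedAddCommGroup E] (f : ℕ → Eucl d → E),
      (∀ n, AEStronglyMeasurable (f n) μ) →
      Tendsto (fun n => eLpNorm (f n) 2 μ) atTop (𝓝 0) →
      Tendsto (fun n => eLpNorm (f n) p μ) atTop (𝓝 0) := by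
    intro E _ f hfm hf
    have h1 : Tendsto (fun n => eLpNorm (f n) 2 μ *
        (μ Set.univ) ^ (1 / p.toReal - 1 / (2 : ℝ≥0∞).toReal)) atTop (𝓝 0) := by
      have hne : (μ Set.univ) ^ (1 / p.toReal - 1 / (2 : ℝ≥0∞).toReal) ≠ ⊤ := by
        refine ENNReal.rpow_ne_top_of_nonneg ?_ (by rwa [hμ, Measure.restrict_apply_univ])
        rw [sub_nonneg]
        exact one_div_le_one_div_of_le (by linarith)
          ((ENNReal.toReal_le_toReal hptop (by simp)).2 hp2)
      have := ENNReal.Tendsto.mul_const hf (Or.inr hne)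
      rwa [zero_mul] at this
    exact tendsto_of_tendsto_of_tendsto_of_le_of_le tendsto_const_nhds h1 (fun _ => zero_le)
      fun n => eLpNorm_le_eLpNorm_mul_rpow_measure_univ hp2 (hfm n)
  have l1 := hC (fun n x => w n x - u x) (fun n => (hw n).continuous.aestronglyMeasurable.sub huK) hwu
  have l2 := hC (fun n x => gradient (w n) x - g x)
    (fun n => (continuous_gradient (hw1 n)).aestronglyMeasurable.sub hgK) hwg
  have bound : ∀ n, eLpNorm (fun x => u (x + h) - u x) p μ'
      ≤ ‖h‖ₑ * (eLpNorm g p μ + eLpNorm (fun x => gradient (w n) x - g x) p μ)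
        + (eLpNorm (fun x => w n x - u x) p μ + eLpNorm (fun x => w n x - u x) p μ) := by
    intro n
    have hm1 : AEStronglyMeasurable (fun x => w n x - u x) μ :=
      (hw n).continuous.aestronglyMeasurable.sub huK
    have hm1' : AEStronglyMeasurable (fun x => w n x - u x) (Measure.map (fun x => x + h) μ') :=
      hm1.mono_measure hmap
    have hm2 : AEStronglyMeasurable (fun x => w n (x + h) - u (x + h)) μ' :=
      hm1'.comp_aemeasurable (f := fun x => x + h) (by fun_prop)
    have hm3 : AEStronglyMeasurable (fun x => w n (x + h) - w n x) μ' := by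
      have := (hw n).continuous
      exact Continuous.aestronglyMeasurable (by fun_prop)
    have e : (fun x => u (x + h) - u x) = (fun x => w n (x + h) - w n x)
        + ((fun x => w n x - u x) - fun x => w n (x + h) - u (x + h)) := by
      ext x; simp only [Pi.add_apply, Pi.sub_apply]; ring
    rw [e]
    refine (eLpNorm_add_le hm3 ((hm1.mono_measure hμ'μ).sub hm2) hp).trans (add_le_add ?_ ?_)
    · have h1 : eLpNorm (fun x => w n (x + h) - w n x) p μ' ≤ ‖h‖ₑ * eLpNorm (gradient (w n)) p μ := by
        rw [eLpNorm_eq_lintegral_rpow_enorm_toReal hp0 hptop,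
          eLpNorm_eq_lintegral_rpow_enorm_toReal hp0 hptop, one_div,
          ENNReal.rpow_inv_le_iff (by linarith), ENNReal.mul_rpow_of_nonneg _ _ (by linarith),
          ENNReal.rpow_inv_rpow (by linarith)]
        exact lintegral_enorm_sub_rpow_le (hw1 n) hK hKm h hpr
      refine h1.trans ?_
      gcongr
      have e2 : gradient (w n) = g + fun x => gradient (w n) x - g x := by ext x; simp
      conv_lhs => rw [e2]
      exact eLpNorm_add_le hgK ((continuous_gradient (hw1 n)).aestronglyMeasurable.sub hgK) hp
    · refine (eLpNorm_sub_le (hm1.mono_measure hμ'μ) hm2 hp).trans (add_le_add ?_ ?_)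
      · exact eLpNorm_mono_measure _ hμ'μ
      · have := eLpNorm_map_measure (p := p) hm1' (f := fun x => x + h) (by fun_prop)
        change eLpNorm ((fun x => w n x - u x) ∘ fun x => x + h) p μ' ≤ _
        rw [← this]
        exact eLpNorm_mono_measure _ hmap
  refine ge_of_tendsto' (x := atTop) (f := fun n => ‖h‖ₑ * (eLpNorm g p μ +
    eLpNorm (fun x => gradient (w n) x - g x) p μ)
        + (eLpNorm (fun x => w n x - u x) p μ + eLpNorm (fun x => w n x - u x) p μ)) ?_ bound
  have t1 := ENNReal.Tendsto.const_mul (a := ‖h‖ₑ) (l2.const_add (eLpNorm g p μ))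
    (Or.inr enorm_ne_top)
  have := t1.add (l1.add l1)
  simpa using this

/-- Integrated form of an estimate of differences. -/
theorem lintegral_lintegral_enorm_sub_rpow_le {d : ℕ} {K : Set (Eucl d)} (hKm : MeasurableSet K)
    {u : Eucl d → ℝ} (hu : Measurable u) {A : ℝ≥0∞} {p : ℝ} (hp : 0 ≤ p)
    (h : ∀ h : Eucl d, ∫⁻ x in K ∩ (fun x => x + h) ⁻¹' K, ‖u (x + h) - u x‖ₑ ^ p ≤ ‖h‖ₑ ^ p * A)
    (ρ : ℝ) :
    ∫⁻ x in K, ∫⁻ y in K ∩ ball x ρ, ‖u y - u x‖ₑ ^ p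
      ≤ ENNReal.ofReal ρ ^ p * A * volume (ball (0 : Eucl d) ρ) := by
  have hKh : ∀ h : Eucl d, MeasurableSet (K ∩ (fun x => x + h) ⁻¹' K) := fun h =>
    hKm.inter (hKm.preimage (by fun_prop))
  -- Substituting y = x + h turns pairs at distance below ρ into increments |h| < ρ; F is the
  -- integrand extended by zero, so Tonelli applies on the whole space.
  let F : Eucl d → Eucl d → ℝ≥0∞ := fun h x =>
    (ball (0 : Eucl d) ρ).indicator (fun h => (K ∩ (fun x => x + h) ⁻¹' K).indicator
      (fun x => ‖u (x + h) - u x‖ₑ ^ p) x) h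
  have hF : Measurable (Function.uncurry F) := by
    have : Function.uncurry F = ({q : Eucl d × Eucl d | q.1 ∈ ball (0 : Eucl d) ρ} ∩
        {q | q.2 ∈ K} ∩ {q | q.2 + q.1 ∈ K}).indicator fun q => ‖u (q.2 + q.1) - u q.2‖ₑ ^ p := by
      ext ⟨h, x⟩
      by_cases h1 : h ∈ ball (0 : Eucl d) ρ <;> by_cases h2 : x ∈ K <;> by_cases h3 : x + h ∈ K <;>
        simp [F, Function.uncurry, Set.indicator, h2, h3]
    rw [this]
    refine Measurable.indicator (by fun_prop) ?_
    exact ((measurableSet_ball.preimage measurable_fst).inter (hKm.preimage measurable_snd)).inter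
      (hKm.preimage (by fun_prop))
  calc ∫⁻ x in K, ∫⁻ y in K ∩ ball x ρ, ‖u y - u x‖ₑ ^ p
      = ∫⁻ x, ∫⁻ h, F h x := by
        rw [← lintegral_indicator hKm]
        refine lintegral_congr fun x => ?_
        by_cases hx : x ∈ K
        · rw [Set.indicator_of_mem hx, ← lintegral_indicator (hKm.inter measurableSet_ball),
            ← lintegral_add_left_eq_self _ x]
          refine lintegral_congr fun h => ?_
          by_cases h1 : h ∈ ball (0 : Eucl d) ρ <;> by_cases h3 : x + h ∈ K <;>
            simp_all [F, Set.indicator]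
        · rw [Set.indicator_of_notMem hx]
          simp [F, hx]
    _ = ∫⁻ h, ∫⁻ x, F h x := (lintegral_lintegral_swap hF.aemeasurable).symm
    _ ≤ ∫⁻ h, (ball (0 : Eucl d) ρ).indicator (fun _ => ENNReal.ofReal ρ ^ p * A) h := by
        refine lintegral_mono fun k => ?_
        by_cases hk : k ∈ ball (0 : Eucl d) ρ
        · simp only [F, Set.indicator_of_mem hk]
          rw [lintegral_indicator (hKh k)]
          refine (h k).trans ?_
          gcongr
          rw [← ofReal_norm]
          exact ENNReal.ofReal_le_ofReal (by simpa using (mem_ball_zero_iff.1 hk).le)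
        · simp [F, hk]
    _ = _ := by rw [lintegral_indicator measurableSet_ball, setLIntegral_const]

/-! ### Poincaré and isoperimetric inequalities on balls -/

theorem volume_ball_eq {d : ℕ} (x : Eucl d) {r : ℝ} (hr : 0 < r) :
    volume (ball x r) = ENNReal.ofReal (r ^ d) * volume (ball (0 : Eucl d) 1) := by
  rw [Measure.addHaar_ball_of_pos volume x hr]; simp

/-- The volume of the unit ball. -/
noncomputable def unitVol (d : ℕ) : ℝ := volume.real (ball (0 : Eucl d) 1)

theorem unitVol_pos (d : ℕ) : 0 < unitVol d :=
  ENNReal.toReal_pos (measure_ball_pos _ _ one_pos).ne' measure_ball_lt_top.ne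

theorem volume_real_ball {d : ℕ} (x : Eucl d) {r : ℝ} (hr : 0 < r) :
    volume.real (ball x r) = r ^ d * unitVol d := by
  rw [measureReal_def, volume_ball_eq x hr, ENNReal.toReal_mul, ENNReal.toReal_ofReal (by positivity)]
  rfl

theorem ball_eq_ofReal {d : ℕ} (x : Eucl d) {r : ℝ} (hr : 0 < r) :
    volume (ball x r) = ENNReal.ofReal (r ^ d * unitVol d) := by
  rw [← volume_real_ball x hr, ofReal_measureReal measure_ball_lt_top.ne]

/-- Sliding the centre from x towards x₀ by the fraction ρ/(2r) of the segment moves it by at most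
ρ/2 and leaves it within r - ρ/2 of x₀. This bounds the volume of the intersection from below, even
for x near the boundary. -/
theorem exists_ball_half_subset {d : ℕ} {x x₀ : Eucl d} {r ρ : ℝ} (hρ : 0 < ρ) (hρr : ρ ≤ r)
    (hx : x ∈ ball x₀ r) : ∃ z, ball z (ρ / 2) ⊆ ball x₀ r ∩ ball x ρ := by
  have hr : 0 < r := hρ.trans_le hρr
  rw [mem_ball, dist_eq_norm] at hx
  have hθ : ρ / (2 * r) ≤ 1 := by rw [div_le_one (by positivity)]; linarith
  have hθ0 : 0 ≤ ρ / (2 * r) := by positivity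
  refine ⟨x + (ρ / (2 * r)) • (x₀ - x), Set.subset_inter ?_ ?_⟩
  · refine ball_subset_ball' ?_
    rw [dist_eq_norm]
    have : x + (ρ / (2 * r)) • (x₀ - x) - x₀ = (1 - ρ / (2 * r)) • (x - x₀) := by
      module
    rw [this, norm_smul, Real.norm_of_nonneg (by linarith)]
    have h1 : (1 - ρ / (2 * r)) * ‖x - x₀‖ ≤ (1 - ρ / (2 * r)) * r := by gcongr
    have h2 : (1 - ρ / (2 * r)) * r = r - ρ / 2 := by field_simp
    linarith
  · refine ball_subset_ball' ?_
    rw [dist_eq_norm]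
    have : x + (ρ / (2 * r)) • (x₀ - x) - x = (ρ / (2 * r)) • (x₀ - x) := by abel
    rw [this, norm_smul, Real.norm_of_nonneg hθ0, norm_sub_rev]
    have h1 : ρ / (2 * r) * ‖x - x₀‖ ≤ ρ / (2 * r) * r := by gcongr
    have h2 : ρ / (2 * r) * r = ρ / 2 := by field_simp
    linarith

/-- An estimate of Faber–Krahn type on a ball, under a bound on the differences. -/
theorem lintegral_sq_le_of_support {d : ℕ} {x₀ : Eucl d} {r ρ : ℝ} (hρ : 0 < ρ) (hρr : ρ ≤ r)
    {u : Eucl d → ℝ} (hu : Measurable u) {A : ℝ≥0∞}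
    (h : ∀ h : Eucl d, ∫⁻ x in ball x₀ r ∩ (fun x => x + h) ⁻¹' ball x₀ r,
      ‖u (x + h) - u x‖ₑ ^ (2 : ℝ) ≤ ‖h‖ₑ ^ (2 : ℝ) * A)
    (hsupp : volume ({x | u x ≠ 0} ∩ ball x₀ r) ≤ ENNReal.ofReal (ρ ^ d * unitVol d / 2 ^ (d + 1))) :
    ∫⁻ x in ball x₀ r, ‖u x‖ₑ ^ (2 : ℝ) ≤ ENNReal.ofReal (2 ^ (d + 1) * ρ ^ 2) * A := by
  have hω := unitVol_pos d
  -- Half the volume of a ball of radius ρ/2. As u is nonzero on measure at most m, it vanishes on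
  -- measure at least m of the part of the big ball within ρ of any x in it; there |u y - u x| = |u
  -- x|.
  set m : ℝ := ρ ^ d * unitVol d / 2 ^ (d + 1) with hm
  have hm0 : 0 < m := by positivity
  have hz : MeasurableSet {y | u y = 0} := hu (measurableSet_singleton 0)
  have key : ∀ x ∈ ball x₀ r, ENNReal.ofReal m * ‖u x‖ₑ ^ (2 : ℝ)
      ≤ ∫⁻ y in ball x₀ r ∩ ball x ρ, ‖u y - u x‖ₑ ^ (2 : ℝ) := by
    intro x hx
    obtain ⟨z, hzb⟩ := exists_ball_half_subset hρ hρr hx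
    set S := ball x₀ r ∩ ball x ρ with hS
    have hvol : ENNReal.ofReal m ≤ volume ({y | u y = 0} ∩ S) := by
      have h1 : ENNReal.ofReal (m + m) ≤ volume ({y | u y = 0} ∩ S) + ENNReal.ofReal m := by
        have h2 : m + m = (ρ / 2) ^ d * unitVol d := by
          rw [hm, div_pow, pow_succ]; field_simp; ring
        rw [h2, ← ball_eq_ofReal z (by positivity)]
        refine (measure_mono hzb).trans ?_
        have : S ⊆ ({y | u y = 0} ∩ S) ∪ ({x | u x ≠ 0} ∩ ball x₀ r) := by
          intro y hy
          by_cases h0 : u y = 0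
          · exact Or.inl ⟨h0, hy⟩
          · exact Or.inr ⟨h0, hy.1⟩
        exact ((measure_mono this).trans (measure_union_le _ _)).trans (by gcongr)
      rw [ENNReal.ofReal_add hm0.le hm0.le] at h1
      exact (ENNReal.add_le_add_iff_right ENNReal.ofReal_ne_top).1 h1
    calc ENNReal.ofReal m * ‖u x‖ₑ ^ (2 : ℝ) ≤ ‖u x‖ₑ ^ (2 : ℝ) * volume ({y | u y = 0} ∩ S) := by
          rw [mul_comm]; gcongr
      _ = ∫⁻ y in {y | u y = 0} ∩ S, ‖u x‖ₑ ^ (2 : ℝ) := by rw [setLIntegral_const]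
      _ = ∫⁻ y in {y | u y = 0} ∩ S, ‖u y - u x‖ₑ ^ (2 : ℝ) := by
          refine setLIntegral_congr_fun (hz.inter (measurableSet_ball.inter measurableSet_ball))
            fun y hy => ?_
          have : u y = 0 := hy.1
          simp [this]
      _ ≤ _ := lintegral_mono_set Set.inter_subset_right
  have h1 := lintegral_lintegral_enorm_sub_rpow_le measurableSet_ball hu (by norm_num) h ρ
  have h2 : ENNReal.ofReal m * ∫⁻ x in ball x₀ r, ‖u x‖ₑ ^ (2 : ℝ)
      ≤ ENNReal.ofReal ρ ^ (2 : ℝ) * A * volume (ball (0 : Eucl d) ρ) := by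
    rw [← lintegral_const_mul' _ _ ENNReal.ofReal_ne_top]
    exact (setLIntegral_mono' measurableSet_ball key).trans h1
  rw [ball_eq_ofReal _ hρ] at h2
  have h3 : ENNReal.ofReal ρ ^ (2 : ℝ) * A * ENNReal.ofReal (ρ ^ d * unitVol d)
      = ENNReal.ofReal m * (ENNReal.ofReal (2 ^ (d + 1) * ρ ^ 2) * A) := by
    rw [ENNReal.rpow_two, ← ENNReal.ofReal_pow hρ.le, mul_right_comm, ← mul_assoc,
      ← ENNReal.ofReal_mul (by positivity), ← ENNReal.ofReal_mul hm0.le]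
    congr 2
    rw [hm]; field_simp
  rw [h3] at h2
  exact (ENNReal.mul_le_mul_iff_right (by simpa using hm0) ENNReal.ofReal_ne_top).1 h2

/-- An estimate of isoperimetric type on a ball, under a bound on the differences. -/
theorem mul_volume_mul_volume_le {d : ℕ} {x₀ : Eucl d} {r : ℝ} (hr : 0 < r)
    {u : Eucl d → ℝ} (hu : Measurable u) {A : ℝ≥0∞}
    (h : ∀ h : Eucl d, ∫⁻ x in ball x₀ r ∩ (fun x => x + h) ⁻¹' ball x₀ r,
      ‖u (x + h) - u x‖ₑ ^ (1 : ℝ) ≤ ‖h‖ₑ ^ (1 : ℝ) * A) {l : ℝ} (hl : 0 ≤ l) :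
    ENNReal.ofReal l * volume ({x | u x = 0} ∩ ball x₀ r) * volume ({x | u x = l} ∩ ball x₀ r)
      ≤ ENNReal.ofReal ((2 * r) ^ (d + 1) * unitVol d) * A := by
  have h1 := lintegral_lintegral_enorm_sub_rpow_le measurableSet_ball hu (by norm_num) h (2 * r)
  have hz : ∀ t : ℝ, MeasurableSet {y | u y = t} := fun t => hu (measurableSet_singleton t)
  calc ENNReal.ofReal l * volume ({x | u x = 0} ∩ ball x₀ r) * volume ({x | u x = l} ∩ ball x₀ r)
      = ∫⁻ x in {x | u x = l} ∩ ball x₀ r, ENNReal.ofReal l * volume ({x | u x = 0} ∩ ball x₀ r) := by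
        rw [setLIntegral_const]
    -- Each pair with u x = l and u y = 0 contributes exactly l, and no pair is lost because two
    -- points of the ball are less than 2r apart.
    _ ≤ ∫⁻ x in {x | u x = l} ∩ ball x₀ r,
          ∫⁻ y in ball x₀ r ∩ ball x (2 * r), ‖u y - u x‖ₑ ^ (1 : ℝ) := by
        refine setLIntegral_mono' ((hz l).inter measurableSet_ball) fun x hx => ?_
        rw [← setLIntegral_const]
        have hsub : {x | u x = 0} ∩ ball x₀ r ⊆ ball x₀ r ∩ ball x (2 * r) := by
          refine Set.subset_inter Set.inter_subset_right fun y hy => ?_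
          have h1 := mem_ball.1 hy.2
          have h2 := mem_ball.1 hx.2
          rw [mem_ball]
          linarith [dist_triangle_right y x x₀]
        refine le_trans (le_of_eq ?_) (lintegral_mono_set hsub)
        refine setLIntegral_congr_fun ((hz 0).inter measurableSet_ball) fun y hy => ?_
        have h1 : u y = 0 := hy.1
        have h2 : u x = l := hx.1
        simp only [h1, h2, zero_sub, enorm_neg, ENNReal.rpow_one, Real.enorm_of_nonneg hl]
    _ ≤ ∫⁻ x in ball x₀ r,
          ∫⁻ y in ball x₀ r ∩ ball x (2 * r), ‖u y - u x‖ₑ ^ (1 : ℝ) :=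
        lintegral_mono_set Set.inter_subset_right
    _ ≤ _ := h1
    _ = _ := by
        rw [ball_eq_ofReal _ (by positivity), ENNReal.rpow_one, mul_right_comm,
          ← ENNReal.ofReal_mul (by positivity)]
        congr 2; ring

theorem closedBall_half_subset {d : ℕ} {Ω : Set (Eucl d)} {x₀ : Eucl d} {r R : ℝ} (hrR : r < R)
    (hR : ball x₀ R ⊆ Ω) : ∀ x ∈ ball x₀ r, closedBall x ((R - r) / 2) ⊆ Ω := by
  intro x hx y hy
  apply hR
  have h1 := mem_ball.1 hx
  have h2 := mem_closedBall.1 hy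
  rw [mem_ball]
  linarith [dist_triangle y x x₀]

theorem ae_eq_comp_add_restrict {d : ℕ} {K : Set (Eucl d)} (hKm : MeasurableSet K)
    {u u' : Eucl d → ℝ}
    (h : u =ᵐ[volume.restrict K] u') (k : Eucl d) :
    (fun x => u (x + k) - u x) =ᵐ[volume.restrict (K ∩ (fun x => x + k) ⁻¹' K)]
      fun x => u' (x + k) - u' x := by
  have h1 : u =ᵐ[volume.restrict (K ∩ (fun x => x + k) ⁻¹' K)] u' :=
    ae_mono (Measure.restrict_mono Set.inter_subset_left le_rfl) h
  have hmp := (measurePreserving_add_right (volume : Measure (Eucl d)) k).restrict_preimage hKm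
  have h2 := hmp.quasiMeasurePreserving.ae_eq_comp h
  have h3 := ae_mono (Measure.restrict_mono (s' := (fun x => x + k) ⁻¹' K)
    (s := K ∩ (fun x => x + k) ⁻¹' K) Set.inter_subset_right le_rfl) h2
  filter_upwards [h1, h3] with x hx hx'
  simp only [Function.comp] at hx'
  rw [hx, hx']

/-- A Sobolev function with small support in a ball is controlled by its gradient. -/
theorem HasWeakGradient.integral_sq_le {d : ℕ} {Ω : Set (Eucl d)} (hΩ : MeasurableSet Ω)
    {u : Eucl d → ℝ} {g : Eucl d → Eucl d}
    (hu : MemLp u 2 (volume.restrict Ω)) (hg : MemLp g 2 (volume.restrict Ω))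
    (hug : HasWeakGradient Ω u g) {x₀ : Eucl d} {r R ρ : ℝ} (hρ : 0 < ρ) (hρr : ρ ≤ r)
    (hrR : r < R) (hR : ball x₀ R ⊆ Ω)
    (hsupp : volume.real ({x | u x ≠ 0} ∩ ball x₀ r) ≤ ρ ^ d * unitVol d / 2 ^ (d + 1)) :
    ∫ x in ball x₀ r, u x ^ 2 ≤ 2 ^ (d + 1) * ρ ^ 2 * ∫ x in ball x₀ r, ‖g x‖ ^ 2 := by
  have hsub : ball x₀ r ⊆ Ω := (ball_subset_ball hrR.le).trans hR
  have hμ : (volume.restrict (ball x₀ r) : Measure (Eucl d)) ≤ volume.restrict Ω :=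
    Measure.restrict_mono hsub le_rfl
  have huK := hu.mono_measure hμ
  have hgK := hg.mono_measure hμ
  -- The Tonelli estimates need a measurable function; differences, norms and measures of level sets
  -- are unaffected by the change of representative.
  obtain ⟨u', hu'm, huu'⟩ := huK.1.aemeasurable
  have h := lintegral_sq_le_of_support hρ hρr hu'm (x₀ := x₀)
    (A := ∫⁻ x in ball x₀ r, ‖g x‖ₑ ^ (2 : ℝ)) (fun k => by
      have h1 := hug.eLpNorm_comp_add_sub_le hΩ (convex_ball x₀ r) measurableSet_ball
        measure_ball_lt_top.ne (half_pos (sub_pos.2 hrR)) (closedBall_half_subset hrR hR) hu hg k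
        (p := 2) (by norm_num) le_rfl
      rw [eLpNorm_congr_ae (ae_eq_comp_add_restrict measurableSet_ball huu' k)] at h1
      rw [eLpNorm_eq_lintegral_rpow_enorm_toReal (by norm_num) (by norm_num),
        eLpNorm_eq_lintegral_rpow_enorm_toReal (by norm_num) (by norm_num)] at h1
      simp only [ENNReal.toReal_ofNat] at h1
      rwa [one_div, ENNReal.rpow_inv_le_iff (by norm_num),
        ENNReal.mul_rpow_of_nonneg _ _ (by norm_num), ENNReal.rpow_inv_rpow (by norm_num)] at h1)
    (by
      refine le_trans (le_of_eq ?_) (ENNReal.ofReal_le_ofReal hsupp)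
      rw [ofReal_measureReal ((measure_mono Set.inter_subset_right).trans_lt measure_ball_lt_top).ne,
        ← Measure.restrict_apply' measurableSet_ball, ← Measure.restrict_apply' measurableSet_ball]
      refine measure_congr ?_
      filter_upwards [huu'] with x hx
      change (u' x ≠ 0) = (u x ≠ 0)
      rw [hx])
  have e1 : ENNReal.ofReal (∫ x in ball x₀ r, u x ^ 2) = ∫⁻ x in ball x₀ r, ‖u' x‖ₑ ^ (2 : ℝ) := by
    rw [ofReal_integral_eq_lintegral_ofReal huK.integrable_sq (Eventually.of_forall fun x => sq_nonneg _)]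
    refine lintegral_congr_ae ?_
    filter_upwards [huu'] with x hx
    rw [← hx, ENNReal.rpow_two, Real.enorm_eq_ofReal_abs, ← ENNReal.ofReal_pow (abs_nonneg _), sq_abs]
  have e2 : ENNReal.ofReal (∫ x in ball x₀ r, ‖g x‖ ^ 2) = ∫⁻ x in ball x₀ r, ‖g x‖ₑ ^ (2 : ℝ) := by
    rw [ofReal_integral_eq_lintegral_ofReal ((memLp_two_iff_integrable_sq_norm hgK.1).1 hgK)
      (Eventually.of_forall fun x => sq_nonneg _)]
    refine lintegral_congr fun x => ?_
    rw [ENNReal.rpow_two, ← ofReal_norm, ← ENNReal.ofReal_pow (norm_nonneg _)]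
  rw [← e1, ← e2, ← ENNReal.ofReal_mul (by positivity)] at h
  exact (ENNReal.ofReal_le_ofReal_iff (mul_nonneg (by positivity)
    (integral_nonneg fun x => sq_nonneg _))).1 h

/-- De Giorgi's isoperimetric inequality for a Sobolev function in a ball. -/
theorem HasWeakGradient.mul_measure_mul_measure_le {d : ℕ} {Ω : Set (Eucl d)}
    (hΩ : MeasurableSet Ω) {u : Eucl d → ℝ} {g : Eucl d → Eucl d}
    (hu : MemLp u 2 (volume.restrict Ω)) (hg : MemLp g 2 (volume.restrict Ω))
    (hug : HasWeakGradient Ω u g) {x₀ : Eucl d} {r R : ℝ} (hr : 0 < r)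
    (hrR : r < R) (hR : ball x₀ R ⊆ Ω) {l : ℝ} (hl : 0 ≤ l) :
    l * volume.real ({x | u x = 0} ∩ ball x₀ r) * volume.real ({x | u x = l} ∩ ball x₀ r)
      ≤ (2 * r) ^ (d + 1) * unitVol d * ∫ x in ball x₀ r, ‖g x‖ := by
  have hsub : ball x₀ r ⊆ Ω := (ball_subset_ball hrR.le).trans hR
  have hμ : (volume.restrict (ball x₀ r) : Measure (Eucl d)) ≤ volume.restrict Ω :=
    Measure.restrict_mono hsub le_rfl
  have huK := hu.mono_measure hμ
  have hgK := hg.mono_measure hμ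
  have hfin : IsFiniteMeasure (volume.restrict (ball x₀ r) : Measure (Eucl d)) :=
    ⟨by rw [Measure.restrict_apply_univ]; exact measure_ball_lt_top⟩
  obtain ⟨u', hu'm, huu'⟩ := huK.1.aemeasurable
  have h := mul_volume_mul_volume_le hr hu'm (x₀ := x₀)
    (A := ∫⁻ x in ball x₀ r, ‖g x‖ₑ) (fun k => by
      have h1 := hug.eLpNorm_comp_add_sub_le hΩ (convex_ball x₀ r) measurableSet_ball
        measure_ball_lt_top.ne (half_pos (sub_pos.2 hrR)) (closedBall_half_subset hrR hR) hu hg k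
        (p := 1) le_rfl (by norm_num)
      rw [eLpNorm_congr_ae (ae_eq_comp_add_restrict measurableSet_ball huu' k)] at h1
      rw [eLpNorm_one_eq_lintegral_enorm, eLpNorm_one_eq_lintegral_enorm] at h1
      simpa only [ENNReal.rpow_one] using h1) hl
  have e : ∀ t : ℝ, ENNReal.ofReal (volume.real ({x | u x = t} ∩ ball x₀ r))
      = volume ({x | u' x = t} ∩ ball x₀ r) := by
    intro t
    rw [ofReal_measureReal ((measure_mono Set.inter_subset_right).trans_lt measure_ball_lt_top).ne,
        ← Measure.restrict_apply' measurableSet_ball, ← Measure.restrict_apply' measurableSet_ball]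
    refine measure_congr ?_
    filter_upwards [huu'] with x hx
    change (u x = t) = (u' x = t)
    rw [hx]
  have e2 : ENNReal.ofReal (∫ x in ball x₀ r, ‖g x‖) = ∫⁻ x in ball x₀ r, ‖g x‖ₑ := by
    rw [ofReal_integral_eq_lintegral_ofReal (hgK.integrable (by norm_num)).norm
      (Eventually.of_forall fun x => norm_nonneg _)]
    refine lintegral_congr fun x => ofReal_norm _
  have hω := unitVol_pos d
  rw [← e, ← e, ← e2, ← ENNReal.ofReal_mul hl, ← ENNReal.ofReal_mul (mul_nonneg hl measureReal_nonneg),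
    ← ENNReal.ofReal_mul (by positivity)] at h
  exact (ENNReal.ofReal_le_ofReal_iff (mul_nonneg (by positivity)
    (integral_nonneg fun x => norm_nonneg _))).1 h

/-! ### Energy class and local boundedness -/

/-- The energy estimates for the truncations from above of a Sobolev function `u` with weak
gradient `g`, with a source bounded by `s`. -/
structure EnergyClass {d : ℕ} (C s : ℝ) (Ω : Set (Eucl d)) (u : Eucl d → ℝ)
    (g : Eucl d → Eucl d) : Prop where
  isOpen : IsOpen Ω
  finite : volume Ω ≠ ⊤
  memLp : MemLp u 2 (volume.restrict Ω)
  memLp_grad : MemLp g 2 (volume.restrict Ω)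
  grad : HasWeakGradient Ω u g
  one_le : 1 ≤ C
  nonneg : 0 ≤ s
  energy : ∀ (κ : ℝ) (x₀ : Eucl d) (R r : ℝ), ball x₀ R ⊆ Ω → 0 < r → r < R →
    ∫ x in ball x₀ r, ‖{x | κ < u x}.indicator g x‖ ^ 2
      ≤ C / (R - r) ^ 2 * (∫ x in ball x₀ R, max (u x - κ) 0 ^ 2)
        + C * s * ∫ x in ball x₀ R, max (u x - κ) 0

namespace EnergyClass

variable {d : ℕ} {C s : ℝ} {Ω : Set (Eucl d)} {u : Eucl d → ℝ} {g : Eucl d → Eucl d}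

theorem memLp_trunc (h : EnergyClass C s Ω u g) (κ : ℝ) {K : Set (Eucl d)} (hK : K ⊆ Ω) :
    MemLp (fun x => max (u x - κ) 0) 2 (volume.restrict K) :=
  (memLp_max_sub h.finite h.memLp κ).mono_measure (Measure.restrict_mono hK le_rfl)

theorem integrableOn_trunc (h : EnergyClass C s Ω u g) (κ : ℝ) {x₀ : Eucl d} {r : ℝ}
    (hK : ball x₀ r ⊆ Ω) : IntegrableOn (fun x => max (u x - κ) 0) (ball x₀ r) volume := by
  have : IsFiniteMeasure (volume.restrict (ball x₀ r) : Measure (Eucl d)) :=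
    ⟨by rw [Measure.restrict_apply_univ]; exact measure_ball_lt_top⟩
  exact (h.memLp_trunc κ hK).integrable (by norm_num)

/-- Chebyshev: where u exceeds k', the square of the truncation at k is at least (k' - k)². -/
theorem volume_mul_sq_le (h : EnergyClass C s Ω u g) {x₀ : Eucl d} {r r' k k' : ℝ} (hr : r' ≤ r)
    (hΩ : ball x₀ r ⊆ Ω) (hk : k < k') :
    volume.real ({x | max (u x - k') 0 ≠ 0} ∩ ball x₀ r') * (k' - k) ^ 2
      ≤ ∫ x in ball x₀ r, max (u x - k) 0 ^ 2 := by
  have h1 := mul_meas_ge_le_integral_of_nonneg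
    (Eventually.of_forall fun x => sq_nonneg (max (u x - k) 0))
    (h.memLp_trunc k hΩ).integrable_sq ((k' - k) ^ 2)
  rw [mul_comm] at h1
  refine le_trans ?_ h1
  gcongr
  rw [measureReal_restrict_apply' measurableSet_ball]
  refine measureReal_mono ?_
    ((measure_mono Set.inter_subset_right).trans_lt measure_ball_lt_top).ne
  refine Set.inter_subset_inter (fun x hx => ?_) (ball_subset_ball hr)
  have hx' : k' < u x := by
    by_contra hcon
    exact hx (max_eq_right (by linarith))
  change (k' - k) ^ 2 ≤ max (u x - k) 0 ^ 2
  rw [max_eq_left (by linarith)]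
  gcongr

/-- Where u > k', (u - k')(k' - k) ≤ (u - k)². The linear source term is thereby controlled by the
quadratic quantity being iterated. -/
theorem integral_trunc_le (h : EnergyClass C s Ω u g) {x₀ : Eucl d} {r k k' : ℝ}
    (hΩ : ball x₀ r ⊆ Ω) (hk : k < k') :
    ∫ x in ball x₀ r, max (u x - k') 0 ≤ (∫ x in ball x₀ r, max (u x - k) 0 ^ 2) / (k' - k) := by
  rw [← integral_div]
  refine integral_mono (h.integrableOn_trunc k' hΩ)
    ((h.memLp_trunc k hΩ).integrable_sq.div_const _) fun x => ?_
  have hk0 : 0 < k' - k := sub_pos.2 hk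
  rcases le_total (u x) k' with hx | hx
  · simp only [max_eq_right (by linarith : u x - k' ≤ 0)]
    positivity
  · simp only [max_eq_left (by linarith : 0 ≤ u x - k'), max_eq_left (by linarith : 0 ≤ u x - k)]
    rw [le_div_iff₀ hk0]
    nlinarith

theorem integral_trunc_sq_le (h : EnergyClass C s Ω u g) {x₀ : Eucl d} {r k k' : ℝ}
    (hΩ : ball x₀ r ⊆ Ω) (hk : k ≤ k') :
    ∫ x in ball x₀ r, max (u x - k') 0 ^ 2 ≤ ∫ x in ball x₀ r, max (u x - k) 0 ^ 2 := by
  refine integral_mono (h.memLp_trunc k' hΩ).integrable_sq (h.memLp_trunc k hΩ).integrable_sq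
    fun x => ?_
  have : max (u x - k') 0 ≤ max (u x - k) 0 := max_le_max (by linarith) le_rfl
  have h0 : 0 ≤ max (u x - k') 0 := le_max_right _ _
  dsimp only
  gcongr

/-- One step of De Giorgi's iteration. -/
theorem iteration_step (h : EnergyClass C s Ω u g) {x₀ : Eucl d} {r r' ρ k k' : ℝ} (hρ : 0 < ρ)
    (hρr : ρ ≤ r') (hr : r' < r) (hΩ : ball x₀ r ⊆ Ω) (hk : k < k')
    (hY : (∫ x in ball x₀ r, max (u x - k) 0 ^ 2) / (k' - k) ^ 2 ≤ ρ ^ d * unitVol d / 2 ^ (d + 1)) :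
    ∫ x in ball x₀ r', max (u x - k') 0 ^ 2 ≤ 2 ^ (d + 1) * ρ ^ 2 *
      ((C / (r - r') ^ 2 + C * s / (k' - k)) * ∫ x in ball x₀ r, max (u x - k) 0 ^ 2) := by
  have hk0 : 0 < k' - k := sub_pos.2 hk
  have hC : 0 ≤ C := by linarith [h.one_le]
  have hs := h.nonneg
  -- Chebyshev and `hY` make the support of the truncation at k' small enough for the Poincaré
  -- inequality at scale ρ; the energy inequality then bounds its gradient.
  have h1 := (h.grad.max_sub h.isOpen h.finite h.memLp h.memLp_grad k').integral_sq_le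
    h.isOpen.measurableSet (memLp_max_sub h.finite h.memLp k')
    (memLp_indicator_lt h.memLp.1 h.memLp_grad k') (x₀ := x₀) hρ hρr hr hΩ (by
      refine le_trans ?_ hY
      rw [le_div_iff₀ (by positivity)]
      exact h.volume_mul_sq_le hr.le hΩ hk)
  refine h1.trans ?_
  gcongr
  refine (h.energy k' x₀ r r' hΩ (hρ.trans_le hρr) hr).trans ?_
  rw [add_mul]
  gcongr ?_ + ?_
  · exact mul_le_mul_of_nonneg_left (h.integral_trunc_sq_le hΩ hk.le) (by positivity)
  · calc C * s * ∫ x in ball x₀ r, max (u x - k') 0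
        ≤ C * s * ((∫ x in ball x₀ r, max (u x - k) 0 ^ 2) / (k' - k)) := by
          gcongr; exact h.integral_trunc_le hΩ hk
      _ = _ := by ring

end EnergyClass

/-- De Giorgi's local boundedness: a small `L²` norm of a truncation gives an upper bound. -/
theorem exists_ae_le_of_integral_sq_le (d : ℕ) {C : ℝ} (hC : 1 ≤ C) :
    ∃ δ : ℝ, 0 < δ ∧ ∀ (s : ℝ) (Ω : Set (Eucl d)) (u : Eucl d → ℝ) (g : Eucl d → Eucl d),
      EnergyClass C s Ω u g → ∀ (x₀ : Eucl d) (R k H : ℝ), 0 < R → ball x₀ R ⊆ Ω → 0 ≤ H →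
      s * R ^ 2 ≤ H → ∫ x in ball x₀ R, max (u x - k) 0 ^ 2 ≤ δ * H ^ 2 * R ^ d →
      ∀ᵐ x ∂(volume.restrict (ball x₀ (R / 2))), u x ≤ k + H := by
  have hω := unitVol_pos d
  -- At the scale R σ q^j one step multiplies by at most 2^(d+1) · 18 · C · σ², with 18 = 16 + 2
  -- from the energy and source terms. For σ = 1/X this equals θ/X, where θ = 2^(-(d+2)) is the
  -- required decay rate.
  set X : ℝ := 18 * C * 2 ^ (2 * d + 3) with hX
  have hX2 : 2 ≤ X := by
    have : (1 : ℝ) ≤ 2 ^ (2 * d + 3) := one_le_pow₀ (by norm_num)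
    rw [hX]; nlinarith
  set σ : ℝ := 1 / X with hσ
  have hσ0 : 0 < σ := by positivity
  have hσ2 : σ ≤ 1 / 2 := one_div_le_one_div_of_le (by norm_num) hX2
  -- Chosen so that the inductive bound, divided by the squared level gap (H q^(j+1))², is exactly
  -- the support threshold at scale R σ q^j; the 4 from q^2 turns 2^(d+1) into 2^(d+3).
  set δ : ℝ := σ ^ d * unitVol d / 2 ^ (d + 3) with hδ
  have hδ0 : 0 < δ := by positivity
  refine ⟨δ, hδ0, fun s Ω u g h x₀ R k H hR hΩ hH hsH hint => ?_⟩
  have hsub : ∀ {r : ℝ}, r ≤ R → ball x₀ r ⊆ Ω := fun hr => (ball_subset_ball hr).trans hΩ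
  have concl : ∀ m : ℝ, (∫ x in ball x₀ (R / 2), max (u x - m) 0 ^ 2 ≤ 0) →
      ∀ᵐ x ∂(volume.restrict (ball x₀ (R / 2))), u x ≤ m := by
    intro m hm
    have h0 : ∫ x in ball x₀ (R / 2), max (u x - m) 0 ^ 2 = 0 :=
      le_antisymm hm (integral_nonneg fun x => sq_nonneg _)
    rw [integral_eq_zero_iff_of_nonneg (fun x => sq_nonneg _)
      (h.memLp_trunc m (hsub (by linarith))).integrable_sq] at h0
    filter_upwards [h0] with x hx
    have : max (u x - m) 0 = 0 := by simpa using hx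
    linarith [le_max_left (u x - m) 0]
  -- For H = 0 there is no gap between levels, but the hypothesis already says that the truncation
  -- at k vanishes.
  rcases hH.eq_or_lt with rfl | hH
  · refine (concl k ?_).mono fun x hx => by simpa using hx
    refine le_trans ?_ (hint.trans (by simp))
    exact setIntegral_mono_set (h.memLp_trunc k hΩ).integrable_sq
      (Eventually.of_forall fun x => sq_nonneg _)
      (Eventually.of_forall (ball_subset_ball (by linarith)))
  set q : ℝ := 1 / 2 with hq
  -- Per step, volumes at the shrinking Poincaré scale lose q^d and squared level gaps lose q²; the
  -- smallness condition reproduces itself at exactly this rate.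
  set θ : ℝ := q ^ (d + 2) with hθ
  let kk : ℕ → ℝ := fun j => k + H * (1 - q ^ j)
  let rr : ℕ → ℝ := fun j => R / 2 * (1 + q ^ j)
  have hqj : ∀ j : ℕ, 0 < q ^ j := fun j => by positivity
  have hqj1 : ∀ j : ℕ, q ^ j ≤ 1 := fun j => pow_le_one₀ (by norm_num) (by norm_num)
  have main : ∀ j : ℕ, ∫ x in ball x₀ (rr j), max (u x - kk j) 0 ^ 2 ≤ δ * H ^ 2 * R ^ d * θ ^ j := by
    intro j
    induction j with
    | zero =>
      have e1 : rr 0 = R := by simp only [rr, pow_zero]; ring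
      have e2 : kk 0 = k := by simp [kk]
      rw [e1, e2, pow_zero, mul_one]; exact hint
    | succ j ih =>
      have hkd : kk (j + 1) - kk j = H * q ^ (j + 1) := by
        simp only [kk, pow_succ, hq]; ring
      have hrd : rr j - rr (j + 1) = R * q ^ (j + 2) := by
        simp only [rr, pow_succ, hq]; ring
      have hk : kk j < kk (j + 1) := by
        have : 0 < H * q ^ (j + 1) := by positivity
        linarith
      have hr : rr (j + 1) < rr j := by
        have : 0 < R * q ^ (j + 2) := by positivity
        linarith
      have hrΩ : ball x₀ (rr j) ⊆ Ω := hsub (by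
        have : R / 2 * (1 + q ^ j) ≤ R / 2 * 2 := by gcongr; linarith [hqj1 j]
        change R / 2 * (1 + q ^ j) ≤ R
        linarith)
      have hρ : 0 < R * σ * q ^ j := by positivity
      have hρr : R * σ * q ^ j ≤ rr (j + 1) := by
        calc R * σ * q ^ j ≤ R * (1 / 2) * 1 := by gcongr; exact hqj1 j
          _ = R / 2 * (1 + 0) := by ring
          _ ≤ R / 2 * (1 + q ^ (j + 1)) := by gcongr; exact (hqj _).le
      set Y := ∫ x in ball x₀ (rr j), max (u x - kk j) 0 ^ 2 with hY
      have hY0 : 0 ≤ Y := integral_nonneg fun x => sq_nonneg _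
      have hpow : θ ^ j = (q ^ j) ^ d * (q ^ j) ^ 2 := by
        rw [hθ, ← pow_mul, ← pow_mul, ← pow_mul, ← pow_add]; congr 1; ring
      have hstep := h.iteration_step hρ hρr hr hrΩ hk (by
        rw [← hY, hkd, div_le_iff₀ (by positivity)]
        refine ih.trans (le_of_eq ?_)
        rw [hpow, hδ, pow_succ q j, hq]
        generalize (1 / 2 : ℝ) ^ j = t
        rw [pow_add, pow_add]
        field_simp
        ring)
      refine hstep.trans ?_
      rw [← hY, hkd, hrd]
      have hfac : 2 ^ (d + 1) * (R * σ * q ^ j) ^ 2 *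
          (C / (R * q ^ (j + 2)) ^ 2 + C * s / (H * q ^ (j + 1))) ≤ θ := by
        -- By s R² ≤ H and q^(2j) ≤ q^j the source term is no worse than the energy term.
        have e1 : C * s / (H * q ^ (j + 1)) ≤ 2 * C / (R ^ 2 * (q ^ j) ^ 2) := by
          rw [div_le_div_iff₀ (by positivity) (by positivity), pow_succ, hq]
          have h1 : C * (s * R ^ 2) * ((1 / 2 : ℝ) ^ j) ^ 2 ≤ C * H * ((1 / 2 : ℝ) ^ j) ^ 2 := by
            gcongr
          have h2 : C * H * ((1 / 2 : ℝ) ^ j) ^ 2 ≤ C * H * ((1 / 2 : ℝ) ^ j) := by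
            gcongr
            rw [sq]
            exact mul_le_of_le_one_left (by positivity) (hqj1 j)
          nlinarith
        have e2 : C / (R * q ^ (j + 2)) ^ 2 = 16 * C / (R ^ 2 * (q ^ j) ^ 2) := by
          rw [pow_add, hq]; field_simp; norm_num
        calc 2 ^ (d + 1) * (R * σ * q ^ j) ^ 2 *
              (C / (R * q ^ (j + 2)) ^ 2 + C * s / (H * q ^ (j + 1)))
            ≤ 2 ^ (d + 1) * (R * σ * q ^ j) ^ 2 *
              (16 * C / (R ^ 2 * (q ^ j) ^ 2) + 2 * C / (R ^ 2 * (q ^ j) ^ 2)) := by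
              rw [e2]; gcongr
          _ = 2 ^ (d + 1) * 18 * C * σ ^ 2 := by
              have := hqj j
              field_simp; ring
          _ = (1 / X) * θ := by
              rw [hσ, hθ, hq, hX]
              have : (2 : ℝ) ^ (2 * d + 3) = 2 ^ (d + 1) * 2 ^ (d + 2) := by rw [← pow_add]; congr 1; ring
              rw [this]
              simp only [div_pow, one_pow]
              field_simp
          _ ≤ 1 * θ := by
              gcongr
              rw [div_le_one (by positivity)]; linarith
          _ = θ := one_mul θ
      calc _ = (2 ^ (d + 1) * (R * σ * q ^ j) ^ 2 *
          (C / (R * q ^ (j + 2)) ^ 2 + C * s / (H * q ^ (j + 1)))) * Y := by ring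
        _ ≤ θ * (δ * H ^ 2 * R ^ d * θ ^ j) := by gcongr
        _ = _ := by rw [pow_succ]; ring
  refine concl (k + H) ?_
  have hθ1 : θ < 1 := pow_lt_one₀ (by norm_num) (by norm_num) (by omega)
  have hlim : Tendsto (fun j => δ * H ^ 2 * R ^ d * θ ^ j) atTop (𝓝 0) := by
    have := (tendsto_pow_atTop_nhds_zero_of_lt_one (by positivity : 0 ≤ θ) hθ1).const_mul
      (δ * H ^ 2 * R ^ d)
    rwa [mul_zero] at this
  refine ge_of_tendsto' hlim fun j => le_trans ?_ (main j)
  have hrj : R / 2 ≤ rr j := by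
    have := hqj j
    change R / 2 ≤ R / 2 * (1 + q ^ j)
    nlinarith
  have hrR : rr j ≤ R := by
    have := hqj1 j
    change R / 2 * (1 + q ^ j) ≤ R
    nlinarith
  refine (h.integral_trunc_sq_le (k := kk j) (hsub (by linarith)) ?_).trans ?_
  · have := mul_pos hH (hqj j)
    change k + H * (1 - q ^ j) ≤ k + H
    nlinarith
  · exact setIntegral_mono_set (h.memLp_trunc _ (hsub hrR)).integrable_sq
      (Eventually.of_forall fun x => sq_nonneg _) (Eventually.of_forall (ball_subset_ball hrj))

/-! ### Reduction of the supremum and decay of the oscillation -/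

/-- Cauchy–Schwarz against the indicator of D. Null measurability suffices, as D will be cut out by
level sets of an a.e. measurable function. -/
theorem sq_setIntegral_le {X : Type*} [MeasurableSpace X] {μ : Measure X} [IsFiniteMeasure μ]
    {f : X → ℝ} (hf : MemLp f 2 μ) {D : Set X} (hD : NullMeasurableSet D μ) :
    (∫ x in D, f x ∂μ) ^ 2 ≤ μ.real D * ∫ x, f x ^ 2 ∂μ := by
  obtain ⟨D', hD'D, hD'm, hD'e⟩ := hD.exists_measurable_subset_ae_eq
  rw [← setIntegral_congr_set hD'e, ← measureReal_congr hD'e]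
  have h1 : MemLp (D'.indicator fun _ => (1 : ℝ)) 2 μ := (memLp_const 1).indicator hD'm
  have hinner : ∀ {a b : X → ℝ} (ha : MemLp a 2 μ) (hb : MemLp b 2 μ),
      inner ℝ (ha.toLp a) (hb.toLp b) = ∫ x, a x * b x ∂μ := by
    intro a b ha hb
    rw [L2.inner_def]
    refine integral_congr_ae ?_
    filter_upwards [ha.coeFn_toLp, hb.coeFn_toLp] with x h1 h2
    rw [h1, h2]; simp [mul_comm]
  have h2 := real_inner_mul_inner_self_le (h1.toLp _) (hf.toLp f)
  rw [hinner, hinner, hinner] at h2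
  have e1 : ∫ x, D'.indicator (fun _ => (1 : ℝ)) x * f x ∂μ = ∫ x in D', f x ∂μ := by
    rw [← integral_indicator hD'm]
    congr 1 with x
    by_cases hx : x ∈ D' <;> simp [hx]
  have e2 : ∫ x, D'.indicator (fun _ => (1 : ℝ)) x * D'.indicator (fun _ => (1 : ℝ)) x ∂μ
      = μ.real D' := by
    rw [← integral_indicator_one hD'm]
    congr 1 with x
    by_cases hx : x ∈ D' <;> simp [hx]
  rw [e1, e2] at h2
  simpa only [sq] using h2

namespace EnergyClass

variable {d : ℕ} {C s : ℝ} {Ω : Set (Eucl d)} {u : Eucl d → ℝ} {g : Eucl d → Eucl d}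

/-- The energy estimate for a truncation of a function which is bounded from above. -/
theorem integral_grad_le (h : EnergyClass C s Ω u g) {x₀ : Eucl d} {R k l M : ℝ} (hR : 0 < R)
    (hΩ : ball x₀ (2 * R) ⊆ Ω) (hl : 0 < l) (hM : M ≤ k + 2 * l) (hs : s * R ^ 2 ≤ 2 * l)
    (hu : ∀ᵐ x ∂(volume.restrict (ball x₀ (2 * R))), u x ≤ M) :
    ∫ x in ball x₀ R, ‖{x | k < u x}.indicator g x‖ ^ 2
      ≤ 8 * C * l ^ 2 * 2 ^ d * R ^ d * unitVol d / R ^ 2 := by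
  have hC : 0 ≤ C := by linarith [h.one_le]
  have hs0 := h.nonneg
  have hω := unitVol_pos d
  refine (h.energy k x₀ (2 * R) R hΩ hR (by linarith)).trans ?_
  have hb : ∀ᵐ x ∂(volume.restrict (ball x₀ (2 * R))), max (u x - k) 0 ≤ 2 * l := by
    filter_upwards [hu] with x hx
    exact max_le (by linarith) (by linarith)
  have hfin : IsFiniteMeasure (volume.restrict (ball x₀ (2 * R)) : Measure (Eucl d)) :=
    ⟨by rw [Measure.restrict_apply_univ]; exact measure_ball_lt_top⟩
  have hvol : ∀ c : ℝ, ∫ _ in ball x₀ (2 * R), c = (2 * R) ^ d * unitVol d * c := by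
    intro c
    rw [setIntegral_const, volume_real_ball _ (by positivity), smul_eq_mul]
  have h1 : ∫ x in ball x₀ (2 * R), max (u x - k) 0 ^ 2
      ≤ (2 * R) ^ d * unitVol d * (2 * l) ^ 2 := by
    rw [← hvol]
    refine integral_mono_ae (h.memLp_trunc k hΩ).integrable_sq (integrable_const _) ?_
    filter_upwards [hb] with x hx
    have : 0 ≤ max (u x - k) 0 := le_max_right _ _
    gcongr
  have h2 : ∫ x in ball x₀ (2 * R), max (u x - k) 0 ≤ (2 * R) ^ d * unitVol d * (2 * l) := by
    rw [← hvol]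
    exact integral_mono_ae (h.integrableOn_trunc k hΩ) (integrable_const _) hb
  have e : 2 * R - R = R := by ring
  rw [e]
  calc _ ≤ C / R ^ 2 * ((2 * R) ^ d * unitVol d * (2 * l) ^ 2)
        + C * s * ((2 * R) ^ d * unitVol d * (2 * l)) := by gcongr
    _ = (C * (2 * R) ^ d * unitVol d * (2 * l) / R ^ 2) * (2 * l + s * R ^ 2) := by
        field_simp
    _ ≤ (C * (2 * R) ^ d * unitVol d * (2 * l) / R ^ 2) * (2 * l + 2 * l) := by gcongr
    _ = _ := by rw [mul_pow]; ring

/-- One step in the reduction of the measure of super-level sets. -/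
theorem measure_step (h : EnergyClass C s Ω u g) {x₀ : Eucl d} {R k l M : ℝ} (hR : 0 < R)
    (hΩ : ball x₀ (2 * R) ⊆ Ω) (hl : 0 < l) (hM : M ≤ k + 2 * l) (hs : s * R ^ 2 ≤ 2 * l)
    (hu : ∀ᵐ x ∂(volume.restrict (ball x₀ (2 * R))), u x ≤ M)
    (hhalf : R ^ d * unitVol d / 2 ≤ volume.real ({x | u x ≤ k} ∩ ball x₀ R)) :
    volume.real ({x | k + l < u x} ∩ ball x₀ R) ^ 2 ≤ 2 ^ (3 * d + 7) * C * (R ^ d * unitVol d) *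
      (volume.real ({x | k < u x} ∩ ball x₀ R) - volume.real ({x | k + l < u x} ∩ ball x₀ R)) := by
  have hC : 0 ≤ C := by linarith [h.one_le]
  have hω := unitVol_pos d
  have hRsub : ball x₀ R ⊆ Ω := (ball_subset_ball (by linarith)).trans hΩ
  have hfin : IsFiniteMeasure (volume.restrict (ball x₀ R) : Measure (Eucl d)) :=
    ⟨by rw [Measure.restrict_apply_univ]; exact measure_ball_lt_top⟩
  have hres : (volume.restrict (ball x₀ R) : Measure (Eucl d)) ≤ volume.restrict Ω :=
    Measure.restrict_mono hRsub le_rfl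
  have huR := h.memLp.mono_measure hres
  have hnull : ∀ t : ℝ, NullMeasurableSet {x | t < u x} (volume.restrict (ball x₀ R)) := fun t =>
    nullMeasurableSet_lt aemeasurable_const huR.1.aemeasurable
  have hgm : ∀ t : ℝ, MemLp ({x | t < u x}.indicator g) 2 (volume.restrict Ω) := fun t =>
    memLp_indicator_lt h.memLp.1 h.memLp_grad t
  set D : Set (Eucl d) := {x | k < u x} \ {x | k + l < u x} with hD
  have hDnull : NullMeasurableSet D (volume.restrict (ball x₀ R)) := (hnull k).diff (hnull _)
  -- The isoperimetric inequality is applied to the truncation at k minus the truncation at k + l: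
  -- it is 0 on {u ≤ k}, l on {u > k + l}, and its gradient lives on the slab D between them.
  have iso := ((h.grad.max_sub h.isOpen h.finite h.memLp h.memLp_grad k).sub
    (h.grad.max_sub h.isOpen h.finite h.memLp h.memLp_grad (k + l))).mul_measure_mul_measure_le
      h.isOpen.measurableSet ((memLp_max_sub h.finite h.memLp k).sub
        (memLp_max_sub h.finite h.memLp (k + l))) ((hgm k).sub (hgm (k + l)))
      (x₀ := x₀) (R := 2 * R) hR (by linarith) hΩ hl.le
  have hfinR : ∀ A : Set (Eucl d), volume (A ∩ ball x₀ R) ≠ ⊤ := fun A =>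
    ((measure_mono Set.inter_subset_right).trans_lt measure_ball_lt_top).ne
  have hDvol : volume.real (D ∩ ball x₀ R) = volume.real ({x | k < u x} ∩ ball x₀ R)
      - volume.real ({x | k + l < u x} ∩ ball x₀ R) := by
    simp only [← measureReal_restrict_apply' (measurableSet_ball : MeasurableSet (ball x₀ R))]
    rw [hD, measureReal_def, measure_sdiff (fun x hx => ?_) (hnull _) (measure_ne_top _ _),
      ENNReal.toReal_sub_of_le _ (measure_ne_top _ _)]
    · rfl
    · exact measure_mono fun x (hx : k + l < u x) => (by linarith : k < u x)
    · exact (by linarith : k < k + l).trans hx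
  have hint : ∫ x in ball x₀ R, ‖{x | k < u x}.indicator g x - {x | k + l < u x}.indicator g x‖
      = ∫ x in D, ‖{x | k < u x}.indicator g x‖ ∂(volume.restrict (ball x₀ R)) := by
    rw [← integral_indicator₀ hDnull]
    congr 1 with x
    by_cases h1 : k < u x <;> by_cases h2 : k + l < u x <;> simp [hD, Set.indicator, h1, h2]
    linarith
  -- Because the gradient lives on D, Cauchy–Schwarz gains a factor |D|, which links the slab to the
  -- superlevel set above it.
  have hcs := sq_setIntegral_le ((hgm k).mono_measure hres).norm hDnull
  rw [measureReal_restrict_apply' measurableSet_ball, ← hint] at hcs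
  rw [← hDvol]
  set I := ∫ x in ball x₀ R, ‖{x | k < u x}.indicator g x - {x | k + l < u x}.indicator g x‖ with hI
  set a := volume.real ({x | k + l < u x} ∩ ball x₀ R) with ha
  have ha0 : 0 ≤ a := measureReal_nonneg
  have h1 : l * (R ^ d * unitVol d / 2) * a ≤ (2 * R) ^ (d + 1) * unitVol d * I := by
    refine le_trans ?_ iso
    gcongr ?_ * ?_ * ?_
    · refine hhalf.trans (measureReal_mono ?_ (hfinR _))
      refine Set.inter_subset_inter_left _ fun x hx => ?_
      have hx : u x ≤ k := hx
      change max (u x - k) 0 - max (u x - (k + l)) 0 = 0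
      rw [max_eq_right (by linarith), max_eq_right (by linarith), sub_zero]
    · refine measureReal_mono ?_ (hfinR _)
      refine Set.inter_subset_inter_left _ fun x hx => ?_
      have hx : k + l < u x := hx
      change max (u x - k) 0 - max (u x - (k + l)) 0 = l
      rw [max_eq_left (by linarith), max_eq_left (by linarith)]
      ring
  have h2 := h.integral_grad_le hR hΩ hl hM hs hu
  have hDv0 : 0 ≤ volume.real (D ∩ ball x₀ R) := measureReal_nonneg
  have h3 : (l * (R ^ d * unitVol d / 2) * a) ^ 2 ≤ ((2 * R) ^ (d + 1) * unitVol d) ^ 2 *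
      (volume.real (D ∩ ball x₀ R) * (8 * C * l ^ 2 * 2 ^ d * R ^ d * unitVol d / R ^ 2)) := by
    calc _ ≤ ((2 * R) ^ (d + 1) * unitVol d * I) ^ 2 := by gcongr
      _ = ((2 * R) ^ (d + 1) * unitVol d) ^ 2 * I ^ 2 := by ring
      _ ≤ _ := by
        gcongr
        exact hcs.trans (by gcongr)
  have hpos : 0 < (l * (R ^ d * unitVol d / 2)) ^ 2 := by positivity
  refine le_of_mul_le_mul_left ?_ hpos
  calc _ = (l * (R ^ d * unitVol d / 2) * a) ^ 2 := by ring
    _ ≤ _ := h3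
    _ = _ := by
      have e1 : (2 : ℝ) ^ (3 * d + 7) = (2 ^ d) ^ 3 * 128 := by
        rw [pow_add, ← pow_mul, mul_comm 3 d]; norm_num
      rw [e1, mul_pow 2 R, pow_succ, pow_succ]
      field_simp
      ring

end EnergyClass

/-- A quantitative decay of a monotone sequence. -/
theorem exists_small_of_sq_le {b : ℕ → ℝ} {Γ : ℝ} (hΓ : 0 ≤ Γ) (hb0 : ∀ j, 0 ≤ b j) (hb1 : b 0 ≤ 1)
    {J : ℕ} (hanti : ∀ j < J, b (j + 1) ≤ b j)
    (h : ∀ j < J, b (j + 1) ^ 2 ≤ Γ * (b j - b (j + 1))) : J * b J ^ 2 ≤ Γ := by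
  have hle : ∀ j, j ≤ J → b J ≤ b j := by
    intro j hj
    induction hj using Nat.decreasingInduction with
    | self => exact le_rfl
    | of_succ k hk ih => exact ih.trans (hanti k hk)
  -- The right-hand sides telescope to Γ (b 0 - b J) ≤ Γ, while each of the J squares on the left is
  -- at least b J ^ 2.
  have hsum : ∑ j ∈ Finset.range J, b (j + 1) ^ 2 ≤ ∑ j ∈ Finset.range J, Γ * (b j - b (j + 1)) :=
    Finset.sum_le_sum fun j hj => h j (Finset.mem_range.1 hj)
  rw [← Finset.mul_sum, Finset.sum_range_sub'] at hsum
  have hlow : J * b J ^ 2 ≤ ∑ j ∈ Finset.range J, b (j + 1) ^ 2 := by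
    have := Finset.card_nsmul_le_sum (Finset.range J) (fun j => b (j + 1) ^ 2) (b J ^ 2)
      fun j hj => by
        have h1 := hle (j + 1) (Finset.mem_range.1 hj)
        have h2 := hb0 J
        gcongr
    simpa using this
  have := hb0 J
  nlinarith

/-- De Giorgi's reduction of the supremum. -/
theorem exists_ae_le_of_measure_le (d : ℕ) {C : ℝ} (hC : 1 ≤ C) :
    ∃ γ : ℝ, 0 < γ ∧ γ ≤ 1 / 2 ∧ ∀ (s : ℝ) (Ω : Set (Eucl d)) (u : Eucl d → ℝ)
      (g : Eucl d → Eucl d), EnergyClass C s Ω u g → ∀ (x₀ : Eucl d) (R M L : ℝ), 0 < R →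
      ball x₀ (2 * R) ⊆ Ω → 0 ≤ L → s * R ^ 2 ≤ γ * L →
      (∀ᵐ x ∂(volume.restrict (ball x₀ (2 * R))), u x ≤ M) →
      R ^ d * unitVol d / 2 ≤ volume.real ({x | u x ≤ M - L} ∩ ball x₀ R) →
      ∀ᵐ x ∂(volume.restrict (ball x₀ (R / 2))), u x ≤ M - γ * L := by
  obtain ⟨δ, hδ, hA⟩ := exists_ae_le_of_integral_sq_le d hC
  have hω := unitVol_pos d
  set Γ : ℝ := 2 ^ (3 * d + 7) * C with hΓ
  have hΓ0 : 0 < Γ := by positivity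
  -- J depends only on d and C: so many slabs force the relative measure of the last superlevel set
  -- below δ / (4 ω), with ω the unit volume, which is what local boundedness requires.
  obtain ⟨J, hJ⟩ := exists_nat_gt (Γ / (δ / (4 * unitVol d)) ^ 2)
  set q : ℝ := 1 / 2 with hq
  have hqj : ∀ j : ℕ, 0 < q ^ j := fun j => by positivity
  refine ⟨q ^ (J + 1), hqj _, ?_, ?_⟩
  · exact pow_le_of_le_one (by norm_num) (by norm_num) (by omega)
  intro s Ω u g h x₀ R M L hR hΩ hL hsL hu hhalf
  have hRsub : ball x₀ R ⊆ ball x₀ (2 * R) := ball_subset_ball (by linarith)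
  have huR : ∀ᵐ x ∂(volume.restrict (ball x₀ R)), u x ≤ M := ae_restrict_of_ae_restrict_of_subset hRsub hu
  rcases hL.eq_or_lt with rfl | hL
  · have := ae_restrict_of_ae_restrict_of_subset
      (ball_subset_ball (by linarith : R / 2 ≤ R) (x := x₀)) huR
    simpa using this
  -- Each level halves the distance to M, so the step l = q^(j+1) L satisfies M = kk j + 2 l, as
  -- `measure_step` needs.
  let kk : ℕ → ℝ := fun j => M - q ^ j * L
  have hkk : ∀ j, kk j + q ^ (j + 1) * L = kk (j + 1) := fun j => by
    simp only [kk, pow_succ, hq]; ring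
  have hmono : Monotone kk := monotone_nat_of_le_succ fun j => by
    rw [← hkk]; have := mul_pos (hqj (j + 1)) hL; linarith
  let V : ℝ := R ^ d * unitVol d
  have hV : 0 < V := by positivity
  have hVball : volume.real (ball x₀ R) = V := volume_real_ball x₀ hR
  have hfinR : ∀ A : Set (Eucl d), volume (A ∩ ball x₀ R) ≠ ⊤ := fun A =>
    ((measure_mono Set.inter_subset_right).trans_lt measure_ball_lt_top).ne
  let b : ℕ → ℝ := fun j => volume.real ({x | kk j < u x} ∩ ball x₀ R) / V
  have hbV : ∀ j, volume.real ({x | kk j < u x} ∩ ball x₀ R) = b j * V := fun j => by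
    simp only [b]; field_simp
  have key : J * b J ^ 2 ≤ Γ := by
    refine exists_small_of_sq_le (b := b) hΓ0.le (fun j => div_nonneg measureReal_nonneg hV.le) ?_ ?_ ?_
    · rw [div_le_one hV, ← hVball]
      exact measureReal_mono Set.inter_subset_right measure_ball_lt_top.ne
    · intro j _
      refine div_le_div_of_nonneg_right (measureReal_mono ?_ (hfinR _)) hV.le
      exact Set.inter_subset_inter_left _ fun x hx => (hmono (Nat.le_succ j)).trans_lt hx
    · intro j hj
      have hst := h.measure_step (k := kk j) (l := q ^ (j + 1) * L) (M := M) hR hΩ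
        (mul_pos (hqj _) hL) (by simp only [kk, pow_succ, hq]; linarith)
        (by
          have h1 : q ^ (J + 1) ≤ q ^ (j + 1) :=
            pow_le_pow_of_le_one (by norm_num) (by norm_num) (by omega)
          have h2 : q ^ (J + 1) * L ≤ q ^ (j + 1) * L := by gcongr
          have h3 := mul_pos (hqj (j + 1)) hL
          linarith) hu
        (hhalf.trans (measureReal_mono (Set.inter_subset_inter_left _ fun x hx => by
          have hx : u x ≤ M - L := hx
          have : kk 0 ≤ kk j := hmono (Nat.zero_le j)
          have e : kk 0 = M - L := by simp [kk]
          change u x ≤ kk j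
          linarith) (hfinR _)))
      rw [hkk, hbV, hbV] at hst
      have : b (j + 1) ^ 2 * V ^ 2 ≤ (Γ * (b j - b (j + 1))) * V ^ 2 := by
        calc _ = (b (j + 1) * V) ^ 2 := by ring
          _ ≤ _ := hst
          _ = _ := by simp only [V]; ring
      exact le_of_mul_le_mul_right this (by positivity)
  have hbJ : b J ≤ δ / (4 * unitVol d) := by
    have hε : 0 < δ / (4 * unitVol d) := by positivity
    by_contra hcon
    have hcon := not_le.1 hcon
    rw [div_lt_iff₀ (by positivity)] at hJ
    have hJ0 : (0 : ℝ) ≤ J := Nat.cast_nonneg J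
    have h1 : (δ / (4 * unitVol d)) ^ 2 ≤ b J ^ 2 := by gcongr
    have h2 : (J : ℝ) * (δ / (4 * unitVol d)) ^ 2 ≤ J * b J ^ 2 := by gcongr
    linarith
  have hfin : IsFiniteMeasure (volume.restrict (ball x₀ R) : Measure (Eucl d)) :=
    ⟨by rw [Measure.restrict_apply_univ]; exact measure_ball_lt_top⟩
  have hres : (volume.restrict (ball x₀ R) : Measure (Eucl d)) ≤ volume.restrict Ω :=
    Measure.restrict_mono (hRsub.trans hΩ) le_rfl
  have hnull : NullMeasurableSet {x | kk J < u x} (volume.restrict (ball x₀ R)) :=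
    nullMeasurableSet_lt aemeasurable_const (h.memLp.mono_measure hres).1.aemeasurable
  -- H is half of M - kk J, so the truncation is at most 2H on a set of relative measure b J; the 4
  -- in δ / (4 ω) absorbs (2H)². The new bound kk J + H is M - q^(J+1) L.
  have hfinal := hA s Ω u g h x₀ R (kk J) (q ^ (J + 1) * L) hR (hRsub.trans hΩ)
    (mul_pos (hqj _) hL).le hsL (by
      have h1 : ∫ x in ball x₀ R, max (u x - kk J) 0 ^ 2
          ≤ ∫ x in ball x₀ R, {x | kk J < u x}.indicator (fun _ => (q ^ J * L) ^ 2) x := by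
        refine integral_mono_ae (h.memLp_trunc _ (hRsub.trans hΩ)).integrable_sq
          ((integrable_const _).indicator₀ hnull) ?_
        filter_upwards [huR] with x hx
        by_cases hxk : kk J < u x
        · rw [Set.indicator_of_mem (by exact hxk), max_eq_left (by linarith)]
          have : u x - kk J ≤ q ^ J * L := by simp only [kk]; linarith
          have h0 : 0 ≤ u x - kk J := by linarith
          gcongr
        · rw [Set.indicator_of_notMem (by exact hxk), max_eq_right (by linarith)]; simp
      refine h1.trans ?_
      rw [integral_indicator₀ hnull, setIntegral_const, measureReal_restrict_apply' measurableSet_ball,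
        hbV, smul_eq_mul]
      calc b J * V * (q ^ J * L) ^ 2 ≤ δ / (4 * unitVol d) * V * (q ^ J * L) ^ 2 := by gcongr
        _ = _ := by
          simp only [V]
          rw [pow_succ q J, hq]
          field_simp
          norm_num)
  refine hfinal.mono fun x hx => hx.trans (le_of_eq ?_)
  simp only [kk, pow_succ, hq]; ring

/-- Oscillation decay from a ball to the concentric ball of a quarter of the radius. -/
theorem exists_oscillation_step (d : ℕ) {C : ℝ} (hC : 1 ≤ C) :
    ∃ γ : ℝ, 0 < γ ∧ γ ≤ 1 / 2 ∧ ∀ (s : ℝ) (Ω : Set (Eucl d)) (u : Eucl d → ℝ)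
      (g : Eucl d → Eucl d), EnergyClass C s Ω u g →
      EnergyClass C s Ω (fun x => -u x) (fun x => -g x) → ∀ (x₀ : Eucl d) (R m Q : ℝ), 0 < R →
      ball x₀ R ⊆ Ω → 0 ≤ Q → s * R ^ 2 ≤ γ * Q →
      (∀ᵐ x ∂(volume.restrict (ball x₀ R)), m ≤ u x ∧ u x ≤ m + Q) →
      ∃ m' : ℝ, ∀ᵐ x ∂(volume.restrict (ball x₀ (R / 4))),
        m' ≤ u x ∧ u x ≤ m' + Q * (1 - γ / 2) := by
  obtain ⟨γ, hγ, hγ2, hB⟩ := exists_ae_le_of_measure_le d hC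
  refine ⟨γ, hγ, hγ2, fun s Ω u g hp hm x₀ R m Q hR hΩ hQ hsQ hu => ?_⟩
  have hω := unitVol_pos d
  have e2 : 2 * (R / 2) = R := by ring
  have e4 : R / 2 / 2 = R / 4 := by ring
  have hs : s * (R / 2) ^ 2 ≤ γ * (Q / 2) := by nlinarith [hp.nonneg, mul_nonneg hγ.le hQ]
  have hu4 : ∀ᵐ x ∂(volume.restrict (ball x₀ (R / 4))), m ≤ u x ∧ u x ≤ m + Q :=
    ae_restrict_of_ae_restrict_of_subset (ball_subset_ball (by linarith)) hu
  -- On at least half of the ball of radius R/2, either u or -u is on the good side of the midpoint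
  -- m + Q/2. The first case lowers the upper bound, the second raises the lower bound, by γ Q / 2.
  by_cases hcase : (R / 2) ^ d * unitVol d / 2
      ≤ volume.real ({x | u x ≤ (m + Q) - Q / 2} ∩ ball x₀ (R / 2))
  · have h := hB s Ω u g hp x₀ (R / 2) (m + Q) (Q / 2) (by positivity) (by rwa [e2]) (by positivity)
      hs (by rw [e2]; exact hu.mono fun x hx => hx.2) hcase
    rw [e4] at h
    refine ⟨m, ?_⟩
    filter_upwards [h, hu4] with x hx hx'
    exact ⟨hx'.1, by linarith⟩
  · have hcase' : (R / 2) ^ d * unitVol d / 2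
        ≤ volume.real ({x | -u x ≤ -m - Q / 2} ∩ ball x₀ (R / 2)) := by
      have h1 : volume.real (ball x₀ (R / 2))
          ≤ volume.real ({x | u x ≤ (m + Q) - Q / 2} ∩ ball x₀ (R / 2))
            + volume.real ({x | -u x ≤ -m - Q / 2} ∩ ball x₀ (R / 2)) := by
        refine le_trans (measureReal_mono ?_ ?_) (measureReal_union_le _ _)
        · intro x hx
          rcases le_total (u x) (m + Q - Q / 2) with h | h
          · exact Or.inl ⟨h, hx⟩
          · exact Or.inr ⟨by change -u x ≤ -m - Q / 2; linarith, hx⟩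
        · rw [← Set.union_inter_distrib_right]
          exact ((measure_mono Set.inter_subset_right).trans_lt measure_ball_lt_top).ne
      rw [volume_real_ball _ (by positivity)] at h1
      linarith
    have h := hB s Ω _ _ hm x₀ (R / 2) (-m) (Q / 2) (by positivity) (by rwa [e2]) (by positivity)
      hs (by rw [e2]; exact hu.mono fun x hx => by linarith [hx.1]) hcase'
    rw [e4] at h
    refine ⟨m + γ * (Q / 2), ?_⟩
    filter_upwards [h, hu4] with x hx hx'
    exact ⟨by linarith, by linarith⟩

/-- Geometric decay of the oscillation. -/
theorem exists_oscillation_decay (d : ℕ) {C : ℝ} (hC : 1 ≤ C) :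
    ∃ γ : ℝ, 0 < γ ∧ γ ≤ 1 / 2 ∧ ∀ (s : ℝ) (Ω : Set (Eucl d)) (u : Eucl d → ℝ)
      (g : Eucl d → Eucl d), EnergyClass C s Ω u g →
      EnergyClass C s Ω (fun x => -u x) (fun x => -g x) → ∀ (x₀ : Eucl d) (R m Q : ℝ), 0 < R →
      ball x₀ R ⊆ Ω → 0 ≤ Q → s * R ^ 2 ≤ γ * Q →
      (∀ᵐ x ∂(volume.restrict (ball x₀ R)), m ≤ u x ∧ u x ≤ m + Q) →
      ∀ n : ℕ, ∃ m' : ℝ, ∀ᵐ x ∂(volume.restrict (ball x₀ ((1 / 4) ^ n * R))),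
        m' ≤ u x ∧ u x ≤ m' + Q * (1 - γ / 2) ^ n := by
  obtain ⟨γ, hγ, hγ2, hB⟩ := exists_oscillation_step d hC
  refine ⟨γ, hγ, hγ2, fun s Ω u g hp hm x₀ R m Q hR hΩ hQ hsQ hu n => ?_⟩
  induction n with
  | zero => exact ⟨m, by simpa using hu⟩
  | succ n ih =>
    obtain ⟨m', hm'⟩ := ih
    have hs := hp.nonneg
    have h1 : ((1 : ℝ) / 4) ^ n ≤ 1 := pow_le_one₀ (by norm_num) (by norm_num)
    have hτ : (0 : ℝ) ≤ 1 - γ / 2 := by linarith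
    obtain ⟨m'', hm''⟩ := hB s Ω u g hp hm x₀ ((1 / 4) ^ n * R) m' (Q * (1 - γ / 2) ^ n)
      (by positivity) ((ball_subset_ball (by nlinarith)).trans hΩ)
      (by positivity) (by
        -- The source scales with the squared radius, by 1/16 per step, hence decays at least as
        -- fast as the oscillation bound since 1/16 ≤ 1 - γ/2; its smallness relative to Q persists.
        have h2 : (((1 : ℝ) / 4) ^ n) ^ 2 ≤ (1 - γ / 2) ^ n := by
          rw [← pow_mul, mul_comm, pow_mul]
          exact pow_le_pow_left₀ (by norm_num) (by norm_num; linarith) n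
        calc s * ((1 / 4) ^ n * R) ^ 2 = (((1 : ℝ) / 4) ^ n) ^ 2 * (s * R ^ 2) := by ring
          _ ≤ (1 - γ / 2) ^ n * (γ * Q) := by gcongr
          _ = _ := by ring) hm'
    refine ⟨m'', ?_⟩
    have e : (1 / 4) ^ n * R / 4 = (1 / 4) ^ (n + 1) * R := by rw [pow_succ]; ring
    rw [e] at hm''
    simpa only [pow_succ, mul_assoc] using hm''

/-! ### From oscillation decay to Hölder continuity -/

/-- The local bound by the `L²` norm. -/
theorem exists_ae_abs_le (d : ℕ) {C : ℝ} (hC : 1 ≤ C) {R : ℝ} (hR : 0 < R) :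
    ∃ c : ℝ, 0 < c ∧ ∀ (s N : ℝ) (Ω : Set (Eucl d)) (u : Eucl d → ℝ)
      (g : Eucl d → Eucl d), EnergyClass C s Ω u g →
      EnergyClass C s Ω (fun x => -u x) (fun x => -g x) → 0 ≤ N → ∫ x in Ω, u x ^ 2 ≤ N ^ 2 →
      ∀ x₀ : Eucl d, ball x₀ R ⊆ Ω →
      ∀ᵐ x ∂(volume.restrict (ball x₀ (R / 2))), |u x| ≤ c * (N + s) := by
  obtain ⟨δ, hδ, hA⟩ := exists_ae_le_of_integral_sq_le d hC
  -- In H = (R² + b)(N + s) the term R² s dominates the source, and b is the value with (b N)² δ R^d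
  -- = N², so that b N ≤ H gives the L² smallness.
  set b := 1 / Real.sqrt (δ * R ^ d) with hb
  have hpos : 0 < δ * R ^ d := by positivity
  have hb0 : 0 < b := by positivity
  have hb2 : b ^ 2 * (δ * R ^ d) = 1 := by
    rw [hb, div_pow, Real.sq_sqrt hpos.le]; field_simp
  refine ⟨R ^ 2 + b, by positivity, fun s N Ω u g hp hm hN hint x₀ hΩ => ?_⟩
  have hs := hp.nonneg
  have key : ∀ (v : Eucl d → ℝ) (k : Eucl d → Eucl d), EnergyClass C s Ω v k →
      ∫ x in Ω, v x ^ 2 ≤ N ^ 2 →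
      ∀ᵐ x ∂(volume.restrict (ball x₀ (R / 2))), v x ≤ (R ^ 2 + b) * (N + s) := by
    intro v k hv hvint
    have h := hA s Ω v k hv x₀ R 0 ((R ^ 2 + b) * (N + s)) hR hΩ (by positivity) (by
        nlinarith [mul_nonneg hb0.le hs, mul_nonneg hb0.le hN, mul_nonneg (sq_nonneg R) hN]) (by
      have h1 : ∫ x in ball x₀ R, max (v x - 0) 0 ^ 2 ≤ ∫ x in ball x₀ R, v x ^ 2 := by
        refine integral_mono (hv.memLp_trunc 0 hΩ).integrable_sq
          (hv.memLp.mono_measure (Measure.restrict_mono hΩ le_rfl)).integrable_sq fun x => ?_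
        dsimp only
        rw [sub_zero, sq_le_sq, abs_of_nonneg (le_max_right _ _)]
        exact max_le (le_abs_self _) (abs_nonneg _)
      have h2 : ∫ x in ball x₀ R, v x ^ 2 ≤ ∫ x in Ω, v x ^ 2 :=
        setIntegral_mono_set hv.memLp.integrable_sq (Eventually.of_forall fun x => sq_nonneg _)
          (Eventually.of_forall hΩ)
      have h3 : b * N ≤ (R ^ 2 + b) * (N + s) := by
        nlinarith [mul_nonneg hb0.le hs, mul_nonneg (sq_nonneg R) hs, mul_nonneg (sq_nonneg R) hN]
      calc _ ≤ N ^ 2 := h1.trans (h2.trans hvint)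
        _ = (b * N) ^ 2 * (δ * R ^ d) := by rw [mul_pow, mul_right_comm, hb2, one_mul]
        _ ≤ ((R ^ 2 + b) * (N + s)) ^ 2 * (δ * R ^ d) := by gcongr
        _ = _ := by ring)
    simpa using h
  filter_upwards [key u g hp hint, key _ _ hm (by simpa using hint)] with x h1 h2
  exact abs_le.2 ⟨by linarith, h1⟩

/-- The Hölder exponent given by the decay rate of the oscillation. -/
theorem exists_exponent {τ : ℝ} (h1 : 1 / 4 ≤ τ) (h2 : τ < 1) :
    ∃ α : ℝ, 0 < α ∧ α ≤ 1 ∧ ∀ n : ℕ, τ ^ n = ((1 / 4 : ℝ) ^ n) ^ α := by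
  have hτ : 0 < τ := by linarith
  have hl : Real.log (1 / 4) < 0 := Real.log_neg (by norm_num) (by norm_num)
  -- The solution of (1/4)^α = τ; the lower bound on τ is what gives α ≤ 1.
  refine ⟨Real.log τ / Real.log (1 / 4), div_pos_of_neg_of_neg (Real.log_neg hτ h2) hl, ?_, ?_⟩
  · rw [div_le_one_of_neg hl]
    exact Real.log_le_log (by norm_num) h1
  · intro n
    have : (1 / 4 : ℝ) ^ (Real.log τ / Real.log (1 / 4)) = τ := by
      rw [Real.rpow_def_of_pos (by norm_num), mul_div_cancel₀ _ hl.ne, Real.exp_log hτ]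
    rw [← Real.rpow_natCast (1 / 4) n, ← Real.rpow_mul (by norm_num), mul_comm, Real.rpow_mul (by norm_num),
      this, Real.rpow_natCast]

/-- Hölder continuity outside a null set, in the balls compactly contained in the unit ball. -/
theorem exists_holder_on_ae (d : ℕ) {C : ℝ} (hC : 1 ≤ C) :
    ∃ α : ℝ, 0 < α ∧ α ≤ 1 ∧ ∀ r : ℝ, r < 1 → ∃ c : ℝ, 0 < c ∧
      ∀ (s N : ℝ) (u : Eucl d → ℝ) (g : Eucl d → Eucl d), EnergyClass C s (ball 0 1) u g →
      EnergyClass C s (ball 0 1) (fun x => -u x) (fun x => -g x) → 0 ≤ N →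
      ∫ x in ball 0 1, u x ^ 2 ≤ N ^ 2 →
      ∃ G : Set (Eucl d), (∀ᵐ x, x ∈ ball 0 r → x ∈ G) ∧
        (∀ x ∈ G ∩ ball 0 r, |u x| ≤ c * (N + s)) ∧
        ∀ x ∈ G ∩ ball 0 r, ∀ y ∈ G ∩ ball 0 r, |u x - u y| ≤ c * (N + s) * dist x y ^ α := by
  obtain ⟨γ, hγ, hγ2, hosc⟩ := exists_oscillation_decay d hC
  set τ := 1 - γ / 2 with hτ
  obtain ⟨α, hα, hα1, hατ⟩ := exists_exponent (τ := τ) (by linarith) (by linarith)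
  refine ⟨α, hα, hα1, fun r hr => ?_⟩
  have hR : 0 < 1 - r := by linarith
  set ρ := (1 - r) / 2 with hρ
  have hρ0 : 0 < ρ := by positivity
  obtain ⟨c, hc, hbdd⟩ := exists_ae_abs_le d hC hR
  -- 2c covers the initial oscillation, and ρ²/γ secures s ρ² ≤ γ Q.
  set c₁ : ℝ := 2 * c + ρ ^ 2 / γ with hc₁
  have hc₁0 : 0 < c₁ := by positivity
  set c₂ : ℝ := c₁ * (16 / ρ) ^ α with hc₂
  have hc₂0 : 0 < c₂ := by positivity
  refine ⟨c + c₂, by positivity, fun s N u g hp hm hN hint => ?_⟩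
  have hs := hp.nonneg
  set Q := c₁ * (N + s) with hQ
  have hQ0 : 0 ≤ Q := by positivity
  have hball : ∀ x₀ ∈ ball (0 : Eucl d) r, ball x₀ (1 - r) ⊆ ball 0 1 := fun x₀ hx₀ =>
    ball_subset_ball' (by have := mem_ball.1 hx₀; linarith)
  have hb : ∀ x₀ ∈ ball (0 : Eucl d) r,
      ∀ᵐ x ∂(volume.restrict (ball x₀ ρ)), |u x| ≤ c * (N + s) := fun x₀ hx₀ =>
    hbdd s N _ u g hp hm hN hint x₀ (hball x₀ hx₀)
  have hQc : 2 * (c * (N + s)) ≤ Q := by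
    have : 0 ≤ ρ ^ 2 / γ * (N + s) := by positivity
    rw [hQ, hc₁]; linarith
  have hdec : ∀ x₀ ∈ ball (0 : Eucl d) r, ∀ n : ℕ, ∃ m' : ℝ,
      ∀ᵐ x ∂(volume.restrict (ball x₀ ((1 / 4) ^ n * ρ))), m' ≤ u x ∧ u x ≤ m' + Q * τ ^ n := by
    intro x₀ hx₀
    refine hosc s _ u g hp hm x₀ ρ (-(c * (N + s))) Q hρ0
      ((ball_subset_ball (by linarith)).trans (hball x₀ hx₀)) hQ0 ?_ ?_
    · have h1 : γ * (ρ ^ 2 / γ * s) = s * ρ ^ 2 := by field_simp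
      have h2 : ρ ^ 2 / γ * s ≤ Q := by
        rw [hQ, hc₁]
        have : 0 ≤ ρ ^ 2 / γ * N := by positivity
        have : 0 ≤ c * (N + s) := by positivity
        linarith
      nlinarith
    · filter_upwards [hb x₀ hx₀] with x hx
      have := abs_le.1 hx
      exact ⟨this.1, by linarith⟩
  choose! m hmn using hdec
  obtain ⟨D, hDc, hDd⟩ := TopologicalSpace.exists_countable_dense (Eucl d)
  -- Each centre and each scale has its own exceptional null set; restricting the centres to a
  -- countable dense set keeps their union null.
  let G : Set (Eucl d) := {x | ∀ x₀ ∈ D, x₀ ∈ ball (0 : Eucl d) r →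
    (x ∈ ball x₀ ρ → |u x| ≤ c * (N + s)) ∧ ∀ n : ℕ, x ∈ ball x₀ ((1 / 4) ^ n * ρ) →
      m x₀ n ≤ u x ∧ u x ≤ m x₀ n + Q * τ ^ n}
  have hnear : ∀ x ∈ ball (0 : Eucl d) r, ∀ η > 0, ∃ x₀ ∈ D, x₀ ∈ ball (0 : Eucl d) r ∧
      dist x x₀ < η := by
    intro x hx η hη
    obtain ⟨x₀, hx₀D, hx₀⟩ := hDd.exists_mem_open (isOpen_ball.inter isOpen_ball)
      (⟨x, hx, mem_ball_self hη⟩ : (ball (0 : Eucl d) r ∩ ball x η).Nonempty)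
    exact ⟨x₀, hx₀D, hx₀.1, by rw [dist_comm]; exact hx₀.2⟩
  have hGb : ∀ x ∈ G ∩ ball 0 r, |u x| ≤ c * (N + s) := by
    rintro x ⟨hxG, hx⟩
    obtain ⟨x₀, hx₀D, hx₀r, hx₀⟩ := hnear x hx ρ hρ0
    exact (hxG x₀ hx₀D hx₀r).1 hx₀
  refine ⟨G, ?_, fun x hx => (hGb x hx).trans ?_, ?_⟩
  · have : ∀ᵐ x, ∀ x₀ ∈ D, x₀ ∈ ball (0 : Eucl d) r →
        (x ∈ ball x₀ ρ → |u x| ≤ c * (N + s)) ∧ ∀ n : ℕ, x ∈ ball x₀ ((1 / 4) ^ n * ρ) →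
          m x₀ n ≤ u x ∧ u x ≤ m x₀ n + Q * τ ^ n := by
      rw [ae_ball_iff hDc]
      intro x₀ _
      by_cases hx₀ : x₀ ∈ ball (0 : Eucl d) r
      · have h1 := (ae_restrict_iff' measurableSet_ball).1 (hb x₀ hx₀)
        have h2 := ae_all_iff.2 fun n => (ae_restrict_iff' measurableSet_ball).1 (hmn x₀ hx₀ n)
        filter_upwards [h1, h2] with x hx1 hx2 _
        exact ⟨hx1, hx2⟩
      · exact Eventually.of_forall fun x h => absurd h hx₀
    exact this.mono fun x hx _ => hx
  · have : 0 ≤ c₂ * (N + s) := by positivity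
    linarith
  · intro x hx y hy
    have hle : |u x - u y| ≤ Q * (16 * (dist x y / ρ)) ^ α := by
      rcases eq_or_ne x y with rfl | hxy
      · rw [sub_self, abs_zero]; positivity
      have ht : 0 < dist x y / ρ := div_pos (dist_pos.2 hxy) hρ0
      have htriv : |u x - u y| ≤ Q := by
        have h1 := abs_le.1 (hGb x hx)
        have h2 := abs_le.1 (hGb y hy)
        exact abs_le.2 ⟨by linarith, by linarith⟩
      have hbig : 1 ≤ 16 * (dist x y / ρ) → |u x - u y| ≤ Q * (16 * (dist x y / ρ)) ^ α := fun h =>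
        htriv.trans (le_mul_of_one_le_right hQ0 (Real.one_le_rpow h hα.le))
      rcases le_or_gt 1 (16 * (dist x y / ρ)) with h | h
      · exact hbig h
      -- With t = dist x y / ρ, (1/4)^(n+1) < t ≤ (1/4)^n. For n = 0 the trivial bound suffices.
      -- Otherwise the coarser scale k = n - 1 leaves room for a centre in D near x whose ball
      -- contains both points. These two quarter steps account for the factor 16.
      obtain ⟨n, hn1, hn2⟩ := exists_nat_pow_near_of_lt_one ht (by linarith)
        (by norm_num : (0 : ℝ) < 1 / 4) (by norm_num)
      obtain _ | k := n
      · exact hbig (by rw [pow_one] at hn1; linarith)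
      have hlt : dist x y < (1 / 4) ^ k * ρ := by
        rw [div_le_iff₀ hρ0] at hn2
        refine hn2.trans_lt ?_
        gcongr ?_ * ρ
        exact pow_lt_pow_right_of_lt_one₀ (by norm_num) (by norm_num) (by omega)
      obtain ⟨x₀, hx₀D, hx₀r, hx₀⟩ := hnear x hx.2 _ (sub_pos.2 hlt)
      have hx' := (hx.1 x₀ hx₀D hx₀r).2 k (mem_ball.2 (by linarith [dist_nonneg (x := x) (y := y)]))
      have hy' := (hy.1 x₀ hx₀D hx₀r).2 k (mem_ball.2 (by linarith [dist_triangle_left y x₀ x]))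
      calc |u x - u y| ≤ Q * τ ^ k := abs_le.2 ⟨by linarith, by linarith⟩
        _ = Q * ((1 / 4 : ℝ) ^ k) ^ α := by rw [hατ]
        _ ≤ _ := by
          gcongr
          rw [pow_succ, pow_succ] at hn1
          linarith
    refine hle.trans ?_
    have e : Q * (16 * (dist x y / ρ)) ^ α = c₂ * (N + s) * dist x y ^ α := by
      have : 16 * (dist x y / ρ) = 16 / ρ * dist x y := by ring
      rw [this, Real.mul_rpow (by positivity) dist_nonneg, hQ, hc₂]; ring
    rw [e]
    gcongr
    linarith

/-- Extension of a function which is Hölder continuous on dense subsets of balls. -/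
theorem exists_holder_extension {d : ℕ} {u : Eucl d → ℝ} {α : ℝ} (hα : 0 < α) {G : Set (Eucl d)}
    (hG : ball (0 : Eucl d) 1 ⊆ closure G) {K : ℝ → ℝ} (hK : ∀ r < 1, 0 ≤ K r)
    (hu : ∀ r < 1, ∀ x ∈ G ∩ ball 0 r, ∀ y ∈ G ∩ ball 0 r, |u x - u y| ≤ K r * dist x y ^ α) :
    ∃ v : Eucl d → ℝ, (∀ x ∈ G ∩ ball 0 1, v x = u x) ∧
      ∀ r < 1, (∀ x ∈ ball (0 : Eucl d) r, ∀ y ∈ ball (0 : Eucl d) r,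
        |v x - v y| ≤ K r * dist x y ^ α) ∧
        ∀ M, (∀ x ∈ G ∩ ball 0 r, |u x| ≤ M) → ∀ x ∈ ball (0 : Eucl d) r, |v x| ≤ M := by
  have hne : ∀ x ∈ ball (0 : Eucl d) 1, (𝓝[G] x).NeBot := fun x hx =>
    mem_closure_iff_nhdsWithin_neBot.1 (hG hx)
  have hsmall : ∀ x ∈ ball (0 : Eucl d) 1, ∃ r < 1, x ∈ ball (0 : Eucl d) r := fun x hx => by
    obtain ⟨r, h1, h2⟩ := exists_between (mem_ball.1 hx)
    exact ⟨r, h2, mem_ball.2 h1⟩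
  have hpow : Tendsto (fun t : ℝ => t ^ α) (𝓝 0) (𝓝 0) := by
    have := (Real.continuousAt_rpow_const 0 α (Or.inr hα.le)).tendsto
    rwa [Real.zero_rpow hα.ne'] at this
  have hmemG : ∀ x r, x ∈ ball (0 : Eucl d) r → ∀ᶠ y in 𝓝[G] x, y ∈ G ∩ ball 0 r :=
    fun x r hx => inter_mem self_mem_nhdsWithin (mem_nhdsWithin_of_mem_nhds (isOpen_ball.mem_nhds hx))
  have hlim : ∀ x ∈ ball (0 : Eucl d) 1, ∃ y, Tendsto u (𝓝[G] x) (𝓝 y) := by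
    intro x hx
    have := hne x hx
    obtain ⟨r, hr, hxr⟩ := hsmall x hx
    -- The Hölder bound on G makes the values of u near x along G a Cauchy filter, so the limit used
    -- by `extendFrom` exists.
    rw [← cauchy_map_iff_exists_tendsto, Metric.cauchy_iff]
    refine ⟨inferInstance, fun ε hε => ?_⟩
    have h2 : Tendsto (fun t : ℝ => K r * (2 * t) ^ α) (𝓝 0) (𝓝 0) := by
      have h3 : Tendsto (fun t : ℝ => 2 * t) (𝓝 0) (𝓝 0) := by
        simpa using (tendsto_id (α := ℝ) (x := 𝓝 0)).const_mul 2
      simpa using (hpow.comp h3).const_mul (K r)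
    obtain ⟨η, hη, hη0⟩ := (((h2.mono_left nhdsWithin_le_nhds).eventually (gt_mem_nhds hε)).and
      (self_mem_nhdsWithin (s := Set.Ioi (0 : ℝ)) (a := 0))).exists
    refine ⟨u '' (G ∩ ball 0 r ∩ ball x η), image_mem_map (inter_mem (hmemG x r hxr)
      (mem_nhdsWithin_of_mem_nhds (ball_mem_nhds x hη0))), ?_⟩
    rintro _ ⟨y, ⟨hy, hyx⟩, rfl⟩ _ ⟨z, ⟨hz, hzx⟩, rfl⟩
    rw [Real.dist_eq]
    refine ((hu r hr y hy z hz).trans ?_).trans_lt hη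
    have := hK r hr
    gcongr
    have h1 := mem_ball.1 hyx
    have h2 := mem_ball.1 hzx
    linarith [dist_triangle_right y z x]
  set v := extendFrom G u with hv
  have hvt : ∀ x ∈ ball (0 : Eucl d) 1, Tendsto u (𝓝[G] x) (𝓝 (v x)) := fun x hx =>
    tendsto_extendFrom (hlim x hx)
  refine ⟨v, fun x hx => ?_, fun r hr => ⟨fun x hx y hy => ?_, fun M hM x hx => ?_⟩⟩
  · have := hne x hx.2
    obtain ⟨r, hr, hxr⟩ := hsmall x hx.2
    refine tendsto_nhds_unique (hvt x hx.2) ?_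
    rw [tendsto_iff_dist_tendsto_zero]
    have hd : Tendsto (fun y => K r * dist y x ^ α) (𝓝[G] x) (𝓝 0) := by
      have h1 : Tendsto (fun y => dist y x) (𝓝[G] x) (𝓝 0) := by
        have : Tendsto (fun y => dist y x) (𝓝 x) (𝓝 (dist x x)) :=
          (continuous_id.dist continuous_const).tendsto x
        rw [dist_self] at this
        exact this.mono_left nhdsWithin_le_nhds
      simpa using (hpow.comp h1).const_mul (K r)
    refine squeeze_zero' (Eventually.of_forall fun y => dist_nonneg) ?_ hd
    filter_upwards [hmemG x r hxr] with y hy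
    exact hu r hr y hy x ⟨hx.1, hxr⟩
  · have hx1 := ball_subset_ball hr.le hx
    have hy1 := ball_subset_ball hr.le hy
    have := hne x hx1
    have := hne y hy1
    have t1 : Tendsto (fun p : Eucl d × Eucl d => |u p.1 - u p.2|) (𝓝[G] x ×ˢ 𝓝[G] y)
        (𝓝 |v x - v y|) :=
      (((hvt x hx1).comp tendsto_fst).sub ((hvt y hy1).comp tendsto_snd)).abs
    have t2 : Tendsto (fun p : Eucl d × Eucl d => K r * dist p.1 p.2 ^ α) (𝓝[G] x ×ˢ 𝓝[G] y)
        (𝓝 (K r * dist x y ^ α)) := by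
      have hc : Continuous fun p : Eucl d × Eucl d => K r * dist p.1 p.2 ^ α :=
        continuous_const.mul (continuous_dist.rpow_const fun _ => Or.inr hα.le)
      refine (hc.tendsto (x, y)).mono_left ?_
      rw [nhds_prod_eq]
      exact Filter.prod_mono nhdsWithin_le_nhds nhdsWithin_le_nhds
    refine le_of_tendsto_of_tendsto t1 t2 ?_
    filter_upwards [(hmemG x r hx).prod_mk (hmemG y r hy)] with p hp
    exact hu r hr _ hp.1 _ hp.2
  · have hx1 := ball_subset_ball hr.le hx
    have := hne x hx1
    refine le_of_tendsto (hvt x hx1).abs ?_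
    filter_upwards [hmemG x r hx] with y hy
    exact hM y hy

theorem holderNorm_le {d : ℕ} {α : ℝ≥0} {F : Set (Eucl d)} {v : Eucl d → ℝ} {M : ℝ} (hM : 0 ≤ M)
    (h1 : ∀ x ∈ F, |v x| ≤ M) (h2 : ∀ x ∈ F, ∀ y ∈ F, |v x - v y| ≤ M * dist x y ^ (α : ℝ)) :
    holderNorm α F v ≤ ENNReal.ofReal (2 * M) := by
  rw [holderNorm, two_mul, ENNReal.ofReal_add hM hM]
  gcongr
  · refine iSup₂_le fun x hx => ?_
    rw [Real.enorm_eq_ofReal_abs]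
    exact ENNReal.ofReal_le_ofReal (h1 x hx)
  · refine iSup₂_le fun x hx => iSup₂_le fun y hy => iSup_le fun hxy => ?_
    refine ENNReal.ofReal_le_ofReal ?_
    have hpos : 0 < ‖x - y‖ := norm_pos_iff.2 (sub_ne_zero.2 hxy)
    rw [div_le_iff₀ (by positivity), ← dist_eq_norm]
    exact h2 x hx y hy

/-- Hölder regularity in the energy class. -/
theorem exists_holder_of_energyClass (d : ℕ) {C : ℝ} (hC : 1 ≤ C) :
    ∃ (α : ℝ≥0) (c : ℝ), 0 < α ∧ α ≤ 1 ∧ 0 < c ∧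
      ∀ (s N : ℝ) (u : Eucl d → ℝ) (g : Eucl d → Eucl d), EnergyClass C s (ball 0 1) u g →
      EnergyClass C s (ball 0 1) (fun x => -u x) (fun x => -g x) → 0 ≤ N →
      ∫ x in ball 0 1, u x ^ 2 ≤ N ^ 2 →
      ∃ v : Eucl d → ℝ, (∀ᵐ x ∂(volume.restrict (ball 0 1)), v x = u x) ∧
        (∀ r : ℝ, r < 1 → ∃ K : ℝ≥0, HolderOnWith K α v (ball 0 r)) ∧
        holderNorm α (ball 0 (1 / 2)) v ≤ ENNReal.ofReal (c * (N + s)) := by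
  obtain ⟨α, hα, hα1, h⟩ := exists_holder_on_ae d hC
  choose! c hc hmain using h
  lift α to ℝ≥0 using hα.le
  -- The good set depends on the radius. Intersecting over countably many radii tending to 1 gives
  -- one conull set, hence a single v for all r < 1.
  let ρ : ℕ → ℝ := fun n => 1 - 1 / ((n : ℝ) + 2)
  have hρ1 : ∀ n, ρ n < 1 := fun n => by
    have : 0 < 1 / ((n : ℝ) + 2) := by positivity
    simp only [ρ]; linarith
  have hρlim : Tendsto ρ atTop (𝓝 1) := by
    have h1 : Tendsto (fun n : ℕ => 1 / ((n : ℝ) + 2)) atTop (𝓝 0) :=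
      tendsto_const_nhds.div_atTop
        (tendsto_atTop_add_const_right _ _ tendsto_natCast_atTop_atTop)
    have h2 := h1.const_sub 1
    rwa [sub_zero] at h2
  have hex : ∀ r : ℝ, r < 1 → ∃ n, r ≤ ρ n := fun r hr =>
    ((hρlim.eventually (lt_mem_nhds hr)).exists).imp fun n hn => hn.le
  choose! ν hν using hex
  refine ⟨α, 2 * c (ρ (ν (1 / 2))), hα, hα1, by linarith [hc _ (hρ1 (ν (1 / 2)))],
    fun s N u g hp hm hN hint => ?_⟩
  have hs := hp.nonneg
  have hG' := fun r hr => hmain r hr s N u g hp hm hN hint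
  choose! G hGae hGb hGh using hG'
  let G' : Set (Eucl d) := {x | ∀ n, x ∈ ball (0 : Eucl d) (ρ n) → x ∈ G (ρ n)}
  have hG'ae : ∀ᵐ x, x ∈ G' := ae_all_iff.2 fun n => hGae (ρ n) (hρ1 n)
  have hdense : ball (0 : Eucl d) 1 ⊆ closure G' := by
    have : Dense G' := by
      have := Measure.dense_of_ae (μ := (volume : Measure (Eucl d))) (p := fun x => x ∈ G') hG'ae
      exact this
    intro x _
    exact this x
  have hsub : ∀ r < 1, ∀ x ∈ G' ∩ ball 0 r, x ∈ G (ρ (ν r)) ∩ ball 0 (ρ (ν r)) := by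
    rintro r hr x ⟨hx, hxr⟩
    have := ball_subset_ball (hν r hr) hxr
    exact ⟨hx _ this, this⟩
  have hK : ∀ r < 1, 0 ≤ c (ρ (ν r)) * (N + s) := fun r hr =>
    mul_nonneg (hc _ (hρ1 _)).le (by positivity)
  obtain ⟨v, hvu, hv⟩ := exists_holder_extension hα hdense (K := fun r => c (ρ (ν r)) * (N + s)) hK
    fun r hr x hx y hy => hGh _ (hρ1 _) x (hsub r hr x hx) y (hsub r hr y hy)
  refine ⟨v, ?_, fun r hr => ?_, ?_⟩
  · filter_upwards [ae_restrict_of_ae hG'ae, ae_restrict_mem measurableSet_ball] with x hx hx1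
    exact hvu x ⟨hx, hx1⟩
  · refine ⟨Real.toNNReal (c (ρ (ν r)) * (N + s)), fun x hx y hy => ?_⟩
    rw [edist_dist, edist_dist, ENNReal.ofReal_rpow_of_nonneg dist_nonneg hα.le, Real.dist_eq,
      ← ENNReal.ofReal, ← ENNReal.ofReal_mul (hK r hr)]
    exact ENNReal.ofReal_le_ofReal ((hv r hr).1 x hx y hy)
  · have hr : (1 / 2 : ℝ) < 1 := by norm_num
    rw [mul_assoc]
    exact holderNorm_le (hK _ hr) ((hv _ hr).2 _ fun x hx => hGb _ (hρ1 _) x (hsub _ hr x hx))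
      (hv _ hr).1

/-! ### Hölder regularity in De Giorgi classes -/

theorem ae_abs_le_toReal {d : ℕ} {B : Set (Eucl d)} {S : Eucl d → ℝ}
    (hS : MemLp S ⊤ (volume.restrict B)) :
    ∀ᵐ x ∂(volume.restrict B), |S x| ≤ (eLpNorm S ⊤ (volume.restrict B)).toReal := by
  have h := ae_le_eLpNormEssSup (f := S) (μ := volume.restrict B)
  filter_upwards [h] with x hx
  rw [← eLpNorm_exponent_top] at hx
  have := ENNReal.toReal_mono hS.2.ne hx
  simpa using this

/-- The bridge to the energy class: the source is replaced by its essential supremum and `weakGrad`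
by an explicit gradient. The larger constant C' lets both signs share `max Cp Cm`. -/
theorem energyClass_of_localEnergyEstimate {d : ℕ} {C C' : ℝ} (hC : 1 ≤ C) (hCC' : C ≤ C')
    {B : Set (Eucl d)} (hB : IsOpen B) (hfin : volume B ≠ ⊤) {S u : Eucl d → ℝ}
    {g : Eucl d → Eucl d} (hu : MemLp u 2 (volume.restrict B)) (hg : MemLp g 2 (volume.restrict B))
    (hug : HasWeakGradient B u g) (hS : MemLp S ⊤ (volume.restrict B))
    (h : ∀ κ : ℝ, LocalEnergyEstimate C B S (fun x => max (u x - κ) 0)) :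
    EnergyClass C' (eLpNorm S ⊤ (volume.restrict B)).toReal B u g := by
  refine ⟨hB, hfin, hu, hg, hug, hC.trans hCC', ENNReal.toReal_nonneg, fun κ x₀ R r hR hr hrR => ?_⟩
  set s := (eLpNorm S ⊤ (volume.restrict B)).toReal with hs
  have hs0 : 0 ≤ s := ENNReal.toReal_nonneg
  have h1 := h κ x₀ R r hR hr hrR
  have hae := (hug.max_sub hB hfin hu hg κ).weakGrad_ae_eq hB
  have e : ∫ x in ball x₀ r, ‖weakGrad B (fun x => max (u x - κ) 0) x‖ ^ 2
      = ∫ x in ball x₀ r, ‖{x | κ < u x}.indicator g x‖ ^ 2 := by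
    refine integral_congr_ae ?_
    filter_upwards [ae_restrict_of_ae_restrict_of_subset
      ((ball_subset_ball hrR.le).trans hR) hae] with x hx
    rw [hx]
  rw [e] at h1
  have hw : Integrable (fun x => max (u x - κ) 0) (volume.restrict (ball x₀ R)) := by
    have : IsFiniteMeasure (volume.restrict (ball x₀ R) : Measure (Eucl d)) :=
      ⟨by rw [Measure.restrict_apply_univ]; exact measure_ball_lt_top⟩
    exact ((memLp_max_sub hfin hu κ).mono_measure
      (Measure.restrict_mono hR le_rfl)).integrable (by norm_num)
  have h2 : ∫ x in ball x₀ R, |S x| * max (u x - κ) 0 ≤ s * ∫ x in ball x₀ R, max (u x - κ) 0 := by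
    rw [← integral_const_mul]
    refine integral_mono_of_nonneg (Eventually.of_forall fun x => by positivity) (hw.const_mul s) ?_
    filter_upwards [ae_restrict_of_ae_restrict_of_subset hR (ae_abs_le_toReal hS)] with x hx
    have : 0 ≤ max (u x - κ) 0 := le_max_right _ _
    gcongr
  have h3 : 0 ≤ ∫ x in ball x₀ R, max (u x - κ) 0 ^ 2 := integral_nonneg fun x => sq_nonneg _
  have h4 : 0 ≤ ∫ x in ball x₀ R, max (u x - κ) 0 := integral_nonneg fun x => le_max_right _ _
  calc _ ≤ _ := h1
    _ ≤ C / (R - r) ^ 2 * (∫ x in ball x₀ R, max (u x - κ) 0 ^ 2)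
        + C * (s * ∫ x in ball x₀ R, max (u x - κ) 0) := by gcongr
    _ ≤ C' / (R - r) ^ 2 * (∫ x in ball x₀ R, max (u x - κ) 0 ^ 2)
        + C' * (s * ∫ x in ball x₀ R, max (u x - κ) 0) := by gcongr
    _ = _ := by ring

/-- Hölder regularity in the De Giorgi class. -/
theorem DG.exists_holder (d : ℕ) {Cp Cm : ℝ} (hCp : 1 ≤ Cp) :
    ∃ (α : ℝ≥0) (C : ℝ), 0 < α ∧ α ≤ 1 ∧ 0 < C ∧
      ∀ S u : Eucl d → ℝ, MemLp S ⊤ (volume.restrict (ball 0 1)) → DG Cp Cm (ball 0 1) S u →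
        ∃ v : Eucl d → ℝ,
          (∀ᵐ x ∂(volume.restrict (ball 0 1)), v x = u x) ∧
          (∀ r : ℝ, r < 1 → ∃ K : ℝ≥0, HolderOnWith K α v (ball 0 r)) ∧
          holderNorm α (ball 0 (1 / 2)) v
            ≤ ENNReal.ofReal C * (eLpNorm u 2 (volume.restrict (ball 0 1))
                + eLpNorm S ⊤ (volume.restrict (ball 0 1))) := by
  obtain ⟨α, c, hα, hα1, hc, h⟩ := exists_holder_of_energyClass d (C := max Cp Cm)
    (hCp.trans (le_max_left _ _))
  refine ⟨α, c, hα, hα1, hc, fun S u hS hu => ?_⟩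
  obtain ⟨huL, g, hg, hug⟩ := hu.1.memH1
  have hfin : volume (ball (0 : Eucl d) 1) ≠ ⊤ := measure_ball_lt_top.ne
  have hp := energyClass_of_localEnergyEstimate hu.1.one_le (le_max_left Cp Cm) isOpen_ball hfin
    huL hg hug hS hu.1.energy
  have hm := energyClass_of_localEnergyEstimate hu.2.one_le (le_max_right Cp Cm) isOpen_ball hfin
    huL.neg hg.neg hug.neg hS (fun κ => by
      -- The lower truncation of u at -κ is the upper truncation of -u at κ.
      have := hu.2.energy (-κ)
      have e : (fun x => max (-(u x - -κ)) 0) = fun x => max ((-u) x - κ) 0 := by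
        ext x; congr 1; simp only [Pi.neg_apply]; ring
      rwa [e] at this)
  obtain ⟨v, hv1, hv2, hv3⟩ := h _ (eLpNorm u 2 (volume.restrict (ball 0 1))).toReal u g hp hm
    ENNReal.toReal_nonneg (by
      have h1 := eLpNorm_eq_lintegral_rpow_enorm_toReal (μ := volume.restrict (ball (0 : Eucl d) 1))
        (p := 2) (by norm_num) (by norm_num) (f := u)
      simp only [ENNReal.toReal_ofNat] at h1
      have h2 : eLpNorm u 2 (volume.restrict (ball 0 1)) ^ 2
          = ENNReal.ofReal (∫ x in ball 0 1, u x ^ 2) := by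
        rw [ofReal_integral_eq_lintegral_ofReal huL.integrable_sq
          (Eventually.of_forall fun x => sq_nonneg _), h1, ← ENNReal.rpow_natCast,
          ← ENNReal.rpow_mul]
        norm_num
        refine lintegral_congr fun x => ?_
        rw [Real.enorm_eq_ofReal_abs, ← ENNReal.ofReal_pow (abs_nonneg _), sq_abs]
      rw [← ENNReal.toReal_pow, h2, ENNReal.toReal_ofReal (integral_nonneg fun x => sq_nonneg _)])
  refine ⟨v, hv1, hv2, hv3.trans (le_of_eq ?_)⟩
  rw [ENNReal.ofReal_mul hc.le, ENNReal.ofReal_add ENNReal.toReal_nonneg ENNReal.toReal_nonneg,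
    ENNReal.ofReal_toReal huL.2.ne, ENNReal.ofReal_toReal hS.2.ne]

/-! ### Caccioppoli's inequality for weak solutions -/

/-- The derivative is continuous on [0, 1] and vanishes outside. The bound makes the cut-off
constant independent of the ball and of the dimension. -/
theorem exists_deriv_smoothTransition_le :
    ∃ K : ℝ, 0 < K ∧ ∀ t, |deriv Real.smoothTransition t| ≤ K := by
  have hc : Continuous (deriv Real.smoothTransition) :=
    (Real.smoothTransition.contDiff (n := 1)).continuous_deriv (by simp)
  obtain ⟨K, hK⟩ := isCompact_Icc.exists_bound_of_continuousOn (s := Set.Icc (0 : ℝ) 1)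
    hc.continuousOn
  refine ⟨max K 1, by positivity, fun t => ?_⟩
  by_cases ht : t ∈ Set.Icc (0 : ℝ) 1
  · exact (hK t ht).trans (le_max_left _ _)
  · have h0 : deriv Real.smoothTransition t = 0 := by
      rcases lt_or_ge t 0 with h | h
      · have : Real.smoothTransition =ᶠ[𝓝 t] fun _ => 0 := by
          filter_upwards [gt_mem_nhds h] with x hx
          exact Real.smoothTransition.zero_of_nonpos hx.le
        rw [this.deriv_eq, deriv_const]
      · have h1 : 1 < t := by
          by_contra hcon
          exact ht ⟨h, not_lt.1 hcon⟩
        have : Real.smoothTransition =ᶠ[𝓝 t] fun _ => 1 := by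
          filter_upwards [lt_mem_nhds h1] with x hx
          exact Real.smoothTransition.one_of_one_le hx.le
        rw [this.deriv_eq, deriv_const]
    rw [h0, abs_zero]; positivity

/-- Cut-off functions between concentric balls, with a bound on the gradient. -/
theorem exists_cutoff :
    ∃ K : ℝ, 0 < K ∧ ∀ (d : ℕ) (x₀ : Eucl d) (r R : ℝ), 0 < r → r < R →
      ∃ η : Eucl d → ℝ, IsTestFunction (ball x₀ R) η ∧ (∀ x, 0 ≤ η x) ∧ (∀ x, η x ≤ 1) ∧
        (∀ x ∈ ball x₀ r, η x = 1) ∧ ∀ x, ‖gradient η x‖ ≤ K / (R - r) := by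
  obtain ⟨K, hK, hKd⟩ := exists_deriv_smoothTransition_le
  refine ⟨4 * K, by positivity, fun d x₀ r R hr hrR => ?_⟩
  -- An intermediate radius keeps the support in a closed ball inside the open ball of radius R.
  set ρ := (R + r) / 2 with hρ
  have hrρ : r < ρ := by linarith
  have hρR : ρ < R := by linarith
  have hden : 0 < ρ ^ 2 - r ^ 2 := by nlinarith
  -- The squared norm keeps f smooth at the centre; f ≥ 1 within r and f ≤ 0 beyond ρ. Its gradient
  -- there is at most 2ρ/(ρ² - r²) ≤ 2/(ρ - r) = 4/(R - r).
  let f : Eucl d → ℝ := fun x => (ρ ^ 2 - ‖x - x₀‖ ^ 2) / (ρ ^ 2 - r ^ 2)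
  have hf : ContDiff ℝ ∞ f := by
    have : ContDiff ℝ ∞ fun x : Eucl d => ‖x - x₀‖ ^ 2 :=
      (contDiff_id.sub contDiff_const).norm_sq ℝ
    exact (contDiff_const.sub this).div_const _
  have hT : ContDiff ℝ ∞ Real.smoothTransition := Real.smoothTransition.contDiff
  let η : Eucl d → ℝ := fun x => Real.smoothTransition (f x)
  have hzero : ∀ x, x ∉ ball x₀ ρ → η x = 0 := by
    intro x hx
    rw [mem_ball, not_lt, dist_eq_norm] at hx
    refine Real.smoothTransition.zero_of_nonpos (div_nonpos_of_nonpos_of_nonneg ?_ hden.le)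
    nlinarith
  have hts : tsupport η ⊆ closedBall x₀ ρ := by
    refine closure_minimal (fun x hx => ?_) isClosed_closedBall
    by_contra hcon
    exact hx (hzero x fun h => hcon (ball_subset_closedBall h))
  have hη : ContDiff ℝ ∞ η := hT.comp hf
  refine ⟨η, ⟨hη, HasCompactSupport.of_support_subset_isCompact
    (isCompact_closedBall x₀ ρ) ((subset_tsupport _).trans hts),
    hts.trans (closedBall_subset_ball hρR)⟩, fun x => Real.smoothTransition.nonneg _,
    fun x => Real.smoothTransition.le_one _, fun x hx => ?_, fun x => ?_⟩
  · rw [mem_ball, dist_eq_norm] at hx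
    refine Real.smoothTransition.one_of_one_le ?_
    rw [one_le_div hden]
    nlinarith [norm_nonneg (x - x₀)]
  · by_cases hx : x ∈ closedBall x₀ ρ
    · rw [mem_closedBall, dist_eq_norm] at hx
      have hfg : HasFDerivAt f ((-(2 / (ρ ^ 2 - r ^ 2))) • innerSL ℝ (x - x₀)) x := by
        have h1 : HasFDerivAt (fun x : Eucl d => ‖x - x₀‖ ^ 2) (2 • innerSL ℝ (x - x₀)) x := by
          simpa using! ((hasFDerivAt_id x).sub_const x₀).norm_sq
        have h2 := (h1.const_sub (ρ ^ 2)).mul_const (ρ ^ 2 - r ^ 2)⁻¹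
        refine h2.congr_fderiv ?_
        ext v
        simp
        ring
      have hη1 : gradient η x = deriv Real.smoothTransition (f x) • gradient f x :=
        gradient_comp (G := Real.smoothTransition) (G' := deriv Real.smoothTransition)
          (hT.differentiable (by simp) _).hasDerivAt (hf.differentiable (by simp) x)
      have hgf : ‖gradient f x‖ ≤ 2 / (ρ ^ 2 - r ^ 2) * ρ := by
        rw [gradient, LinearIsometryEquiv.norm_map, hfg.fderiv, norm_smul, norm_neg,
          Real.norm_of_nonneg (by positivity), innerSL_apply_norm]
        gcongr
      rw [hη1, norm_smul]
      calc _ ≤ K * (2 / (ρ ^ 2 - r ^ 2) * ρ) := by gcongr; exact hKd _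
        _ ≤ 4 * K / (R - r) := by
          have e : R - r = 2 * (ρ - r) := by rw [hρ]; ring
          have e2 : ρ ^ 2 - r ^ 2 = (ρ - r) * (ρ + r) := by ring
          have h3 : 0 < ρ - r := by linarith
          have h4 : 0 < ρ + r := by linarith
          rw [e, e2, div_mul_eq_mul_div, mul_div_assoc', div_le_div_iff₀ (by positivity) (by positivity)]
          have : 0 ≤ K * (ρ - r) * r := by positivity
          nlinarith
    · have : gradient η x = 0 := by
        have : fderiv ℝ η x = 0 := by
          by_contra hne
          exact hx (hts (support_fderiv_subset ℝ (f := η) hne))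
        rw [gradient, this, map_zero]
      rw [this, norm_zero]
      have : 0 < R - r := by linarith
      positivity

/-- The norm of the image of a vector under a symmetric matrix with a bounded nonnegative
quadratic form. -/
theorem norm_toEuclideanLin_le {d : ℕ} {lam Lam : ℝ} (hlam : 0 < lam) (hLam : 0 < Lam)
    {A : Matrix (Fin d) (Fin d) ℝ} (hA : A.IsSymm)
    (h : ∀ ξ : Eucl d, lam * ‖ξ‖ ^ 2 ≤ inner ℝ (Matrix.toEuclideanLin A ξ) ξ ∧
      inner ℝ (Matrix.toEuclideanLin A ξ) ξ ≤ Lam * ‖ξ‖ ^ 2) (p : Eucl d) :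
    ‖Matrix.toEuclideanLin A p‖ ≤ Lam * ‖p‖ := by
  set T := Matrix.toEuclideanLin A with hT
  have hsymm : T.IsSymmetric := Matrix.isSymmetric_toEuclideanLin_iff.2 (by
    rw [Matrix.IsHermitian, Matrix.conjTranspose_eq_transpose_of_trivial]; exact hA)
  -- Polarization at p ± ξ gives 4 ⟨T p, ξ⟩ ≤ Lam ‖p + ξ‖² by dropping the nonnegative form at p -
  -- ξ. For this ξ both sides contain ‖T p‖² / Lam, with coefficients 4 and, by the parallelogram
  -- law, 2.
  set ξ := Lam⁻¹ • T p with hξ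
  have h1 := (h (p + ξ)).2
  have h2 : 0 ≤ inner ℝ (T (p - ξ)) (p - ξ) := le_trans (by positivity) (h (p - ξ)).1
  have e1 : inner ℝ (T (p + ξ)) (p + ξ) - inner ℝ (T (p - ξ)) (p - ξ) = 4 * inner ℝ (T p) ξ := by
    have : inner ℝ (T ξ) p = inner ℝ (T p) ξ := by
      rw [hsymm ξ p, real_inner_comm]
    simp only [map_add, map_sub, inner_add_left, inner_add_right, inner_sub_left, inner_sub_right]
    linarith
  have e2 : inner ℝ (T p) ξ = Lam⁻¹ * ‖T p‖ ^ 2 := by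
    rw [hξ, inner_smul_right, real_inner_self_eq_norm_sq]
  have e3 : ‖p + ξ‖ ^ 2 ≤ 2 * (‖p‖ ^ 2 + ‖ξ‖ ^ 2) := by
    have := parallelogram_law_with_norm ℝ p ξ
    nlinarith [mul_self_nonneg ‖p - ξ‖]
  have e4 : ‖ξ‖ = Lam⁻¹ * ‖T p‖ := by
    rw [hξ, norm_smul, Real.norm_of_nonneg (by positivity)]
  have h3 : 4 * (Lam⁻¹ * ‖T p‖ ^ 2) ≤ Lam * (2 * (‖p‖ ^ 2 + (Lam⁻¹ * ‖T p‖) ^ 2)) := by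
    rw [← e2, ← e4, ← e1]
    nlinarith
  have h4 : ‖T p‖ ^ 2 ≤ (Lam * ‖p‖) ^ 2 := by
    have e5 : Lam * (2 * (‖p‖ ^ 2 + (Lam⁻¹ * ‖T p‖) ^ 2))
        = 2 * Lam * ‖p‖ ^ 2 + 2 * (Lam⁻¹ * ‖T p‖ ^ 2) := by
      field_simp
    rw [e5] at h3
    have h6 : Lam⁻¹ * ‖T p‖ ^ 2 ≤ Lam * ‖p‖ ^ 2 := by linarith
    calc ‖T p‖ ^ 2 = Lam * (Lam⁻¹ * ‖T p‖ ^ 2) := by field_simp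
      _ ≤ Lam * (Lam * ‖p‖ ^ 2) := by gcongr
      _ = _ := by ring
  exact (sq_le_sq₀ (norm_nonneg _) (by positivity)).1 h4

theorem IsElliptic.memLp {d : ℕ} {lam Lam : ℝ} (hlam : 0 < lam) (hLam : 0 < Lam)
    {Ω : Set (Eucl d)} {A : Eucl d → Matrix (Fin d) (Fin d) ℝ} (hA : IsElliptic lam Lam Ω A)
    {p : Eucl d → Eucl d} (hp : MemLp p 2 (volume.restrict Ω)) :
    MemLp (fun x => Matrix.toEuclideanLin (A x) (p x)) 2 (volume.restrict Ω) := by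
  refine hp.of_le_mul (c := Lam) ?_ ?_
  · refine AEMeasurable.aestronglyMeasurable ?_
    have h1 : AEMeasurable (fun x => fun i => ∑ j, A x i j * p x j) (volume.restrict Ω) := by
      refine aemeasurable_pi_lambda _ fun i => Finset.aemeasurable_fun_sum _ fun j _ => ?_
      exact (hA.measurable i j).mul
        (((EuclideanSpace.proj (𝕜 := ℝ) j).continuous.measurable).comp_aemeasurable hp.1.aemeasurable)
    have h2 := (PiLp.continuous_toLp 2 (fun _ : Fin d => ℝ)).measurable.comp_aemeasurable h1
    exact h2
  · filter_upwards [hA.symmetric, hA.elliptic] with x h1 h2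
    exact norm_toEuclideanLin_le hlam hLam h1 h2 (p x)

theorem tendsto_eLpNorm_mul_sub {d : ℕ} {μ : Measure (Eucl d)} {E : Type*} [NormedAddCommGroup E]
    [NormedSpace ℝ E] {ζ : Eucl d → ℝ} {M : ℝ} (hζ : ∀ x, |ζ x| ≤ M) {f : ℕ → Eucl d → E}
    {f₀ : Eucl d → E}
    (h : Tendsto (fun n => eLpNorm (fun x => f n x - f₀ x) 2 μ) atTop (𝓝 0)) :
    Tendsto (fun n => eLpNorm (fun x => ζ x • f n x - ζ x • f₀ x) 2 μ) atTop (𝓝 0) := by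
  have h1 : Tendsto (fun n => ENNReal.ofReal M * eLpNorm (fun x => f n x - f₀ x) 2 μ) atTop (𝓝 0) := by
    have := ENNReal.Tendsto.const_mul (a := ENNReal.ofReal M) h (Or.inr ENNReal.ofReal_ne_top)
    rwa [mul_zero] at this
  refine tendsto_of_tendsto_of_tendsto_of_le_of_le tendsto_const_nhds h1 (fun _ => zero_le) fun n => ?_
  refine eLpNorm_le_mul_eLpNorm_of_ae_le_mul (Eventually.of_forall fun x => ?_) 2
  rw [← smul_sub, norm_smul]
  gcongr
  exact hζ x

theorem gradient_mul_eq {d : ℕ} {f k : Eucl d → ℝ} (hf : ContDiff ℝ 1 f) (hk : ContDiff ℝ 1 k)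
    (x : Eucl d) : gradient (fun x => f x * k x) x = f x • gradient k x + k x • gradient f x := by
  have h := ((hf.differentiable (by simp) x).hasFDerivAt.mul
    (hk.differentiable (by simp) x).hasFDerivAt).fderiv
  have e : (fun x => f x * k x) = f * k := rfl
  rw [gradient, gradient, gradient, e, h, map_add, map_smul, map_smul]

theorem memLp_smul_of_bdd {d : ℕ} {μ : Measure (Eucl d)} {E : Type*} [NormedAddCommGroup E]
    [NormedSpace ℝ E] {ζ : Eucl d → ℝ} (hζc : Continuous ζ) {M : ℝ} (hζ : ∀ x, |ζ x| ≤ M)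
    {f : Eucl d → E} (hf : MemLp f 2 μ) : MemLp (fun x => ζ x • f x) 2 μ := by
  refine hf.of_le_mul (c := M) (hζc.aestronglyMeasurable.smul hf.1) (Eventually.of_forall fun x => ?_)
  rw [norm_smul]
  gcongr
  exact hζ x

theorem memLp_smul_of_bdd_right {d : ℕ} {μ : Measure (Eucl d)} {E : Type*} [NormedAddCommGroup E]
    [NormedSpace ℝ E] {ζ : Eucl d → E} (hζc : Continuous ζ) {M : ℝ} (hζ : ∀ x, ‖ζ x‖ ≤ M)
    {f : Eucl d → ℝ} (hf : MemLp f 2 μ) : MemLp (fun x => f x • ζ x) 2 μ := by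
  refine hf.of_le_mul (c := M) (hf.1.smul hζc.aestronglyMeasurable) (Eventually.of_forall fun x => ?_)
  rw [norm_smul, mul_comm]
  gcongr
  exact hζ x

theorem integrable_inner_of_memLp {d : ℕ} {μ : Measure (Eucl d)} {f g : Eucl d → Eucl d}
    (hf : MemLp f 2 μ) (hg : MemLp g 2 μ) : Integrable (fun x => inner ℝ (f x) (g x)) μ := by
  refine (L2.integrable_inner (𝕜 := ℝ) (hf.toLp f) (hg.toLp g)).congr ?_
  filter_upwards [hf.coeFn_toLp, hg.coeFn_toLp] with x h1 h2
  rw [h1, h2]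

/-- A weak equation can be tested against the product of a squared cut-off function and a Sobolev
function. -/
theorem integral_inner_eq_of_forall_test {d : ℕ} {Ω : Set (Eucl d)} (hΩ : IsOpen Ω)
    {F : Eucl d → Eucl d} {S : Eucl d → ℝ} (hF : MemLp F 2 (volume.restrict Ω))
    (hS : MemLp S 2 (volume.restrict Ω))
    (heq : ∀ φ, IsTestFunction Ω φ → ∫ x in Ω, inner ℝ (F x) (gradient φ x) = ∫ x in Ω, S x * φ x)
    {w : Eucl d → ℝ} {k : Eucl d → Eucl d} (hw : MemLp w 2 (volume.restrict Ω))
    (hk : MemLp k 2 (volume.restrict Ω)) (hwk : HasWeakGradient Ω w k)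
    {η : Eucl d → ℝ} (hη : IsTestFunction Ω η) :
    ∫ x in Ω, inner ℝ (F x) (η x ^ 2 • k x + w x • (2 * η x) • gradient η x)
      = ∫ x in Ω, S x * (η x ^ 2 * w x) := by
  set K := tsupport η with hKdef
  have hK : IsCompact K := hη.compact
  have hKΩ : K ⊆ Ω := hη.support
  obtain ⟨ε, hε, hεK⟩ := hK.exists_cthickening_subset_open hΩ hKΩ
  -- η² v n is a genuine test function whose gradient converges in L² to that of η² w; as F and S
  -- are square integrable, the identity passes to the limit.
  obtain ⟨v, hv, hvw, hvk⟩ := exists_smooth_approx hΩ.measurableSet hK.measurableSet hε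
    (fun x hx => (closedBall_subset_cthickening hx ε).trans hεK) hw hk hwk
  have hη0 : ∀ x ∉ K, η x = 0 := fun x hx => image_eq_zero_of_notMem_tsupport hx
  have hη1 : ContDiff ℝ 1 η := hη.smooth.of_le (by exact_mod_cast le_top)
  have hgc : Continuous (gradient η) := continuous_gradient hη1
  have hv1 : ∀ n, ContDiff ℝ 1 (v n) := fun n => (hv n).of_le (by exact_mod_cast le_top)
  have hμ : (volume.restrict K : Measure (Eucl d)) ≤ volume.restrict Ω :=
    Measure.restrict_mono hKΩ le_rfl
  have hη2c : Continuous fun x => η x ^ 2 := hη1.continuous.pow 2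
  have hζc : Continuous fun x => (2 * η x) • gradient η x :=
    (continuous_const.mul hη1.continuous).smul hgc
  have hη2s : HasCompactSupport fun x => η x ^ 2 := by
    simp_rw [sq]; exact hη.compact.mul_left
  have hζs : HasCompactSupport fun x => (2 * η x) • gradient η x :=
    HasCompactSupport.smul_right (f := fun x => 2 * η x) hη.compact.mul_left
  obtain ⟨M, hM⟩ := hη2c.bounded_above_of_compact_support hη2s
  obtain ⟨M', hM'⟩ := hζc.bounded_above_of_compact_support hζs
  have e1 : ∀ {f : Eucl d → Eucl d} {a : Eucl d → ℝ},
      ∫ x in Ω, inner ℝ (F x) (η x ^ 2 • f x + a x • (2 * η x) • gradient η x)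
      = ∫ x in K, inner ℝ (F x) (η x ^ 2 • f x + a x • (2 * η x) • gradient η x) := fun {f a} =>
    setIntegral_eq_of_subset_of_forall_sdiff_eq_zero hΩ.measurableSet hKΩ fun x hx => by
      rw [hη0 x hx.2]; simp
  have e2 : ∀ {a : Eucl d → ℝ}, ∫ x in Ω, S x * (η x ^ 2 * a x)
      = ∫ x in K, S x * (η x ^ 2 * a x) := fun {a} =>
    setIntegral_eq_of_subset_of_forall_sdiff_eq_zero hΩ.measurableSet hKΩ fun x hx => by
      rw [hη0 x hx.2]; simp
  have happrox : ∀ n, ∫ x in K, inner ℝ (F x)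
      (η x ^ 2 • gradient (v n) x + v n x • (2 * η x) • gradient η x)
      = ∫ x in K, S x * (η x ^ 2 * v n x) := by
    intro n
    have ht : IsTestFunction Ω fun x => η x ^ 2 * v n x := by
      refine ⟨(hη.smooth.pow 2).mul (hv n), hη2s.mul_right, ?_⟩
      refine (closure_minimal (fun x hx => ?_) (isClosed_tsupport η)).trans hη.support
      by_contra hcon
      exact hx (by simp [image_eq_zero_of_notMem_tsupport hcon])
    have h := heq _ ht
    rw [← e1, ← e2, ← h]
    congr 1 with x
    congr 1
    rw [gradient_mul_eq (hη1.pow 2) (hv1 n)]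
    congr 2
    have : gradient (fun x => η x ^ 2) x = (2 * η x) • gradient η x :=
      gradient_comp (G := fun t => t ^ 2) (G' := fun t => 2 * t)
        (by simpa using hasDerivAt_pow 2 (η x)) (hη1.differentiable (by simp) x)
    exact this.symm
  have hFK := hF.mono_measure hμ
  have hSK := hS.mono_measure hμ
  have hwK := hw.mono_measure hμ
  have hkK := hk.mono_measure hμ
  have hvK : ∀ n, MemLp (v n) 2 (volume.restrict K) := fun n =>
    (hv n).continuous.memLp_restrict_of_isCompact hK 2
  have hgvK : ∀ n, MemLp (gradient (v n)) 2 (volume.restrict K) := fun n =>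
    (continuous_gradient (hv1 n)).memLp_restrict_of_isCompact hK 2
  have lim1 := tendsto_integral_inner (μ := volume.restrict K) (a := fun _ => F)
    (b := fun n x => η x ^ 2 • gradient (v n) x + v n x • (2 * η x) • gradient η x)
    (a₀ := F) (b₀ := fun x => η x ^ 2 • k x + w x • (2 * η x) • gradient η x)
    (fun _ => hFK)
    (fun n => (memLp_smul_of_bdd hη2c hM (hgvK n)).add (memLp_smul_of_bdd_right hζc hM' (hvK n)))
    hFK ((memLp_smul_of_bdd hη2c hM hkK).add (memLp_smul_of_bdd_right hζc hM' hwK))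
    (by simp)
    (by
      have t1 := tendsto_eLpNorm_mul_sub (ζ := fun x => η x ^ 2) hM hvk
      have t2 : Tendsto (fun n => ENNReal.ofReal M' *
          eLpNorm (fun x => v n x - w x) 2 (volume.restrict K)) atTop (𝓝 0) := by
        have := ENNReal.Tendsto.const_mul (a := ENNReal.ofReal M') hvw (Or.inr ENNReal.ofReal_ne_top)
        rwa [mul_zero] at this
      have t3 := t1.add t2
      rw [add_zero] at t3
      refine tendsto_of_tendsto_of_tendsto_of_le_of_le tendsto_const_nhds t3 (fun _ => zero_le)
        fun n => ?_
      have e : (fun x => η x ^ 2 • gradient (v n) x + v n x • (2 * η x) • gradient η x -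
          (η x ^ 2 • k x + w x • (2 * η x) • gradient η x))
          = (fun x => η x ^ 2 • gradient (v n) x - η x ^ 2 • k x)
            + fun x => (v n x - w x) • (2 * η x) • gradient η x := by
        ext1 x
        simp only [Pi.add_apply, sub_smul]
        abel
      have hd : MemLp (fun x => v n x - w x) 2 (volume.restrict K) := (hvK n).sub hwK
      rw [e]
      refine (eLpNorm_add_le (((memLp_smul_of_bdd hη2c hM (hgvK n)).sub
        (memLp_smul_of_bdd hη2c hM hkK)).1) (memLp_smul_of_bdd_right hζc hM' hd).1
        (by norm_num)).trans (add_le_add le_rfl ?_)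
      refine eLpNorm_le_mul_eLpNorm_of_ae_le_mul (Eventually.of_forall fun x => ?_) 2
      rw [norm_smul, mul_comm]
      gcongr
      exact hM' x)
  have lim2 := tendsto_integral_inner (μ := volume.restrict K) (a := fun _ => S)
    (b := fun n x => η x ^ 2 • v n x) (a₀ := S) (b₀ := fun x => η x ^ 2 • w x)
    (fun _ => hSK) (fun n => memLp_smul_of_bdd hη2c hM (hvK n)) hSK
    (memLp_smul_of_bdd hη2c hM hwK) (by simp) (tendsto_eLpNorm_mul_sub hM hvw)
  have hinner : ∀ a b : ℝ, inner ℝ a b = a * b := fun a b => by simp [mul_comm]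
  simp only [hinner, smul_eq_mul] at lim2
  rw [e1, e2]
  simp_rw [happrox] at lim1
  exact tendsto_nhds_unique lim1 lim2

/-- Absorption of the mixed term in the Caccioppoli inequality. -/
theorem quadratic_absorb {d : ℕ} {lam Lam : ℝ} (hlam : 0 < lam)
    {A : Matrix (Fin d) (Fin d) ℝ} (hA : A.IsSymm)
    (h : ∀ ξ : Eucl d, lam * ‖ξ‖ ^ 2 ≤ inner ℝ (Matrix.toEuclideanLin A ξ) ξ ∧
      inner ℝ (Matrix.toEuclideanLin A ξ) ξ ≤ Lam * ‖ξ‖ ^ 2) (p q : Eucl d) (η w : ℝ) :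
    lam / 2 * (η ^ 2 * ‖p‖ ^ 2) ≤ inner ℝ (Matrix.toEuclideanLin A p) (η ^ 2 • p + w • (2 * η) • q)
      + 2 * Lam * (w ^ 2 * ‖q‖ ^ 2) := by
  set T := Matrix.toEuclideanLin A with hT
  have hsymm : T.IsSymmetric := Matrix.isSymmetric_toEuclideanLin_iff.2 (by
    rw [Matrix.IsHermitian, Matrix.conjTranspose_eq_transpose_of_trivial]; exact hA)
  -- Half of this nonnegative form bounds the mixed term 2 η w ⟨T p, q⟩ below by -½ η² ⟨T p, p⟩ - 2
  -- w² ⟨T q, q⟩, leaving half of the coercive term.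
  have h1 : 0 ≤ inner ℝ (T (η • p + (2 * w) • q)) (η • p + (2 * w) • q) :=
    le_trans (by positivity) (h _).1
  have h2 := (h p).1
  have h3 := (h q).2
  have hs : inner ℝ (T q) p = inner ℝ (T p) q := by rw [hsymm q p, real_inner_comm]
  simp only [map_add, map_smul, inner_add_left, inner_add_right, inner_smul_left, inner_smul_right,
    hs, conj_trivial] at h1 ⊢
  have h4 : η ^ 2 * (lam * ‖p‖ ^ 2) ≤ η ^ 2 * inner ℝ (T p) p := by gcongr
  have h5 : w ^ 2 * inner ℝ (T q) q ≤ w ^ 2 * (Lam * ‖q‖ ^ 2) := by gcongr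
  nlinarith

/-- Caccioppoli's inequality for the truncations of a weak solution. -/
theorem exists_localEnergyEstimate (lam Lam : ℝ) (hlam : 0 < lam) (hLam : 0 < Lam) :
    ∃ C : ℝ, 1 ≤ C ∧ ∀ (d : ℕ) (Ω : Set (Eucl d)), IsOpen Ω → volume Ω ≠ ⊤ →
      ∀ (A : Eucl d → Matrix (Fin d) (Fin d) ℝ) (S u : Eucl d → ℝ) (p : Eucl d → Eucl d),
      IsElliptic lam Lam Ω A → MemLp S 2 (volume.restrict Ω) → MemLp u 2 (volume.restrict Ω) →
      MemLp p 2 (volume.restrict Ω) → HasWeakGradient Ω u p →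
      (∀ φ, IsTestFunction Ω φ →
        ∫ x in Ω, inner ℝ (Matrix.toEuclideanLin (A x) (p x)) (gradient φ x) = ∫ x in Ω, S x * φ x) →
      ∀ κ : ℝ, LocalEnergyEstimate C Ω S (fun x => max (u x - κ) 0) := by
  obtain ⟨K, hK, hcut⟩ := exists_cutoff
  -- 2 Lam comes from the mixed term, K² from the cut-off gradient, and 2/lam from dividing by the
  -- remaining coercivity lam/2.
  set C₁ := 4 * Lam / lam * K ^ 2 with hC₁
  set C := max 1 (max C₁ (2 / lam)) with hC
  refine ⟨C, le_max_left _ _, fun d Ω hΩ hfin A S u p hA hS hu hp hup heq κ x₀ R r hR hr hrR => ?_⟩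
  obtain ⟨η, hη, hη0, hη1, hηr, hηK⟩ := hcut d x₀ r R hr hrR
  have hηΩ : IsTestFunction Ω η := ⟨hη.smooth, hη.compact, hη.support.trans hR⟩
  set w : Eucl d → ℝ := fun x => max (u x - κ) 0 with hw
  set k : Eucl d → Eucl d := {x | κ < u x}.indicator p with hk
  have hw0 : ∀ x, 0 ≤ w x := fun x => le_max_right _ _
  have hwL : MemLp w 2 (volume.restrict Ω) := memLp_max_sub hfin hu κ
  have hkL : MemLp k 2 (volume.restrict Ω) := memLp_indicator_lt hu.1 hp κ
  have hwk : HasWeakGradient Ω w k := hup.max_sub hΩ hfin hu hp κ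
  have hid := integral_inner_eq_of_forall_test hΩ (hA.memLp hlam hLam hp) hS heq hwL hkL hwk hηΩ
  have hη1' : ContDiff ℝ 1 η := hη.smooth.of_le (by exact_mod_cast le_top)
  have hηc := hη1'.continuous
  have hgc : Continuous (gradient η) := continuous_gradient hη1'
  have hRr : 0 < R - r := by linarith
  have hη2b : ∀ x, |η x ^ 2| ≤ 1 := fun x => by
    rw [abs_of_nonneg (sq_nonneg _)]; exact pow_le_one₀ (hη0 x) (hη1 x)
  have hζb : ∀ x, ‖(2 * η x) • gradient η x‖ ≤ 2 * (K / (R - r)) := fun x => by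
    rw [norm_smul, Real.norm_of_nonneg (by have := hη0 x; positivity)]
    have := hη1 x
    calc 2 * η x * ‖gradient η x‖ ≤ 2 * 1 * (K / (R - r)) := by
          gcongr
          exact hηK x
      _ = _ := by ring
  -- Where u ≤ κ both the truncation and its gradient vanish, so the flux of u may be replaced by
  -- that of the truncation.
  have hpk : ∀ x, inner ℝ (Matrix.toEuclideanLin (A x) (p x))
      (η x ^ 2 • k x + w x • (2 * η x) • gradient η x)
      = inner ℝ (Matrix.toEuclideanLin (A x) (k x))
        (η x ^ 2 • k x + w x • (2 * η x) • gradient η x) := by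
    intro x
    by_cases hx : κ < u x
    · rw [hk, Set.indicator_of_mem (by exact hx)]
    · have h1 : k x = 0 := Set.indicator_of_notMem (by exact hx) _
      have h2 : w x = 0 := max_eq_right (by linarith)
      rw [h1, h2]; simp
  have hsq : Integrable (fun x => ‖k x‖ ^ 2) (volume.restrict Ω) :=
    (memLp_two_iff_integrable_sq_norm hkL.1).1 hkL
  have hi1 : Integrable (fun x => η x ^ 2 * ‖k x‖ ^ 2) (volume.restrict Ω) :=
    hsq.bdd_mul (hηc.pow 2).aestronglyMeasurable (c := 1) (Eventually.of_forall hη2b)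
  have hi2 : Integrable (fun x => w x ^ 2 * ‖gradient η x‖ ^ 2) (volume.restrict Ω) := by
    refine hwL.integrable_sq.mul_bdd (c := (K / (R - r)) ^ 2) (hgc.norm.pow 2).aestronglyMeasurable
      (Eventually.of_forall fun x => ?_)
    rw [norm_pow, norm_norm]
    gcongr
    exact hηK x
  have hbL : MemLp (fun x => η x ^ 2 • k x + w x • (2 * η x) • gradient η x) 2
      (volume.restrict Ω) :=
    (memLp_smul_of_bdd (hηc.pow 2) hη2b hkL).add (memLp_smul_of_bdd_right
      ((continuous_const.mul hηc).smul hgc) hζb hwL)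
  have hi3 : Integrable (fun x => inner ℝ (Matrix.toEuclideanLin (A x) (p x))
      (η x ^ 2 • k x + w x • (2 * η x) • gradient η x)) (volume.restrict Ω) :=
    integrable_inner_of_memLp (hA.memLp hlam hLam hp) hbL
  have hmain : lam / 2 * ∫ x in Ω, η x ^ 2 * ‖k x‖ ^ 2
      ≤ (∫ x in Ω, S x * (η x ^ 2 * w x)) + 2 * Lam * ∫ x in Ω, w x ^ 2 * ‖gradient η x‖ ^ 2 := by
    rw [← hid, ← integral_const_mul, ← integral_const_mul, ← integral_add hi3 (hi2.const_mul _)]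
    refine integral_mono_ae (hi1.const_mul _) (hi3.add (hi2.const_mul _)) ?_
    filter_upwards [hA.symmetric, hA.elliptic] with x h1 h2
    rw [hpk x]
    exact quadratic_absorb hlam h1 h2 (k x) (gradient η x) (η x) (w x)
  have hrsub : ball x₀ r ⊆ Ω := (ball_subset_ball hrR.le).trans hR
  have hl : ∫ x in ball x₀ r, ‖weakGrad Ω w x‖ ^ 2 ≤ ∫ x in Ω, η x ^ 2 * ‖k x‖ ^ 2 := by
    have e : ∫ x in ball x₀ r, ‖weakGrad Ω w x‖ ^ 2 = ∫ x in ball x₀ r, η x ^ 2 * ‖k x‖ ^ 2 := by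
      refine integral_congr_ae ?_
      filter_upwards [ae_restrict_of_ae_restrict_of_subset hrsub (hwk.weakGrad_ae_eq hΩ),
        ae_restrict_mem measurableSet_ball] with x hx hxr
      rw [hx, hηr x hxr]; ring
    rw [e]
    exact setIntegral_mono_set hi1 (Eventually.of_forall fun x => by positivity)
      (Eventually.of_forall hrsub)
  have hout : ∀ x, x ∉ ball x₀ R → gradient η x = 0 := by
    intro x hx
    have : fderiv ℝ η x = 0 := by
      by_contra hne
      exact hx (hη.support (support_fderiv_subset ℝ (f := η) hne))
    rw [gradient, this, map_zero]
  have hwR : MemLp w 2 (volume.restrict (ball x₀ R)) := hwL.mono_measure (Measure.restrict_mono hR le_rfl)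
  have hSR : MemLp S 2 (volume.restrict (ball x₀ R)) := hS.mono_measure (Measure.restrict_mono hR le_rfl)
  have hr1 : ∫ x in Ω, w x ^ 2 * ‖gradient η x‖ ^ 2
      ≤ K ^ 2 / (R - r) ^ 2 * ∫ x in ball x₀ R, w x ^ 2 := by
    rw [setIntegral_eq_of_subset_of_forall_sdiff_eq_zero hΩ.measurableSet hR fun x hx => by
      rw [hout x hx.2]; simp, ← integral_const_mul]
    refine integral_mono (hi2.mono_measure (Measure.restrict_mono hR le_rfl))
      (hwR.integrable_sq.const_mul _) fun x => ?_
    dsimp only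
    rw [mul_comm, ← div_pow]
    gcongr
    exact hηK x
  have hr2 : ∫ x in Ω, S x * (η x ^ 2 * w x) ≤ ∫ x in ball x₀ R, |S x| * w x := by
    rw [setIntegral_eq_of_subset_of_forall_sdiff_eq_zero hΩ.measurableSet hR fun x hx => by
      rw [image_eq_zero_of_notMem_tsupport fun h => hx.2 (hη.support h)]; simp]
    have hηw : MemLp (fun x => η x ^ 2 • w x) 2 (volume.restrict (ball x₀ R)) :=
      memLp_smul_of_bdd (hηc.pow 2) hη2b hwR
    refine integral_mono (hSR.integrable_mul hηw) (hSR.abs.integrable_mul hwR) fun x => ?_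
    dsimp only
    have h1 : η x ^ 2 * w x ≤ w x := mul_le_of_le_one_left (hw0 x) ((le_abs_self _).trans (hη2b x))
    have h2 : 0 ≤ η x ^ 2 * w x := mul_nonneg (sq_nonneg _) (hw0 x)
    calc S x * (η x ^ 2 * w x) ≤ |S x| * (η x ^ 2 * w x) := by gcongr; exact le_abs_self _
      _ ≤ _ := by gcongr
  have hW0 : 0 ≤ ∫ x in ball x₀ R, w x ^ 2 := integral_nonneg fun x => sq_nonneg _
  have hSw0 : 0 ≤ ∫ x in ball x₀ R, |S x| * w x :=
    integral_nonneg fun x => mul_nonneg (abs_nonneg _) (hw0 x)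
  have hfinal : ∫ x in Ω, η x ^ 2 * ‖k x‖ ^ 2 ≤ C₁ / (R - r) ^ 2 * (∫ x in ball x₀ R, w x ^ 2)
      + 2 / lam * ∫ x in ball x₀ R, |S x| * w x := by
    have h1 : lam / 2 * ∫ x in Ω, η x ^ 2 * ‖k x‖ ^ 2 ≤ (∫ x in ball x₀ R, |S x| * w x)
        + 2 * Lam * (K ^ 2 / (R - r) ^ 2 * ∫ x in ball x₀ R, w x ^ 2) := by
      refine hmain.trans ?_
      gcongr
    calc ∫ x in Ω, η x ^ 2 * ‖k x‖ ^ 2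
        = 2 / lam * (lam / 2 * ∫ x in Ω, η x ^ 2 * ‖k x‖ ^ 2) := by field_simp
      _ ≤ 2 / lam * ((∫ x in ball x₀ R, |S x| * w x)
        + 2 * Lam * (K ^ 2 / (R - r) ^ 2 * ∫ x in ball x₀ R, w x ^ 2)) := by gcongr
      _ = _ := by rw [hC₁]; ring
  refine hl.trans (hfinal.trans ?_)
  have hc1 : C₁ ≤ C := (le_max_left _ _).trans (le_max_right _ _)
  have hc2 : 2 / lam ≤ C := (le_max_right _ _).trans (le_max_right _ _)
  gcongr

/-- Weak solutions of elliptic equations belong to a De Giorgi class. -/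
theorem IsWeakSolution.exists_DG (lam Lam : ℝ) (hlam : 0 < lam) (hLam : 0 < Lam) :
    ∃ C : ℝ, 1 ≤ C ∧ ∀ (d : ℕ) (Ω : Set (Eucl d)), IsOpen Ω → volume Ω ≠ ⊤ →
      ∀ (A : Eucl d → Matrix (Fin d) (Fin d) ℝ) (S u : Eucl d → ℝ),
      IsElliptic lam Lam Ω A → MemLp S 2 (volume.restrict Ω) → IsWeakSolution Ω A S u →
      DG C C Ω S u := by
  obtain ⟨C, hC, h⟩ := exists_localEnergyEstimate lam Lam hlam hLam
  refine ⟨C, hC, fun d Ω hΩ hfin A S u hA hS hu => ?_⟩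
  obtain ⟨huL, g, hg, hug⟩ := hu.memH1
  have hgae := hug.weakGrad_ae_eq hΩ
  have heq : ∀ φ, IsTestFunction Ω φ →
      ∫ x in Ω, inner ℝ (Matrix.toEuclideanLin (A x) (g x)) (gradient φ x) = ∫ x in Ω, S x * φ x := by
    intro φ hφ
    rw [← hu.weak_eq φ hφ]
    refine integral_congr_ae ?_
    filter_upwards [hgae] with x hx
    rw [hx]
  refine ⟨⟨hS, hu.memH1, hC, h d Ω hΩ hfin A S u g hA hS huL hg hug heq⟩,
    ⟨hS, hu.memH1, hC, fun κ => ?_⟩⟩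
  -- By linearity -u solves the equation with source -S, and the energy estimate sees only |S|.
  have hneg := h d Ω hΩ hfin A (fun x => -S x) (fun x => -u x) (fun x => -g x) hA hS.neg huL.neg
    hg.neg hug.neg (fun φ hφ => by
      simp only [map_neg, inner_neg_left, neg_mul, integral_neg, heq φ hφ]) (-κ)
  have e : (fun x => max (-(u x - κ)) 0) = fun x => max (-u x - -κ) 0 := by
    ext x; congr 1; ring
  rw [e]
  intro x₀ R r hR hr hrR
  simpa only [abs_neg] using hneg x₀ R r hR hr hrR

end DeGiorgi

theorem theoremt (d : ℕ) (hd : 1 ≤ d) :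
    -- functions in the De Giorgi class
    (∀ Cp Cm : ℝ, 1 ≤ Cp → 1 ≤ Cm →
      ∃ (α : ℝ≥0) (C : ℝ), 0 < α ∧ α ≤ 1 ∧ 0 < C ∧
        ∀ S u : DeGiorgi.Eucl d → ℝ,
          MemLp S ∞ (volume.restrict (ball 0 1)) →
          DeGiorgi.DG Cp Cm (ball 0 1) S u →
          ∃ v : DeGiorgi.Eucl d → ℝ,
            (∀ᵐ x ∂(volume.restrict (ball 0 1)), v x = u x) ∧
            (∀ r : ℝ, r < 1 → ∃ K : ℝ≥0, HolderOnWith K α v (ball 0 r)) ∧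
            DeGiorgi.holderNorm α (ball 0 (1 / 2)) v
              ≤ ENNReal.ofReal C * (eLpNorm u 2 (volume.restrict (ball 0 1))
                  + eLpNorm S ∞ (volume.restrict (ball 0 1)))) ∧
    -- in particular, weak solutions of elliptic equations
    (∀ lam Lam : ℝ, 0 < lam → 0 < Lam →
      ∃ (Cp Cm : ℝ) (α : ℝ≥0) (C : ℝ), 1 ≤ Cp ∧ 1 ≤ Cm ∧ 0 < α ∧ α ≤ 1 ∧ 0 < C ∧
        ∀ (A : DeGiorgi.Eucl d → Matrix (Fin d) (Fin d) ℝ) (S u : DeGiorgi.Eucl d → ℝ),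
          DeGiorgi.IsElliptic lam Lam (ball 0 1) A →
          MemLp S ∞ (volume.restrict (ball 0 1)) →
          DeGiorgi.IsWeakSolution (ball 0 1) A S u →
          DeGiorgi.DG Cp Cm (ball 0 1) S u ∧
          ∃ v : DeGiorgi.Eucl d → ℝ,
            (∀ᵐ x ∂(volume.restrict (ball 0 1)), v x = u x) ∧
            (∀ r : ℝ, r < 1 → ∃ K : ℝ≥0, HolderOnWith K α v (ball 0 r)) ∧
            DeGiorgi.holderNorm α (ball 0 (1 / 2)) v
              ≤ ENNReal.ofReal C * (eLpNorm u 2 (volume.restrict (ball 0 1))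
                  + eLpNorm S ∞ (volume.restrict (ball 0 1)))) := by
  refine ⟨fun Cp Cm hCp _ => DeGiorgi.DG.exists_holder d hCp, fun lam Lam hlam hLam => ?_⟩
  obtain ⟨C₀, hC₀, hDG⟩ := DeGiorgi.IsWeakSolution.exists_DG lam Lam hlam hLam
  obtain ⟨α, C, hα, hα1, hC, h⟩ := DeGiorgi.DG.exists_holder d (Cm := C₀) hC₀
  refine ⟨C₀, C₀, α, C, hC₀, hC₀, hα, hα1, hC, fun A S u hA hS hu => ?_⟩
  have hfin : IsFiniteMeasure (volume.restrict (ball (0 : DeGiorgi.Eucl d) 1)) :=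
    ⟨by rw [Measure.restrict_apply_univ]; exact measure_ball_lt_top⟩
  have hmem := hDG d (ball 0 1) isOpen_ball measure_ball_lt_top.ne A S u hA
    (hS.mono_exponent le_top) hu
  exact ⟨hmem, h S u hS hmem⟩
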